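/- Let $n\ge 1$, let $\mathbb B$ be the open unit ball of $\mathbb C^n$ and $\mathbb S$ its boundary, and let $dV$ and $d\sigma$ be the normalized volume measure on $\mathbb B$ and the normalized surface measure on $\mathbb S$. A radial weight is a positive, measurable and integrable function $\omega$ on $[0,1)$, extended to $\mathbb B$ by $\omega(z)=\omega(|z|)$; put $\hat\omega(r)=\int_r^1\omega(t)\,dt$, and write $\omega\in\hat{\mathcal D}$ if there is $C>0$ with $\hat\omega(r)<C\,\hat\omega\left(\frac{1+r}{2}\right)$ for all $0\le r<1$. For $\omega\in\hat{\mathcal D}$ and $z\in\mathbb B$, let $B_z^\omega$ be the reproducing kernel at $z$ of the space $A_\omega^2$ of holomorphic functions on $\mathbb B$ that are square integrable for $\omega\,dV$; that is, $B_z^\omega\in A^2_\omega$ and $f(z)=\int_{\mathbb B} f(w)\overline{B_z^\omega(w)}\,\omega(w)\,dV(w)$ for all $f\in A_\omega^2$. For $0<p<\infty$ and a holomorphic $f$ on $\mathbb B$ put $$M_p^p(r,f)=\int_{\mathbb S}|f(r\xi)|^p\,d\sigma(\xi)\quad(0<r<1),\qquad \|f\|_{A_\upsilon^p}^p=\int_{\mathbb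 B}|f(w)|^p\,\upsilon(w)\,dV(w),\qquad \Re f(w)=\sum_{k=1}^n w_k\frac{\partial f}{\partial w_k}(w).$$ Let $0<p<\infty$ and $\omega\in\hat{\mathcal D}$. Below, $A\approx B$ means that $C^{-1}B\le A\le CB$ with a constant $C>0$ that is independent of $r$ and $z$ (it may depend on $n$, $p$, $\omega$ and, in (ii), on $\upsilon$). (i) For all $0<r<1$ and $z\in\mathbb B$ with $r|z|>\frac14$, $$M_p^p(r,B_z^\omega)\approx\int_0^{r|z|}\frac{dt}{\hat\omega(t)^p(1-t)^{np-n+1}},\qquad M_p^p(r,\Re B_z^\omega)\approx\int_0^{r|z|}\frac{dt}{\hat\omega(t)^p(1-t)^{(n+1)p-n+1}}.$$ (ii) If $\upsilon\in\hat{\mathcal D}$, then for all $z\in\mathbb B$ with $|z|>\frac67$, $$\|B_z^\omega\|_{A_\upsilon^p}^p\approx\int_0^{|z|}\frac{\hat\upsilon(t)\,dt}{\hat\omega(t)^p(1-t)^{np-n+1}},\qquad \|\Re B_z^\omega\|_{A_\upsilon^p}^p\approx\int_0^{|z|}\frac{\hat\upsilon(t)\,dt}{\hat\omega(t)^p(1-t)^{(n+1)p-n+1}}.$$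 -/

import Mathlib

open MeasureTheory Metric
open scoped ENNReal NNReal

noncomputable section

namespace BergmanBall

/-- The complex Euclidean space of dimension `n`, with `|z|² = |z₁|² + ⋯ + |zₙ|²`. -/
abbrev Cn (n : ℕ) : Type := EuclideanSpace ℂ (Fin n)

/-- The normalized volume measure `dV` on the open unit ball, seen as a measure on the whole
space that is carried by the ball: Lebesgue measure conditioned on the ball. -/
def ballMeasure (n : ℕ) : Measure (Cn n) :=
  ProbabilityTheory.cond volume (ball (0 : Cn n) 1)

/-- The normalized surface measure `dσ` on the unit sphere. -/
def sphereMeasure (n : ℕ) : Measure (sphere (0 : Cn n) 1) :=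
  ((volume : Measure (Cn n)).toSphere Set.univ)⁻¹ • (volume : Measure (Cn n)).toSphere

/-- A radial weight, given by its profile on `[0,1)`: a positive, measurable and integrable
function there. The values of `ω` outside `[0,1)` are irrelevant. The weight on the ball is
`z ↦ ω ‖z‖`. -/
structure IsRadialWeight (ω : ℝ → ℝ) : Prop where
  pos : ∀ t ∈ Set.Ico (0 : ℝ) 1, 0 < ω t
  measurable : Measurable fun t : Set.Ico (0 : ℝ) 1 => ω t
  integrable : IntegrableOn ω (Set.Ico 0 1)

/-- The tail integral of `ω` over `[r,1)`. -/
def hat (ω : ℝ → ℝ) (r : ℝ) : ℝ := ∫ t in r..1, ω t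

/-- The class of doubling weights. -/
structure IsDoubling (ω : ℝ → ℝ) : Prop extends IsRadialWeight ω where
  doubling : ∃ C : ℝ, 0 < C ∧ ∀ r ∈ Set.Ico (0 : ℝ) 1, hat ω r < C * hat ω ((1 + r) / 2)

/-- The measure `ω dV` on the unit ball. -/
def weightedMeasure (n : ℕ) (ω : ℝ → ℝ) : Measure (Cn n) :=
  (ballMeasure n).withDensity fun z => ENNReal.ofReal (ω ‖z‖)

/-- The quantity `(∫ |f|^p ω dV)^(1/p)` over the unit ball, as an extended nonnegative real. -/
def bergmanNorm {n : ℕ} (p : ℝ) (ω : ℝ → ℝ) (f : Cn n → ℂ) : ℝ≥0∞ :=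
  eLpNorm f (ENNReal.ofReal p) (weightedMeasure n ω)

/-- Membership in the weighted Bergman space with exponent `2`: holomorphic in the unit ball and
square integrable for `ω dV`. The values of `f` outside the ball are irrelevant. -/
def MemBergmanTwo {n : ℕ} (ω : ℝ → ℝ) (f : Cn n → ℂ) : Prop :=
  DifferentiableOn ℂ f (ball 0 1) ∧ MemLp f 2 (weightedMeasure n ω)

/-- `B` is the element of the Bergman space that represents the evaluation at `z`. -/
def IsKernelAt {n : ℕ} (ω : ℝ → ℝ) (z : Cn n) (B : Cn n → ℂ) : Prop :=
  MemBergmanTwo ω B ∧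
    ∀ f : Cn n → ℂ, MemBergmanTwo ω f →
      f z = ∫ w, f w * (starRingEnd ℂ) (B w) ∂(weightedMeasure n ω)

open Classical in
/-- The reproducing kernel `w ↦ B_z(w)` of the Bergman space with exponent `2` and weight `ω`.
It is determined on the unit ball by `IsKernelAt`; the value is `0` if there were no kernel. -/
def bergmanKernel {n : ℕ} (ω : ℝ → ℝ) (z : Cn n) : Cn n → ℂ :=
  if h : ∃ B : Cn n → ℂ, IsKernelAt ω z B then h.choose else 0

/-- The integral mean `M_p(r, f) = (∫ |f(rξ)|^p dσ(ξ))^(1/p)` over the unit sphere. -/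
def integralMean {n : ℕ} (p r : ℝ) (f : Cn n → ℂ) : ℝ≥0∞ :=
  eLpNorm (fun ξ : sphere (0 : Cn n) 1 => f ((r : ℂ) • (ξ : Cn n))) (ENNReal.ofReal p)
    (sphereMeasure n)

/-- The radial derivative `∑ₖ zₖ ∂f/∂zₖ`. -/
def radialDeriv {n : ℕ} (f : Cn n → ℂ) (z : Cn n) : ℂ :=
  ∑ k : Fin n, z k * fderiv ℂ f z (EuclideanSpace.single k 1)

/-- `A` and `B` are comparable with constant `C`. -/
def Comparable (C : ℝ≥0) (A B : ℝ≥0∞) : Prop := A ≤ C * B ∧ B ≤ C * A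

end BergmanBall

end

/-! The kernel is a power series in one variable. By unitary invariance of `ω dV`, pairing a
holomorphic `f` with the conjugate of `⟨w, e⟩ ^ k`, `|e| = 1`, gives `m_k` times the `k`-th Taylor
coefficient of the slice `l ↦ f (l e)`, where `m_k = ∫ |⟨w, e⟩|^(2k) ω dV` does not depend on `e`
(`integral_mul_conj_inner_pow`). Hence `B_z(w) = ∑ ⟨w, z⟩ ^ k / m_k` (`isKernelAt_discSeries`), and
the radial derivative multiplies the `k`-th coefficient by `k`.

Size of the series. The numbers `m_k` are the moments of the law of `|⟨w, e⟩|²`, which gives `[1 -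
s, 1]` a mass comparable to `V(s) = s^(n-1) ω̂(1 - s)`. Doubling makes `m_k` comparable to
`V(1/(k+1))`. Each difference of moments inserts a factor `1 - y` under the integral, which gains
`1/(k+1)`; so the moments, their reciprocals and the reciprocals times `k` satisfy symbol estimates
of every order (`moment_symbolBound`, `SymbolBound.inv`, `SymbolBound.mul`). Repeated summation by
parts then bounds the series `F` by a multiple of `1/U(min(|1 - λ|, 1))` on the whole disc, with
`U(s) = s^(q+1) V(s)`, `q = 0` for the kernel and `q = 1` for its radial derivative. Nonnegative
coefficients give the reverse bound on the positive radius. Only these two facts, recorded in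
`SizeLike`, enter the means.

Upper bound for means. A nonisotropic ball of radius `s` on the sphere has measure at most a
multiple of `s^n`, so summing over scales bounds the mean by `∫ s^(n-1) U(s)^(-p) ds` over `1 - ρ <
s ≤ 1` (`SizeLike.lintegral_sphere_le`). With `t = 1 - s` this is the integral of the theorem.

Lower bound for means. `F` is bounded below on a radius only, so this information has to be spread
over the sphere. The Poisson formula at `1 - s`, for `F(ρζ)` damped by a power of `(1 - ζ)/(1 + s -
ζ)`, bounds `U(s)^(-p)` by the circular mean of `|F|^p` against the weight `|1 - ζ| s / (s + |1 -
ζ|)^3` (`SizeLike.le_circleAverage`). Damping is what makes every `p > 0` accessible. It also leaves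
a factor `|1 - ζ|` in the weight, whose integral in `s` is then at most `1`, so that all scales can
be added without loss. Averaging over the tube `|⟨ξ, e⟩| ≥ 1 - s`, of measure comparable to
`s^(n-1)`, and integrating in `s` gives `SizeLike.le_lintegral_sphere`.

For the weighted norms, the means are integrated in polar coordinates against `υ` and the two radial
integrals are exchanged. The inner one becomes a tail of `υ`, and doubling absorbs the shift of its
endpoint caused by `|z| < 1`. -/

noncomputable section

namespace BergmanBall

/-! ### Growth functions of doubling type -/

/-- A positive increasing function on `(0,1]` of at most polynomial growth from every point. -/
structure TailFn (V : ℝ → ℝ) (C : ℝ) (M : ℕ) : Prop where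
  pos : ∀ s, 0 < s → s ≤ 1 → 0 < V s
  mono : ∀ s t, 0 < t → t ≤ s → s ≤ 1 → V t ≤ V s
  growth : ∀ s t, 0 < t → t ≤ s → s ≤ 1 → V s ≤ C * (s / t) ^ M * V t

namespace TailFn

lemma one_le {V : ℝ → ℝ} {C : ℝ} {M : ℕ} (h : TailFn V C M) : 1 ≤ C := by
  have h1 := h.growth 1 1 one_pos le_rfl le_rfl
  have h2 := h.pos 1 one_pos le_rfl
  simp only [div_one, one_pow, mul_one] at h1
  by_contra hC
  nlinarith

/-- Iterating the doubling inequality: with `D < 2 ^ M`, each halving of `s` costs a factor `2 ^ M`,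
which is exactly what `(s / t) ^ M` loses. The last, incomplete halving is paid for by monotonicity
and gives the constant `2 ^ M`. -/
lemma of_doubling {V : ℝ → ℝ} {D : ℝ} (pos : ∀ s, 0 < s → s ≤ 1 → 0 < V s)
    (mono : ∀ s t, 0 < t → t ≤ s → s ≤ 1 → V t ≤ V s)
    (hD : ∀ s, 0 < s → s ≤ 1 → V s ≤ D * V (s / 2)) : ∃ C M, TailFn V C M := by
  obtain ⟨M, hM⟩ := pow_unbounded_of_one_lt D (one_lt_two : (1 : ℝ) < 2)
  refine ⟨2 ^ M, M, pos, mono, ?_⟩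
  have hM' : ∀ s, 0 < s → s ≤ 1 → V s ≤ 2 ^ M * V (s / 2) := fun s h0 h1 =>
    (hD s h0 h1).trans (mul_le_mul_of_nonneg_right hM.le (pos _ (by linarith) (by linarith)).le)
  have key : ∀ i : ℕ, ∀ s t, 0 < t → t ≤ s → s ≤ 1 → s < 2 ^ i * t →
      V s ≤ 2 ^ M * (s / t) ^ M * V t := by
    intro i
    induction i with
    | zero => intro s t ht hts hs h; simp at h; linarith
    | succ i ih =>
      intro s t ht hts hs h
      have hs0 : 0 < s := by linarith
      refine (hM' s hs0 hs).trans ?_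
      by_cases h2 : s < 2 * t
      · have h3 : V (s / 2) ≤ V t := mono _ _ (by linarith) (by linarith) (by linarith)
        have h4 : (1 : ℝ) ≤ (s / t) ^ M := one_le_pow₀ ((one_le_div ht).2 hts)
        have h5 := (pos t ht (by linarith)).le
        calc (2 : ℝ) ^ M * V (s / 2) ≤ 2 ^ M * (1 * V t) := by rw [one_mul]; gcongr
          _ ≤ 2 ^ M * ((s / t) ^ M * V t) := by gcongr
          _ = _ := by ring
      · have h3 := ih (s / 2) t ht (by linarith) (by linarith) (by rw [pow_succ] at h; linarith)
        calc (2 : ℝ) ^ M * V (s / 2) ≤ 2 ^ M * (2 ^ M * (s / 2 / t) ^ M * V t) := by gcongr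
          _ = 2 ^ M * (2 * (s / 2 / t)) ^ M * V t := by rw [mul_pow]; ring
          _ = _ := by congr 3; ring
  intro s t ht hts hs
  obtain ⟨i, hi⟩ := pow_unbounded_of_one_lt (s / t) (one_lt_two : (1 : ℝ) < 2)
  exact key i s t ht hts hs ((div_lt_iff₀ ht).1 hi)

lemma mul {V V' : ℝ → ℝ} {C C' : ℝ} {M M' : ℕ} (h : TailFn V C M) (h' : TailFn V' C' M') :
    TailFn (fun s => V s * V' s) (C * C') (M + M') where
  pos s h0 h1 := mul_pos (h.pos s h0 h1) (h'.pos s h0 h1)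
  mono s t h0 h1 h2 := mul_le_mul (h.mono s t h0 h1 h2) (h'.mono s t h0 h1 h2)
    (h'.pos t h0 (h1.trans h2)).le (h.pos s (h0.trans_le h1) h2).le
  growth s t h0 h1 h2 := by
    have := mul_le_mul (h.growth s t h0 h1 h2) (h'.growth s t h0 h1 h2)
      (h'.pos s (h0.trans_le h1) h2).le
      ((h.pos s (h0.trans_le h1) h2).le.trans (h.growth s t h0 h1 h2))
    refine this.trans (le_of_eq ?_)
    rw [pow_add]; ring

lemma pow (q : ℕ) : TailFn (fun s => s ^ q) 1 q where
  pos s h0 _ := pow_pos h0 q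
  mono s t h0 h1 _ := pow_le_pow_left₀ h0.le h1 q
  growth s t h0 h1 _ := by
    rw [one_mul, ← mul_pow, div_mul_cancel₀ _ h0.ne']

/-- Values at comparable points are comparable. -/
lemma le_of_le_mul {V : ℝ → ℝ} {C : ℝ} {M : ℕ} (h : TailFn V C M) {L s t : ℝ} (hL : 1 ≤ L)
    (ht : 0 < t) (ht1 : t ≤ 1) (hs : 0 < s) (hs1 : s ≤ 1) (hst : s ≤ L * t) :
    V s ≤ C * L ^ M * V t := by
  have hC := h.one_le
  have hV := (h.pos t ht ht1).le
  by_cases hts : t ≤ s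
  · refine (h.growth s t ht hts hs1).trans ?_
    gcongr
    exact (div_le_iff₀ ht).2 hst
  · calc V s ≤ V t := h.mono t s hs (by linarith) ht1
      _ = 1 * V t := by ring
      _ ≤ C * L ^ M * V t := by
        gcongr
        exact one_le_mul_of_one_le_of_one_le hC (one_le_pow₀ hL)

end TailFn

/-! ### Discrete symbol classes -/

/-- Symbol estimates up to order `j` for a sequence `u` with respect to the weight `g`:
the differences of order `i ≤ j` are bounded by a multiple of `g k / (k + 1) ^ i`. -/
def SymbolBound : ℕ → (ℕ → ℝ) → (ℕ → ℝ) → Prop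
  | 0, g, u => ∃ C, ∀ k, |u k| ≤ C * g k
  | j + 1, g, u => (∃ C, ∀ k, |u k| ≤ C * g k) ∧
      SymbolBound j (fun k => g k / (k + 1)) (fun k => u (k + 1) - u k)

namespace SymbolBound

lemma bound {j : ℕ} {g u : ℕ → ℝ} (h : SymbolBound j g u) : ∃ C, ∀ k, |u k| ≤ C * g k := by
  cases j with
  | zero => exact h
  | succ j => exact h.1

lemma of_succ {j : ℕ} {g u : ℕ → ℝ} (h : SymbolBound (j + 1) g u) : SymbolBound j g u := by
  induction j generalizing g u with
  | zero => exact h.1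
  | succ j ih => exact ⟨h.1, ih h.2⟩

lemma add {j : ℕ} {g u v : ℕ → ℝ} (hu : SymbolBound j g u) (hv : SymbolBound j g v) :
    SymbolBound j g (fun k => u k + v k) := by
  have base : ∀ {g u v : ℕ → ℝ}, (∃ C, ∀ k, |u k| ≤ C * g k) → (∃ C, ∀ k, |v k| ≤ C * g k) →
      ∃ C, ∀ k, |u k + v k| ≤ C * g k := by
    rintro g u v ⟨C, hC⟩ ⟨D, hD⟩
    refine ⟨C + D, fun k => (abs_add_le _ _).trans ?_⟩
    linarith [hC k, hD k]
  induction j generalizing g u v with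
  | zero => exact base hu hv
  | succ j ih =>
    refine ⟨base hu.1 hv.1, ?_⟩
    convert ih hu.2 hv.2 using 2
    ring

lemma neg {j : ℕ} {g u : ℕ → ℝ} (hu : SymbolBound j g u) : SymbolBound j g (fun k => -u k) := by
  induction j generalizing g u with
  | zero => simpa [SymbolBound] using hu
  | succ j ih =>
    refine ⟨by simpa using hu.1, ?_⟩
    convert ih hu.2 using 2
    ring

lemma shift {j : ℕ} {g u : ℕ → ℝ} (hu : SymbolBound j g u) (hg : ∀ k, 0 ≤ g k) (A : ℝ)
    (hA : ∀ k, g (k + 1) ≤ A * g k) : SymbolBound j g (fun k => u (k + 1)) := by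
  have base : ∀ {g u : ℕ → ℝ}, (∃ C, ∀ k, |u k| ≤ C * g k) → (∀ k, 0 ≤ g k) →
      (∀ k, g (k + 1) ≤ A * g k) → ∃ C, ∀ k, |u (k + 1)| ≤ C * g k := by
    rintro g u ⟨C, hC⟩ hg hA
    refine ⟨|C| * A, fun k => (hC _).trans ?_⟩
    calc C * g (k + 1) ≤ |C| * g (k + 1) := mul_le_mul_of_nonneg_right (le_abs_self C) (hg _)
      _ ≤ |C| * (A * g k) := mul_le_mul_of_nonneg_left (hA k) (abs_nonneg C)
      _ = _ := by ring
  induction j generalizing g u with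
  | zero => exact base hu hg hA
  | succ j ih =>
    refine ⟨base hu.1 hg hA, ih hu.2 (fun k => div_nonneg (hg k) (by positivity)) fun k => ?_⟩
    calc g (k + 1) / ((k + 1 : ℕ) + 1) ≤ g (k + 1) / (k + 1) := by
          apply div_le_div_of_nonneg_left (hg _) (by positivity); push_cast; linarith
      _ ≤ A * g k / (k + 1) := by gcongr; exact hA k
      _ = _ := by ring

/-- The discrete Leibniz rule `Δ(uv) = u(k+1) Δv + Δu · v(k)` and induction on the order. The
shifted factor `u(k+1)` is why `g (k + 1)` must be controlled by `g k`. -/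
lemma mul {j : ℕ} {g h u v : ℕ → ℝ} (hu : SymbolBound j g u) (hv : SymbolBound j h v)
    (hg : ∀ k, 0 ≤ g k) (hh : ∀ k, 0 ≤ h k) (A : ℝ) (hA : ∀ k, g (k + 1) ≤ A * g k) :
    SymbolBound j (fun k => g k * h k) (fun k => u k * v k) := by
  have base : ∀ {g h u v : ℕ → ℝ}, (∃ C, ∀ k, |u k| ≤ C * g k) → (∃ C, ∀ k, |v k| ≤ C * h k) →
      ∃ C, ∀ k, |u k * v k| ≤ C * (g k * h k) := by
    rintro g h u v ⟨C, hC⟩ ⟨D, hD⟩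
    refine ⟨C * D, fun k => ?_⟩
    rw [abs_mul]
    calc |u k| * |v k| ≤ (C * g k) * (D * h k) :=
          mul_le_mul (hC k) (hD k) (abs_nonneg _) ((abs_nonneg _).trans (hC k))
      _ = _ := by ring
  induction j generalizing g h u v with
  | zero => exact base hu hv
  | succ j ih =>
    refine ⟨base hu.1 hv.1, ?_⟩
    have h1 := ih (hu.of_succ.shift hg A hA) hv.2 hg
      (fun k => div_nonneg (hh k) (by positivity)) hA
    have h2 := ih hu.2 hv.of_succ (fun k => div_nonneg (hg k) (by positivity)) hh (fun k => by
      calc g (k + 1) / ((k + 1 : ℕ) + 1) ≤ g (k + 1) / (k + 1) := by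
            apply div_le_div_of_nonneg_left (hg _) (by positivity); push_cast; linarith
        _ ≤ A * g k / (k + 1) := by gcongr; exact hA k
        _ = _ := by ring)
    have e1 : (fun k : ℕ => g k * (h k / (k + 1))) = fun k : ℕ => g k * h k / (k + 1) := by
      funext k; ring
    have e2 : (fun k : ℕ => g k / (k + 1) * h k) = fun k : ℕ => g k * h k / (k + 1) := by
      funext k; ring
    rw [e1] at h1
    rw [e2] at h2
    convert h1.add h2 using 2
    ring

/-- The identity `Δ(1/u) = -Δu · (1/u(k+1)) · (1/u(k))` reduces order `j + 1` to order `j` for `1/u`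
and the product rule. Ellipticity of `u`, the bound `g ≤ B u`, provides order zero. -/
lemma inv {j : ℕ} {g u : ℕ → ℝ} (hu : SymbolBound j g u) (hg : ∀ k, 0 < g k)
    (hu0 : ∀ k, 0 < u k) (B : ℝ) (hB : ∀ k, g k ≤ B * u k)
    (A : ℝ) (hA : ∀ k, g (k + 1) ≤ A * g k) (A' : ℝ) (hA' : ∀ k, g k ≤ A' * g (k + 1)) :
    SymbolBound j (fun k => (g k)⁻¹) (fun k => (u k)⁻¹) := by
  have base : ∃ C, ∀ k, |(u k)⁻¹| ≤ C * (g k)⁻¹ := by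
    refine ⟨B, fun k => ?_⟩
    rw [abs_of_pos (inv_pos.2 (hu0 k)), ← div_eq_mul_inv, le_div_iff₀ (hg k), mul_comm,
      ← div_eq_mul_inv, div_le_iff₀ (hu0 k)]
    exact hB k
  have hi : ∀ k, 0 ≤ (g k)⁻¹ := fun k => (inv_pos.2 (hg k)).le
  have hiA : ∀ k, (g (k + 1))⁻¹ ≤ A' * (g k)⁻¹ := fun k => by
    rw [← div_eq_mul_inv, le_div_iff₀ (hg k), mul_comm, ← div_eq_mul_inv, div_le_iff₀ (hg _)]
    exact hA' k
  induction j with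
  | zero => exact base
  | succ j ih =>
    refine ⟨base, ?_⟩
    have h1 := ih hu.of_succ
    have h2 := (h1.shift hi A' hiA).mul h1 hi hi A' hiA
    have h3 := (hu.2.mul h2 (fun k => div_nonneg (hg k).le (by positivity))
      (fun k => mul_nonneg (hi k) (hi k)) A (fun k => by
      calc g (k + 1) / ((k + 1 : ℕ) + 1) ≤ g (k + 1) / (k + 1) := by
            apply div_le_div_of_nonneg_left (hg _).le (by positivity); push_cast; linarith
        _ ≤ A * g k / (k + 1) := by gcongr; exact hA k
        _ = _ := by ring)).neg
    convert h3 using 2 with k k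
    · have := (hg k).ne'
      field_simp
    · have := (hu0 k).ne'
      have := (hu0 (k + 1)).ne'
      field_simp
      ring

lemma zero {g : ℕ → ℝ} (j : ℕ) (hg : ∀ k, 0 ≤ g k) : SymbolBound j g (fun _ => 0) := by
  induction j generalizing g with
  | zero => exact ⟨1, fun k => by simpa using hg k⟩
  | succ j ih =>
    refine ⟨⟨1, fun k => by simpa using hg k⟩, ?_⟩
    simpa using ih fun k => div_nonneg (hg k) (by positivity)

lemma natCast (j : ℕ) : SymbolBound j (fun k => (k : ℝ) + 1) (fun k => (k : ℝ)) := by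
  have b : ∃ C : ℝ, ∀ k : ℕ, |(k : ℝ)| ≤ C * ((k : ℝ) + 1) :=
    ⟨1, fun k => by rw [abs_of_nonneg (by positivity)]; linarith⟩
  cases j with
  | zero => exact b
  | succ j =>
    refine ⟨b, ?_⟩
    have e : (fun k : ℕ => ((k : ℝ) + 1) / (k + 1)) = fun _ => 1 := by
      funext k; field_simp
    have e' : (fun k : ℕ => ((k + 1 : ℕ) : ℝ) - k) = fun _ => 1 := by
      funext k; push_cast; ring
    rw [e, e']
    cases j with
    | zero => exact ⟨1, fun k => by simp⟩
    | succ j =>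
      refine ⟨⟨1, fun k => by simp⟩, ?_⟩
      simpa using zero j fun k => by positivity

end SymbolBound

/-! ### Moments of measures on the unit interval -/

section Moments

variable {ν : Measure ℝ} [IsFiniteMeasure ν]

lemma integrable_moment (hν : ∀ᵐ y ∂ν, y ∈ Set.Icc (0 : ℝ) 1) (j k : ℕ) :
    Integrable (fun y => (1 - y) ^ j * y ^ k) ν := by
  refine Integrable.of_bound (by fun_prop) 1 ?_
  filter_upwards [hν] with y hy
  rw [Real.norm_eq_abs, abs_of_nonneg (mul_nonneg (pow_nonneg (by linarith [hy.2]) _)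
    (pow_nonneg hy.1 _))]
  exact mul_le_one₀ (pow_le_one₀ (by linarith [hy.2]) (by linarith [hy.1]))
    (pow_nonneg hy.1 _) (pow_le_one₀ hy.1 hy.2)

lemma integrable_pow_moment (hν : ∀ᵐ y ∂ν, y ∈ Set.Icc (0 : ℝ) 1) (k : ℕ) :
    Integrable (fun y => y ^ k) ν := by
  simpa using integrable_moment hν 0 k

lemma moment_antitone (hν : ∀ᵐ y ∂ν, y ∈ Set.Icc (0 : ℝ) 1) {k l : ℕ} (h : k ≤ l) :
    ∫ y, y ^ l ∂ν ≤ ∫ y, y ^ k ∂ν := by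
  refine integral_mono_ae (integrable_pow_moment hν l) (integrable_pow_moment hν k) ?_
  filter_upwards [hν] with y hy
  exact pow_le_pow_of_le_one hy.1 hy.2 h

/-- Split at `y = 1 - δ`: to the right the integrand is at most `1`, to the left half of the
exponent is spent on the factor `exp (-δ k)`. -/
lemma moment_two_mul_le (hν : ∀ᵐ y ∂ν, y ∈ Set.Icc (0 : ℝ) 1) (δ : ℝ) (k : ℕ) :
    ∫ y, y ^ (2 * k) ∂ν ≤
      ν.real (Set.Ici (1 - δ)) + Real.exp (-(δ * k)) * ∫ y, y ^ k ∂ν := by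
  have hI : Integrable ((Set.Ici (1 - δ)).indicator fun _ => (1 : ℝ)) ν :=
    (integrable_const _).indicator measurableSet_Ici
  have hI' := (integrable_pow_moment hν k).const_mul (Real.exp (-(δ * k)))
  calc ∫ y, y ^ (2 * k) ∂ν
      ≤ ∫ y, (Set.Ici (1 - δ)).indicator (fun _ => (1 : ℝ)) y
          + Real.exp (-(δ * k)) * y ^ k ∂ν := by
        refine integral_mono_ae (integrable_pow_moment hν _) (hI.add hI') ?_
        filter_upwards [hν] with y hy
        by_cases hyδ : y ∈ Set.Ici (1 - δ)
        · simp only [Set.indicator_of_mem hyδ]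
          have : y ^ (2 * k) ≤ 1 := pow_le_one₀ hy.1 hy.2
          have : 0 ≤ Real.exp (-(δ * k)) * y ^ k := mul_nonneg (Real.exp_nonneg _) (pow_nonneg hy.1 _)
          linarith
        · simp only [Set.indicator_of_notMem hyδ, zero_add]
          rw [two_mul, pow_add]
          refine mul_le_mul_of_nonneg_right ?_ (pow_nonneg hy.1 _)
          calc y ^ k ≤ (Real.exp (-δ)) ^ k := by
                refine pow_le_pow_left₀ hy.1 ?_ k
                have h3 : y < 1 - δ := not_le.1 hyδ
                linarith [Real.add_one_le_exp (-δ)]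
            _ = _ := by rw [← Real.exp_nat_mul]; congr 1; ring
    _ = _ := by
        rw [integral_add hI hI', integral_indicator_const _ measurableSet_Ici, integral_const_mul]
        simp

variable {V : ℝ → ℝ} {C : ℝ} {M : ℕ}

/-- Induction along `k = 2 ^ i` with `moment_two_mul_le` at `δ = L / 2 ^ i`. The decay `exp (-L)`
beats the loss of `V` under one halving, so the constant does not grow with `i`. Other exponents lie
between two powers of two. -/
lemma moment_le (hν : ∀ᵐ y ∂ν, y ∈ Set.Icc (0 : ℝ) 1) (hV : TailFn V C M) {B : ℝ}
    (hB : ∀ s, 0 < s → s ≤ 1 → ν.real (Set.Ici (1 - s)) ≤ B * V s) :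
    ∃ A, ∀ k : ℕ, ∫ y, y ^ k ∂ν ≤ A * V (1 / ((k : ℝ) + 1)) := by
  have hC := hV.one_le
  have hB0 : 0 ≤ B := by
    have h1 := hB 1 one_pos le_rfl
    have h2 := hV.pos 1 one_pos le_rfl
    by_contra hb
    have : (0 : ℝ) ≤ ν.real (Set.Ici (1 - 1)) := measureReal_nonneg
    nlinarith
  have huniv : ∀ k : ℕ, ∫ y, y ^ k ∂ν ≤ B * V 1 := fun k => by
    have h1 := moment_antitone hν (Nat.zero_le k)
    have h2 : ν.real Set.univ = ν.real (Set.Ici (1 - 1)) := by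
      refine measureReal_congr ?_
      filter_upwards [hν] with y hy
      have : y ∈ Set.Ici ((1 : ℝ) - 1) := by simpa using hy.1
      exact propext ⟨fun _ => this, fun _ => trivial⟩
    have h3 := hB 1 one_pos le_rfl
    simp only [pow_zero, integral_const, smul_eq_mul, mul_one] at h1
    linarith
  -- `L` is chosen so large that `exp (-L)` times the halving constant `C * 2 ^ M` of `V` is at most
  -- `1 / 2`; the induction hypothesis then uses only half of `A`.
  obtain ⟨L, hL1, hL⟩ : ∃ L : ℝ, 1 ≤ L ∧ Real.exp (-L) * (C * 2 ^ M) ≤ 1 / 2 := by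
    refine ⟨2 * (C * 2 ^ M), ?_, ?_⟩
    · have : (1 : ℝ) ≤ C * 2 ^ M := one_le_mul_of_one_le_of_one_le hC (one_le_pow₀ (by norm_num))
      linarith
    · rw [Real.exp_neg, inv_mul_eq_div, div_le_iff₀ (Real.exp_pos _)]
      linarith [Real.add_one_le_exp (2 * (C * 2 ^ M))]
  set A := max (B) (2 * (B * (C * (2 * L) ^ M))) with hA
  have hA0 : 0 ≤ A := hB0.trans (le_max_left _ _)
  have key : ∀ i : ℕ, ∫ y, y ^ (2 ^ i) ∂ν ≤ A * V (1 / 2 ^ i) := by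
    intro i
    induction i with
    | zero =>
      have := huniv (2 ^ 0)
      have h2 := (hV.pos 1 one_pos le_rfl).le
      simp only [pow_zero, div_one] at this ⊢
      exact this.trans (mul_le_mul_of_nonneg_right (le_max_left _ _) h2)
    | succ i ih =>
      have hp : (0 : ℝ) < 2 ^ i := by positivity
      have hp1 : (1 : ℝ) ≤ 2 ^ i := one_le_pow₀ (by norm_num)
      have hq0 : (0 : ℝ) < 1 / 2 ^ (i + 1) := by positivity
      have hq1 : (1 : ℝ) / 2 ^ (i + 1) ≤ 1 :=
        (div_le_one (by positivity)).2 (one_le_pow₀ (by norm_num))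
      have hVq := (hV.pos _ hq0 hq1).le
      have h1 : ∫ y, y ^ (2 ^ (i + 1)) ∂ν ≤ B * (C * (2 * L) ^ M * V (1 / 2 ^ (i + 1)))
          + Real.exp (-L) * ∫ y, y ^ (2 ^ i) ∂ν := by
        have hint : 0 ≤ ∫ y, y ^ (2 ^ i) ∂ν :=
          integral_nonneg_of_ae (by filter_upwards [hν] with y hy using pow_nonneg hy.1 _)
        -- For the finitely many `i` with `L > 2 ^ i` the splitting point is outside the range of
        -- `hB`, and the total mass is enough.
        by_cases hδ : L / 2 ^ i ≤ 1
        · have h2 := moment_two_mul_le hν (L / 2 ^ i) (2 ^ i)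
          have h3 := hB (L / 2 ^ i) (by positivity) hδ
          have h4 := hV.le_of_le_mul (L := 2 * L) (s := L / 2 ^ i) (by linarith) hq0 hq1
            (by positivity) hδ (by rw [pow_succ]; field_simp; rfl)
          rw [show (2 : ℕ) ^ (i + 1) = 2 * 2 ^ i from pow_succ' 2 i]
          have e : L / 2 ^ i * ((2 ^ i : ℕ) : ℝ) = L := by push_cast; field_simp
          rw [e] at h2
          have h5 := mul_le_mul_of_nonneg_left h4 hB0
          linarith
        · have h2 := huniv (2 ^ (i + 1))
          have h4 := hV.le_of_le_mul (L := 2 * L) (s := 1) (by linarith) hq0 hq1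
            one_pos le_rfl (by
              push Not at hδ
              rw [one_lt_div hp] at hδ
              rw [pow_succ, mul_one_div, le_div_iff₀ (by positivity)]
              linarith)
          have h5 := mul_le_mul_of_nonneg_left h4 hB0
          have := mul_nonneg (Real.exp_nonneg (-L)) hint
          linarith
      have h2 : V (1 / 2 ^ i) ≤ C * 2 ^ M * V (1 / 2 ^ (i + 1)) :=
        hV.le_of_le_mul (by norm_num) hq0 hq1 (by positivity) ((div_le_one hp).2 hp1)
          (by rw [pow_succ]; field_simp; rfl)
      calc ∫ y, y ^ (2 ^ (i + 1)) ∂ν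
          ≤ B * (C * (2 * L) ^ M * V (1 / 2 ^ (i + 1)))
            + Real.exp (-L) * ∫ y, y ^ (2 ^ i) ∂ν := h1
        _ ≤ B * (C * (2 * L) ^ M * V (1 / 2 ^ (i + 1)))
            + Real.exp (-L) * (A * (C * 2 ^ M * V (1 / 2 ^ (i + 1)))) := by
              gcongr
              exact ih.trans (mul_le_mul_of_nonneg_left h2 hA0)
        _ = (B * (C * (2 * L) ^ M) + A * (Real.exp (-L) * (C * 2 ^ M)))
              * V (1 / 2 ^ (i + 1)) := by ring
        _ ≤ A * V (1 / 2 ^ (i + 1)) := by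
            refine mul_le_mul_of_nonneg_right ?_ hVq
            have := mul_le_mul_of_nonneg_left hL hA0
            linarith [le_max_right B (2 * (B * (C * (2 * L) ^ M)))]
  refine ⟨A * (C * 2 ^ M), fun k => ?_⟩
  have hk0 : (0 : ℝ) < 1 / ((k : ℝ) + 1) := by positivity
  have hk1 : 1 / ((k : ℝ) + 1) ≤ 1 := (div_le_one (by positivity)).2 (by linarith [(Nat.cast_nonneg k : (0:ℝ) ≤ k)])
  have hVk := (hV.pos _ hk0 hk1).le
  rcases Nat.eq_zero_or_pos k with rfl | hk
  · have := huniv 0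
    have h1 : (1 : ℝ) ≤ C * 2 ^ M := one_le_mul_of_one_le_of_one_le hC (one_le_pow₀ (by norm_num))
    simp only [Nat.cast_zero, zero_add, div_one] at hVk ⊢
    refine this.trans (mul_le_mul_of_nonneg_right ?_ hVk)
    calc B ≤ A := le_max_left _ _
      _ = A * 1 := by ring
      _ ≤ _ := by gcongr
  · set i := Nat.log 2 k
    have h1 : 2 ^ i ≤ k := Nat.pow_log_le_self 2 hk.ne'
    have h2 : k + 1 ≤ 2 ^ (i + 1) := Nat.lt_pow_succ_log_self (by norm_num) k
    have h2' : (k : ℝ) + 1 ≤ 2 ^ i * 2 := by rw [← pow_succ]; exact_mod_cast h2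
    have hp : (0 : ℝ) < 2 ^ i := by positivity
    calc ∫ y, y ^ k ∂ν ≤ A * V (1 / 2 ^ i) := (moment_antitone hν h1).trans (key i)
      _ ≤ A * (C * 2 ^ M * V (1 / ((k : ℝ) + 1))) := by
        gcongr
        refine hV.le_of_le_mul (by norm_num) hk0 hk1 (by positivity)
          ((div_le_one hp).2 (one_le_pow₀ (by norm_num))) ?_
        rw [mul_one_div, div_le_div_iff₀ hp (by positivity)]
        linarith
      _ = _ := by ring

/-- About half of the powers of `y` are used to absorb `(1 - y) ^ j`, through `x ^ j * exp (-x) ≤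
j!` at `x = (l + 1) (1 - y)`. The other half remains, so that a moment is left after integration. -/
lemma one_sub_pow_mul_pow_le {y : ℝ} (h0 : 0 ≤ y) (h1 : y ≤ 1) (j k : ℕ) :
    (1 - y) ^ j * y ^ k ≤ (2 ^ j * Real.exp 1 * j.factorial) / ((k : ℝ) + 1) ^ j * y ^ (k / 2) := by
  set l := k - k / 2 with hl
  have hk : k = l + k / 2 := by omega
  have hkl : (k : ℝ) + 1 ≤ 2 * ((l : ℝ) + 1) := by
    have : k + 1 ≤ 2 * (l + 1) := by omega
    exact_mod_cast this
  have hy : y ^ k = y ^ l * y ^ (k / 2) := by rw [← pow_add, ← hk]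
  rw [hy, ← mul_assoc]
  refine mul_le_mul_of_nonneg_right ?_ (pow_nonneg h0 _)
  rw [le_div_iff₀ (by positivity)]
  have ht : 0 ≤ 1 - y := by linarith
  have h2 : y ^ l ≤ Real.exp 1 * Real.exp (-(((l : ℝ) + 1) * (1 - y))) := by
    calc y ^ l ≤ (Real.exp (-(1 - y))) ^ l :=
          pow_le_pow_left₀ h0 (by linarith [Real.add_one_le_exp (-(1 - y))]) l
      _ = Real.exp (-(l * (1 - y))) := by rw [← Real.exp_nat_mul]; congr 1; ring
      _ ≤ Real.exp (1 + (-(((l : ℝ) + 1) * (1 - y)))) := by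
          apply Real.exp_le_exp.2; linarith
      _ = _ := by rw [Real.exp_add]
  have hx : 0 ≤ ((l : ℝ) + 1) * (1 - y) := by positivity
  have h3 : (((l : ℝ) + 1) * (1 - y)) ^ j * Real.exp (-(((l : ℝ) + 1) * (1 - y)))
      ≤ j.factorial := by
    have := Real.pow_div_factorial_le_exp _ hx j
    rw [div_le_iff₀ (by positivity)] at this
    rw [Real.exp_neg, ← div_eq_mul_inv, div_le_iff₀ (Real.exp_pos _)]
    linarith
  calc (1 - y) ^ j * y ^ l * ((k : ℝ) + 1) ^ j
      ≤ (1 - y) ^ j * (Real.exp 1 * Real.exp (-(((l : ℝ) + 1) * (1 - y))))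
          * (2 * ((l : ℝ) + 1)) ^ j := by gcongr
    _ = 2 ^ j * Real.exp 1 *
        ((((l : ℝ) + 1) * (1 - y)) ^ j * Real.exp (-(((l : ℝ) + 1) * (1 - y)))) := by
        rw [mul_pow, mul_pow]; ring
    _ ≤ _ := by gcongr

/-- The difference of consecutive moments is minus the moment with an additional factor `1 - y`.
Iterated differences are therefore integrals of `(1 - y) ^ i * y ^ k`, each bounded by a moment of
order `k / 2` divided by `(k + 1) ^ i`. -/
lemma moment_symbolBound (hν : ∀ᵐ y ∂ν, y ∈ Set.Icc (0 : ℝ) 1) (hV : TailFn V C M) {B : ℝ}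
    (hB : ∀ s, 0 < s → s ≤ 1 → ν.real (Set.Ici (1 - s)) ≤ B * V s) (j : ℕ) :
    SymbolBound j (fun k => V (1 / ((k : ℝ) + 1))) (fun k => ∫ y, y ^ k ∂ν) := by
  obtain ⟨A, hA⟩ := moment_le hν hV hB
  have hC := hV.one_le
  have hVk : ∀ k : ℕ, 0 < V (1 / ((k : ℝ) + 1)) := fun k =>
    hV.pos _ (by positivity) ((div_le_one (by positivity)).2
      (by linarith [(Nat.cast_nonneg k : (0:ℝ) ≤ k)]))
  have base : ∀ i, ∃ D, ∀ k : ℕ, |∫ y, (1 - y) ^ i * y ^ k ∂ν| ≤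
      D * (V (1 / ((k : ℝ) + 1)) / ((k : ℝ) + 1) ^ i) := by
    intro i
    refine ⟨(2 ^ i * Real.exp 1 * i.factorial) * (|A| * (C * 2 ^ M)), fun k => ?_⟩
    have hn : 0 ≤ ∫ y, (1 - y) ^ i * y ^ k ∂ν := integral_nonneg_of_ae (by
      filter_upwards [hν] with y hy
      exact mul_nonneg (pow_nonneg (by linarith [hy.2]) _) (pow_nonneg hy.1 _))
    rw [abs_of_nonneg hn]
    have hk2 : (k : ℝ) + 1 ≤ 2 * (((k / 2 : ℕ) : ℝ) + 1) := by
      have : k + 1 ≤ 2 * (k / 2 + 1) := by omega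
      exact_mod_cast this
    have h1 : V (1 / (((k / 2 : ℕ) : ℝ) + 1)) ≤ C * 2 ^ M * V (1 / ((k : ℝ) + 1)) := by
      refine hV.le_of_le_mul (by norm_num) (by positivity) ((div_le_one (by positivity)).2
        (by linarith [(Nat.cast_nonneg k : (0:ℝ) ≤ k)])) (by positivity)
        ((div_le_one (by positivity)).2
        (by linarith [(Nat.cast_nonneg (k / 2) : (0:ℝ) ≤ (k / 2 : ℕ))])) ?_
      rw [mul_one_div, div_le_div_iff₀ (by positivity) (by positivity)]
      linarith
    calc ∫ y, (1 - y) ^ i * y ^ k ∂ν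
        ≤ ∫ y, (2 ^ i * Real.exp 1 * i.factorial) / ((k : ℝ) + 1) ^ i * y ^ (k / 2) ∂ν := by
          refine integral_mono_ae (integrable_moment hν i k)
            ((integrable_pow_moment hν _).const_mul _) ?_
          filter_upwards [hν] with y hy
          exact one_sub_pow_mul_pow_le hy.1 hy.2 i k
      _ = (2 ^ i * Real.exp 1 * i.factorial) / ((k : ℝ) + 1) ^ i * ∫ y, y ^ (k / 2) ∂ν := by
          rw [integral_const_mul]
      _ ≤ (2 ^ i * Real.exp 1 * i.factorial) / ((k : ℝ) + 1) ^ i *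
          (|A| * (C * 2 ^ M * V (1 / ((k : ℝ) + 1)))) := by
          gcongr
          refine (hA _).trans ?_
          exact mul_le_mul (le_abs_self A) h1 (hVk _).le (abs_nonneg A)
      _ = _ := by ring
  -- The induction on `j` needs all `i` at once: a difference moves from `i` to `i + 1`.
  have key : ∀ j i : ℕ, SymbolBound j (fun k => V (1 / ((k : ℝ) + 1)) / ((k : ℝ) + 1) ^ i)
      (fun k => ∫ y, (1 - y) ^ i * y ^ k ∂ν) := by
    intro j
    induction j with
    | zero => exact base
    | succ j ih =>
      intro i
      refine ⟨base i, ?_⟩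
      convert (ih (i + 1)).neg using 2 with k k
      · rw [pow_succ]; field_simp
      · rw [← integral_sub (integrable_moment hν i _) (integrable_moment hν i k), ← integral_neg]
        congr 1
        funext y
        ring
  simpa using key j 0

/-- On `[1 - s, 1]` with `s` of order `1 / k`, the function `y ^ k` is bounded below. The choice `s
= 1 / (2 (k + 1))` makes Bernoulli's inequality give `1 / 2`. -/
lemma le_moment (hν : ∀ᵐ y ∂ν, y ∈ Set.Icc (0 : ℝ) 1) (hV : TailFn V C M) {B : ℝ}
    (hB : ∀ s, 0 < s → s ≤ 1 → V s ≤ B * ν.real (Set.Ici (1 - s))) :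
    ∃ A, 0 < A ∧ ∀ k : ℕ, V (1 / ((k : ℝ) + 1)) ≤ A * ∫ y, y ^ k ∂ν := by
  have hC := hV.one_le
  refine ⟨C * 2 ^ M * ((|B| + 1) * 2), by positivity, fun k => ?_⟩
  have hk : (0 : ℝ) ≤ k := Nat.cast_nonneg k
  set s : ℝ := 1 / (2 * ((k : ℝ) + 1)) with hs
  have hs0 : 0 < s := by positivity
  have hs1 : s ≤ 1 / 2 := by
    rw [hs, div_le_div_iff₀ (by positivity) (by norm_num)]; linarith
  have h1 : V (1 / ((k : ℝ) + 1)) ≤ C * 2 ^ M * V s :=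
    hV.le_of_le_mul (by norm_num) hs0 (by linarith) (by positivity)
      ((div_le_one (by positivity)).2 (by linarith)) (by rw [hs]; field_simp; rfl)
  have h2 : ν.real (Set.Ici (1 - s)) ≤ 2 * ∫ y, y ^ k ∂ν := by
    have hI : Integrable ((Set.Ici (1 - s)).indicator fun _ => (1 : ℝ)) ν :=
      (integrable_const _).indicator measurableSet_Ici
    calc ν.real (Set.Ici (1 - s)) = ∫ y, (Set.Ici (1 - s)).indicator (fun _ => (1 : ℝ)) y ∂ν := by
          rw [integral_indicator_const _ measurableSet_Ici]; simp
      _ ≤ ∫ y, 2 * y ^ k ∂ν := by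
          refine integral_mono_ae hI ((integrable_pow_moment hν k).const_mul 2) ?_
          filter_upwards [hν] with y hy
          by_cases hys : y ∈ Set.Ici (1 - s)
          · simp only [Set.indicator_of_mem hys]
            have h3 : 1 - s ≤ y := hys
            have h4 : (1 - s) ^ k ≤ y ^ k := pow_le_pow_left₀ (by linarith) h3 k
            have h5 := one_add_mul_le_pow (a := -s) (by linarith) k
            have h6 : (k : ℝ) * s ≤ 1 / 2 := by
              rw [hs, mul_one_div, div_le_div_iff₀ (by positivity) (by norm_num)]; linarith
            have h7 : (1 : ℝ) + -s = 1 - s := by ring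
            rw [h7] at h5
            linarith
          · simp only [Set.indicator_of_notMem hys]
            exact mul_nonneg (by norm_num) (pow_nonneg hy.1 _)
      _ = _ := integral_const_mul _ _
  have h3 := hB s hs0 (by linarith)
  have h4 : B * ν.real (Set.Ici (1 - s)) ≤ (|B| + 1) * ν.real (Set.Ici (1 - s)) :=
    mul_le_mul_of_nonneg_right (by linarith [le_abs_self B]) measureReal_nonneg
  calc V (1 / ((k : ℝ) + 1)) ≤ C * 2 ^ M * V s := h1
    _ ≤ C * 2 ^ M * ((|B| + 1) * (2 * ∫ y, y ^ k ∂ν)) := by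
      gcongr
      exact h3.trans (h4.trans (by gcongr))
    _ = _ := by ring

end Moments

/-! ### Power series with symbol coefficients -/

lemma summable_pow_mul_of_le {u : ℕ → ℝ} {B : ℝ} {q : ℕ} (hu : ∀ k, |u k| ≤ B * ((k : ℝ) + 1) ^ q)
    {r : ℝ} (h0 : 0 ≤ r) (h1 : r < 1) : Summable fun k => |u k| * r ^ k := by
  have hr : ‖r‖ < 1 := by rwa [Real.norm_eq_abs, abs_of_nonneg h0]
  have hs : Summable fun k : ℕ => B * 2 ^ q * ((k : ℝ) ^ q * r ^ k) + B * 2 ^ q * r ^ k :=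
    ((summable_pow_mul_geometric_of_norm_lt_one q hr).mul_left _).add
      ((summable_geometric_of_lt_one h0 h1).mul_left _)
  have hB : 0 ≤ B := by simpa using (abs_nonneg _).trans (hu 0)
  refine hs.of_nonneg_of_le (fun k => by positivity) fun k => ?_
  have h2 : ((k : ℝ) + 1) ^ q ≤ 2 ^ q * ((k : ℝ) ^ q + 1) := by
    rcases le_total (k : ℝ) 1 with hk | hk
    · calc ((k : ℝ) + 1) ^ q ≤ 2 ^ q := pow_le_pow_left₀ (by positivity) (by linarith) q
        _ = 2 ^ q * (0 + 1) := by ring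
        _ ≤ _ := by gcongr; positivity
    · calc ((k : ℝ) + 1) ^ q ≤ (2 * (k : ℝ)) ^ q := by gcongr; linarith
        _ = 2 ^ q * ((k : ℝ) ^ q + 0) := by rw [mul_pow]; ring
        _ ≤ _ := by gcongr; norm_num
  calc |u k| * r ^ k ≤ B * ((k : ℝ) + 1) ^ q * r ^ k := by gcongr; exact hu k
    _ ≤ B * (2 ^ q * ((k : ℝ) ^ q + 1)) * r ^ k := by gcongr
    _ = _ := by ring

lemma summable_cpow_mul_of_le {u : ℕ → ℝ} {B : ℝ} {q : ℕ}
    (hu : ∀ k, |u k| ≤ B * ((k : ℝ) + 1) ^ q) {z : ℂ} (hz : ‖z‖ < 1) :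
    Summable fun k => (u k : ℂ) * z ^ k := by
  refine Summable.of_norm ?_
  simpa using summable_pow_mul_of_le hu (norm_nonneg z) hz

/-- Summation by parts, iterated: tails of power series whose coefficients satisfy symbol
estimates of high order. -/
lemma norm_tsum_tail_le (j : ℕ) {G u : ℕ → ℝ} (hG : ∀ k, 0 ≤ G k) (hu : SymbolBound j G u) (B : ℝ)
    (hs : Summable fun k : ℕ => G k / ((k : ℝ) + 1) ^ j)
    (hB : ∀ K : ℕ, ∑' k : ℕ, G (K + k) / (((K + k : ℕ) : ℝ) + 1) ^ j
      ≤ B * (G K * (((K : ℝ) + 1) / ((K : ℝ) + 1) ^ j))) :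
    ∃ C, 0 ≤ C ∧ ∀ (z : ℂ) (K : ℕ), ‖z‖ < 1 → 1 ≤ ((K : ℝ) + 1) * ‖1 - z‖ →
      ‖∑' k, (u (K + k) : ℂ) * z ^ (K + k)‖ ≤ C * (((K : ℝ) + 1) * G K) := by
  induction j generalizing G u with
  | zero =>
    obtain ⟨C, hC⟩ := hu
    simp only [pow_zero, div_one] at hs hB
    refine ⟨|C| * |B|, by positivity, fun z K hz _ => ?_⟩
    have hsK : Summable fun k => G (K + k) := by
      simpa [add_comm] using (summable_nat_add_iff K).2 hs
    have hb : ∀ k, ‖(u (K + k) : ℂ) * z ^ (K + k)‖ ≤ |C| * G (K + k) := fun k => by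
      rw [norm_mul, norm_pow, Complex.norm_real, Real.norm_eq_abs]
      calc |u (K + k)| * ‖z‖ ^ (K + k) ≤ |u (K + k)| * 1 := by
            gcongr; exact pow_le_one₀ (norm_nonneg _) hz.le
        _ ≤ C * G (K + k) := by rw [mul_one]; exact hC _
        _ ≤ _ := mul_le_mul_of_nonneg_right (le_abs_self C) (hG _)
    calc ‖∑' k, (u (K + k) : ℂ) * z ^ (K + k)‖ ≤ ∑' k, |C| * G (K + k) :=
          tsum_of_norm_bounded (hsK.mul_left _).hasSum hb
      _ = |C| * ∑' k, G (K + k) := tsum_mul_left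
      _ ≤ |C| * (|B| * (G K * ((K : ℝ) + 1))) := by
          gcongr
          refine (hB K).trans (mul_le_mul_of_nonneg_right (le_abs_self B) ?_)
          exact mul_nonneg (hG K) (by positivity)
      _ = _ := by ring
  | succ j ih =>
    have hdiv : ∀ k : ℕ, G k / ((k : ℝ) + 1) / ((k : ℝ) + 1) ^ j = G k / ((k : ℝ) + 1) ^ (j + 1) :=
      fun k => by rw [div_div, pow_succ, mul_comm ((k : ℝ) + 1)]
    obtain ⟨D, hD0, hD⟩ := ih (G := fun k => G k / ((k : ℝ) + 1))
      (fun k => div_nonneg (hG k) (by positivity)) hu.2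
      (by simpa only [hdiv] using hs) (fun K => by
        have h1 : ∀ k : ℕ, G (K + k) / (((K + k : ℕ) : ℝ) + 1) / (((K + k : ℕ) : ℝ) + 1) ^ j
          = G (K + k) / (((K + k : ℕ) : ℝ) + 1) ^ (j + 1) := fun k => hdiv (K + k)
        simp only [h1]
        refine (hB K).trans (le_of_eq ?_)
        rw [pow_succ]; field_simp)
    obtain ⟨C, hC⟩ := hu.1
    refine ⟨|C| + D, by positivity, fun z K hz hK => ?_⟩
    -- Any single term of the convergent series is at most its sum, so `G` grows polynomially; this
    -- is what makes the power series absolutely convergent.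
    have hgrow : ∃ A, ∀ k, G k ≤ A * ((k : ℝ) + 1) ^ (j + 1) := by
      refine ⟨∑' k : ℕ, G k / ((k : ℝ) + 1) ^ (j + 1), fun k => ?_⟩
      rw [← div_le_iff₀ (by positivity)]
      exact hs.le_tsum k fun i _ => div_nonneg (hG i) (by positivity)
    obtain ⟨A, hA⟩ := hgrow
    have hub : ∀ k, |u k| ≤ |C| * A * ((k : ℝ) + 1) ^ (j + 1) := fun k => by
      calc |u k| ≤ C * G k := hC k
        _ ≤ |C| * G k := mul_le_mul_of_nonneg_right (le_abs_self C) (hG k)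
        _ ≤ |C| * (A * ((k : ℝ) + 1) ^ (j + 1)) := by gcongr; exact hA k
        _ = _ := by ring
    have hsum0 := summable_cpow_mul_of_le hub hz
    set f : ℕ → ℂ := fun k => (u (K + k) : ℂ) * z ^ (K + k) with hf
    have hsum : Summable f := by
      simpa [hf, add_comm] using (summable_nat_add_iff K).2 hsum0
    have hsum1 : Summable fun k => f (k + 1) := (summable_nat_add_iff 1).2 hsum
    -- One summation by parts. The new coefficients have weight `G k / (k + 1)`, so the induction
    -- hypothesis bounds their tail by a multiple of `G K`, the size of the boundary term.
    have hid : (1 - z) * ∑' k, f k = (u K : ℂ) * z ^ K +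
        z * ∑' k, ((u (K + k + 1) - u (K + k) : ℝ) : ℂ) * z ^ (K + k) := by
      have e1 : ∑' k, f k = f 0 + ∑' k, f (k + 1) := hsum.tsum_eq_zero_add
      have e2 : z * ∑' k, ((u (K + k + 1) - u (K + k) : ℝ) : ℂ) * z ^ (K + k)
          = ∑' k, (f (k + 1) - z * f k) := by
        rw [← tsum_mul_left]
        congr 1
        funext k
        simp only [hf]
        push_cast
        rw [← add_assoc, pow_succ]
        ring
      rw [e2, hsum1.tsum_sub (hsum.mul_left z), tsum_mul_left, sub_mul, one_mul]
      rw [show (u K : ℂ) * z ^ K = f 0 by simp [hf]]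
      rw [e1]
      ring
    have hpos : 0 < ‖1 - z‖ := by
      by_contra h
      have : ‖1 - z‖ = 0 := le_antisymm (not_lt.1 h) (norm_nonneg _)
      rw [this] at hK
      linarith
    have hDK := hD z K hz hK
    have hstep : ‖1 - z‖ * ‖∑' k, f k‖ ≤ (|C| + D) * G K := by
      rw [← norm_mul, hid]
      refine (norm_add_le _ _).trans ?_
      have h1 : ‖(u K : ℂ) * z ^ K‖ ≤ |C| * G K := by
        rw [norm_mul, norm_pow, Complex.norm_real, Real.norm_eq_abs]
        calc |u K| * ‖z‖ ^ K ≤ |u K| * 1 := by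
              gcongr; exact pow_le_one₀ (norm_nonneg _) hz.le
          _ ≤ C * G K := by rw [mul_one]; exact hC _
          _ ≤ _ := mul_le_mul_of_nonneg_right (le_abs_self C) (hG _)
      have h2 : ‖z * ∑' k, ((u (K + k + 1) - u (K + k) : ℝ) : ℂ) * z ^ (K + k)‖ ≤ D * G K := by
        rw [norm_mul]
        refine (mul_le_of_le_one_left (norm_nonneg _) hz.le).trans (hDK.trans (le_of_eq ?_))
        field_simp
      linarith
    calc ‖∑' k, f k‖ = 1 * ‖∑' k, f k‖ := (one_mul _).symm
      _ ≤ ((K : ℝ) + 1) * ‖1 - z‖ * ‖∑' k, f k‖ := by gcongr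
      _ = ((K : ℝ) + 1) * (‖1 - z‖ * ‖∑' k, f k‖) := by ring
      _ ≤ ((K : ℝ) + 1) * ((|C| + D) * G K) := by gcongr
      _ = _ := by ring

/-- Telescoping, from `1 / m² ≤ 2 / m - 2 / (m + 1)` for `m ≥ 1`. -/
lemma sum_range_one_div_sq_le (K n : ℕ) :
    ∑ k ∈ Finset.range n, 1 / (((K + k : ℕ) : ℝ) + 1) ^ 2 ≤
      2 / ((K : ℝ) + 1) - 2 / (((K + n : ℕ) : ℝ) + 1) := by
  induction n with
  | zero => simp
  | succ n ih =>
    rw [Finset.sum_range_succ]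
    have hm : (1 : ℝ) ≤ ((K + n : ℕ) : ℝ) + 1 := by
      linarith [(Nat.cast_nonneg (K + n) : (0 : ℝ) ≤ ((K + n : ℕ) : ℝ))]
    have : 1 / (((K + n : ℕ) : ℝ) + 1) ^ 2 ≤
        2 / (((K + n : ℕ) : ℝ) + 1) - 2 / (((K + (n + 1) : ℕ) : ℝ) + 1) := by
      have e : ((K + (n + 1) : ℕ) : ℝ) + 1 = (((K + n : ℕ) : ℝ) + 1) + 1 := by push_cast; ring
      rw [e]
      generalize ((K + n : ℕ) : ℝ) + 1 = m at hm
      rw [div_sub_div _ _ (by positivity) (by positivity), div_le_div_iff₀ (by positivity)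
        (by positivity)]
      nlinarith
    linarith

/-- This fixes the number of summations by parts: if `G` grows at most like `k ^ q`, then order `q +
2` makes the weights summable, with tails governed by their first term as `norm_tsum_tail_le`
demands. -/
lemma tail_sum_le {G : ℕ → ℝ} (hG : ∀ k, 0 ≤ G k) {A : ℝ} {q : ℕ}
    (hA : ∀ l k : ℕ, l ≤ k → G k ≤ A * (((k : ℝ) + 1) / ((l : ℝ) + 1)) ^ q * G l) :
    (Summable fun k : ℕ => G k / ((k : ℝ) + 1) ^ (q + 2)) ∧
    ∀ K : ℕ, ∑' k : ℕ, G (K + k) / (((K + k : ℕ) : ℝ) + 1) ^ (q + 2)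
      ≤ (2 * |A|) * (G K * (((K : ℝ) + 1) / ((K : ℝ) + 1) ^ (q + 2))) := by
  have hterm : ∀ K k : ℕ, G (K + k) / (((K + k : ℕ) : ℝ) + 1) ^ (q + 2) ≤
      |A| * G K / ((K : ℝ) + 1) ^ q * (1 / (((K + k : ℕ) : ℝ) + 1) ^ 2) := fun K k => by
    rw [div_le_iff₀ (by positivity)]
    calc G (K + k) ≤ A * ((((K + k : ℕ) : ℝ) + 1) / ((K : ℝ) + 1)) ^ q * G K :=
          hA K (K + k) (Nat.le_add_right _ _)
      _ ≤ |A| * ((((K + k : ℕ) : ℝ) + 1) / ((K : ℝ) + 1)) ^ q * G K := by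
          gcongr
          · exact hG K
          · exact le_abs_self A
      _ = _ := by rw [div_pow, pow_add]; field_simp
  have hpart : ∀ K n : ℕ, ∑ k ∈ Finset.range n, G (K + k) / (((K + k : ℕ) : ℝ) + 1) ^ (q + 2)
      ≤ (2 * |A|) * (G K * (((K : ℝ) + 1) / ((K : ℝ) + 1) ^ (q + 2))) := fun K n => by
    have hc : 0 ≤ |A| * G K / ((K : ℝ) + 1) ^ q :=
      div_nonneg (mul_nonneg (abs_nonneg _) (hG K)) (by positivity)
    calc ∑ k ∈ Finset.range n, G (K + k) / (((K + k : ℕ) : ℝ) + 1) ^ (q + 2)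
        ≤ ∑ k ∈ Finset.range n, |A| * G K / ((K : ℝ) + 1) ^ q *
            (1 / (((K + k : ℕ) : ℝ) + 1) ^ 2) := Finset.sum_le_sum fun k _ => hterm K k
      _ = |A| * G K / ((K : ℝ) + 1) ^ q *
            ∑ k ∈ Finset.range n, 1 / (((K + k : ℕ) : ℝ) + 1) ^ 2 := by rw [Finset.mul_sum]
      _ ≤ |A| * G K / ((K : ℝ) + 1) ^ q * (2 / ((K : ℝ) + 1)) := by
          gcongr
          refine (sum_range_one_div_sq_le K n).trans ?_
          have : 0 ≤ 2 / (((K + n : ℕ) : ℝ) + 1) := by positivity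
          linarith
      _ = _ := by rw [pow_add]; field_simp
  have hn : ∀ K k : ℕ, 0 ≤ G (K + k) / (((K + k : ℕ) : ℝ) + 1) ^ (q + 2) :=
    fun K k => div_nonneg (hG _) (by positivity)
  refine ⟨?_, fun K => Real.tsum_le_of_sum_range_le (hn K) (hpart K)⟩
  simpa using summable_of_sum_range_le (hn 0) (hpart 0)

section PowerSeries

variable {V : ℝ → ℝ} {C : ℝ} {M q : ℕ}

lemma TailFn.weight_pos (hV : TailFn V C M) (k : ℕ) : 0 < V (1 / ((k : ℝ) + 1)) :=
  hV.pos _ (by positivity) ((div_le_one (by positivity)).2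
    (by linarith [(Nat.cast_nonneg k : (0:ℝ) ≤ k)]))

lemma TailFn.weight_le (hV : TailFn V C M) {l k : ℕ} (h : l ≤ k) :
    V (1 / ((l : ℝ) + 1)) ≤
      C * (((k : ℝ) + 1) / ((l : ℝ) + 1)) ^ M * V (1 / ((k : ℝ) + 1)) := by
  have hlk : (l : ℝ) ≤ k := Nat.cast_le.2 h
  have := hV.growth (1 / ((l : ℝ) + 1)) (1 / ((k : ℝ) + 1)) (by positivity)
    (one_div_le_one_div_of_le (by positivity) (by linarith))
    ((div_le_one (by positivity)).2 (by linarith [(Nat.cast_nonneg l : (0:ℝ) ≤ l)]))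
  convert this using 4
  field_simp

lemma TailFn.weight_antitone (hV : TailFn V C M) {l k : ℕ} (h : l ≤ k) :
    V (1 / ((k : ℝ) + 1)) ≤ V (1 / ((l : ℝ) + 1)) := by
  have hlk : (l : ℝ) ≤ k := Nat.cast_le.2 h
  exact hV.mono _ _ (by positivity) (one_div_le_one_div_of_le (by positivity) (by linarith))
    ((div_le_one (by positivity)).2 (by linarith [(Nat.cast_nonneg l : (0:ℝ) ≤ l)]))

/-- The size of the coefficients: `(k + 1) ^ q / V (1 / (k + 1))`. -/
def coeffWeight (V : ℝ → ℝ) (q k : ℕ) : ℝ := ((k : ℝ) + 1) ^ q * (V (1 / ((k : ℝ) + 1)))⁻¹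

lemma coeffWeight_pos (hV : TailFn V C M) (k : ℕ) : 0 < coeffWeight V q k :=
  mul_pos (by positivity) (inv_pos.2 (hV.weight_pos k))

lemma coeffWeight_mono (hV : TailFn V C M) {l k : ℕ} (h : l ≤ k) :
    coeffWeight V q l ≤ coeffWeight V q k := by
  have hlk : (l : ℝ) ≤ k := Nat.cast_le.2 h
  have := hV.weight_pos k
  have := hV.weight_pos l
  unfold coeffWeight
  gcongr
  · exact hV.weight_antitone h

lemma coeffWeight_growth (hV : TailFn V C M) {l k : ℕ} (h : l ≤ k) :
    coeffWeight V q k ≤ C * (((k : ℝ) + 1) / ((l : ℝ) + 1)) ^ (q + M) * coeffWeight V q l := by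
  have h1 := hV.weight_le h
  have h2 := hV.weight_pos k
  have h3 := hV.weight_pos l
  have h4 : (V (1 / ((k : ℝ) + 1)))⁻¹ ≤
      C * (((k : ℝ) + 1) / ((l : ℝ) + 1)) ^ M * (V (1 / ((l : ℝ) + 1)))⁻¹ := by
    rw [inv_le_iff_one_le_mul₀ h2, mul_comm, ← mul_assoc, ← div_eq_mul_inv, one_le_div h3]
    linarith
  unfold coeffWeight
  calc ((k : ℝ) + 1) ^ q * (V (1 / ((k : ℝ) + 1)))⁻¹
      ≤ ((k : ℝ) + 1) ^ q *
        (C * (((k : ℝ) + 1) / ((l : ℝ) + 1)) ^ M * (V (1 / ((l : ℝ) + 1)))⁻¹) := by gcongr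
    _ = _ := by rw [pow_add, div_pow, div_pow]; field_simp

lemma coeffWeight_le_pow (hV : TailFn V C M) (k : ℕ) :
    coeffWeight V q k ≤ C * coeffWeight V q 0 * ((k : ℝ) + 1) ^ (q + M) := by
  have := coeffWeight_growth (q := q) hV (Nat.zero_le k)
  simp only [Nat.cast_zero, zero_add, div_one] at this
  linarith

lemma exists_abs_le_pow (hV : TailFn V C M) {a : ℕ → ℝ} {D : ℝ}
    (ha : ∀ k, |a k| ≤ D * coeffWeight V q k) :
    ∃ A, ∀ k, |a k| ≤ A * ((k : ℝ) + 1) ^ (q + M) := by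
  refine ⟨|D| * (C * coeffWeight V q 0), fun k => ?_⟩
  calc |a k| ≤ D * coeffWeight V q k := ha k
    _ ≤ |D| * coeffWeight V q k :=
      mul_le_mul_of_nonneg_right (le_abs_self D) (coeffWeight_pos hV k).le
    _ ≤ |D| * (C * coeffWeight V q 0 * ((k : ℝ) + 1) ^ (q + M)) := by
      gcongr; exact coeffWeight_le_pow hV k
    _ = _ := by ring

/-- Pointwise upper estimate for power series whose coefficients are symbols. -/
lemma norm_tsum_le (hV : TailFn V C M) {a : ℕ → ℝ}
    (ha : ∀ j, SymbolBound j (coeffWeight V q) a) :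
    ∃ A, 0 < A ∧ ∀ z : ℂ, ‖z‖ < 1 → ‖∑' k, (a k : ℂ) * z ^ k‖ ≤
      A / ((min ‖1 - z‖ 1) ^ (q + 1) * V (min ‖1 - z‖ 1)) := by
  have hC := hV.one_le
  have hG0 : ∀ k, 0 ≤ coeffWeight V q k := fun k => (coeffWeight_pos hV k).le
  obtain ⟨hs, hB⟩ := tail_sum_le hG0 (A := C) (q := q + M) fun l k h => coeffWeight_growth hV h
  obtain ⟨D, hD0, hD⟩ := norm_tsum_tail_le _ hG0 (ha (q + M + 2)) _ hs hB
  obtain ⟨E, hE⟩ := (ha 0).bound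
  obtain ⟨A', hA'⟩ := exists_abs_le_pow hV hE
  have hE0 : 0 ≤ E := by
    have h1 := (abs_nonneg _).trans (hE 0)
    have h2 := coeffWeight_pos (q := q) hV 0
    by_contra h
    nlinarith
  refine ⟨(E + D + 1) * (2 ^ (q + 1) * (C * 2 ^ M)), by positivity, fun z hz => ?_⟩
  set δ := min ‖1 - z‖ 1 with hδ
  have hδ0 : 0 < δ := by
    refine lt_min ?_ one_pos
    rw [norm_pos_iff, sub_ne_zero]
    rintro rfl
    simp at hz
  have hδ1 : δ ≤ 1 := min_le_right _ _
  -- At frequencies below `1 / δ` there is no cancellation and the sum is estimated term by term;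
  -- beyond, summation by parts applies because `(K + 1) |1 - z| ≥ 1`.
  set K := ⌊1 / δ⌋₊ with hK
  have hK1 : (K : ℝ) ≤ 1 / δ := Nat.floor_le (by positivity)
  have hK2 : 1 / δ < (K : ℝ) + 1 := Nat.lt_floor_add_one _
  have hK3 : 1 ≤ ((K : ℝ) + 1) * ‖1 - z‖ := by
    rw [div_lt_iff₀ hδ0] at hK2
    exact hK2.le.trans (by gcongr; exact min_le_left _ _)
  have hK4 : (K : ℝ) + 1 ≤ 2 / δ := by
    have : 1 ≤ 1 / δ := (one_le_div hδ0).2 hδ1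
    calc (K : ℝ) + 1 ≤ 1 / δ + 1 / δ := by linarith
      _ = _ := by ring
  have hsum := summable_cpow_mul_of_le hA' hz
  have hsplit : ∑' k, (a k : ℂ) * z ^ k = ∑ k ∈ Finset.range K, (a k : ℂ) * z ^ k +
      ∑' k, (a (K + k) : ℂ) * z ^ (K + k) := by
    rw [← hsum.sum_add_tsum_nat_add K]
    simp only [add_comm]
  have hhead : ‖∑ k ∈ Finset.range K, (a k : ℂ) * z ^ k‖ ≤
      E * (((K : ℝ) + 1) * coeffWeight V q K) := by
    calc ‖∑ k ∈ Finset.range K, (a k : ℂ) * z ^ k‖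
        ≤ ∑ k ∈ Finset.range K, ‖(a k : ℂ) * z ^ k‖ := norm_sum_le _ _
      _ ≤ ∑ k ∈ Finset.range K, E * coeffWeight V q K := by
          refine Finset.sum_le_sum fun k hk => ?_
          rw [norm_mul, norm_pow, Complex.norm_real, Real.norm_eq_abs]
          calc |a k| * ‖z‖ ^ k ≤ |a k| * 1 := by
                gcongr; exact pow_le_one₀ (norm_nonneg _) hz.le
            _ ≤ E * coeffWeight V q k := by rw [mul_one]; exact hE k
            _ ≤ _ := by gcongr; exact coeffWeight_mono hV (Finset.mem_range.1 hk).le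
      _ = K * (E * coeffWeight V q K) := by rw [Finset.sum_const, Finset.card_range, nsmul_eq_mul]
      _ ≤ ((K : ℝ) + 1) * (E * coeffWeight V q K) := by
          gcongr
          · exact mul_nonneg hE0 (hG0 K)
          · linarith
      _ = _ := by ring
  have htail := hD z K hz hK3
  have hVδ := hV.pos δ hδ0 hδ1
  have hVK := hV.weight_pos K
  have hwK : (V (1 / ((K : ℝ) + 1)))⁻¹ ≤ C * 2 ^ M * (V δ)⁻¹ := by
    rw [inv_le_iff_one_le_mul₀ hVK, mul_comm, ← mul_assoc, ← div_eq_mul_inv, one_le_div hVδ]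
    rw [mul_comm (V _)]
    refine hV.le_of_le_mul (by norm_num) (by positivity) ((div_le_one (by positivity)).2
        (by linarith [(Nat.cast_nonneg K : (0:ℝ) ≤ K)])) hδ0 hδ1 ?_
    rw [mul_one_div, le_div_iff₀ (by positivity)]
    rw [le_div_iff₀ hδ0] at hK4
    linarith
  rw [hsplit]
  calc ‖∑ k ∈ Finset.range K, (a k : ℂ) * z ^ k + ∑' k, (a (K + k) : ℂ) * z ^ (K + k)‖
      ≤ E * (((K : ℝ) + 1) * coeffWeight V q K) + D * (((K : ℝ) + 1) * coeffWeight V q K) :=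
        (norm_add_le _ _).trans (add_le_add hhead htail)
    _ ≤ (E + D + 1) * (((K : ℝ) + 1) ^ (q + 1) * (V (1 / ((K : ℝ) + 1)))⁻¹) := by
        have e : ((K : ℝ) + 1) * coeffWeight V q K =
          ((K : ℝ) + 1) ^ (q + 1) * (V (1 / ((K : ℝ) + 1)))⁻¹ := by
          unfold coeffWeight; rw [pow_succ]; ring
        rw [e]
        have : 0 ≤ ((K : ℝ) + 1) ^ (q + 1) * (V (1 / ((K : ℝ) + 1)))⁻¹ := by positivity
        linarith
    _ ≤ (E + D + 1) * ((2 / δ) ^ (q + 1) * (C * 2 ^ M * (V δ)⁻¹)) := by gcongr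
    _ = _ := by rw [div_pow]; field_simp

/-- Lower estimate at positive points. -/
lemma le_tsum_real (hV : TailFn V C M) {a : ℕ → ℝ} (ha0 : ∀ k, 0 ≤ a k) {D B : ℝ} (hB : 0 < B)
    (ha : ∀ k, |a k| ≤ D * coeffWeight V q k) (ha1 : ∀ k, 1 ≤ k → coeffWeight V q k ≤ B * a k)
    {x₀ : ℝ} (hx₀ : 0 < x₀) :
    ∃ A, 0 < A ∧ ∀ x : ℝ, x₀ ≤ x → x < 1 →
      1 / ((1 - x) ^ (q + 1) * V (1 - x)) ≤ A * ∑' k, a k * x ^ k := by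
  have hC := hV.one_le
  obtain ⟨A', hA'⟩ := exists_abs_le_pow hV ha
  refine ⟨Real.exp (4 / x₀) * B, by positivity, fun x hx hx1 => ?_⟩
  have hx0 : 0 < x := hx₀.trans_le hx
  set δ := 1 - x with hδ
  have hδ0 : 0 < δ := by linarith
  have hδ1 : δ ≤ 1 := by linarith
  -- The block `K ≤ k < 2 K` alone suffices: there `x ^ k` is bounded below, and `K ≥ 1` keeps away
  -- from index `0`, where the coefficients of the radial derivative vanish.
  set K := ⌈1 / δ⌉₊ with hK
  have hK1 : 1 / δ ≤ K := Nat.le_ceil _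
  have hK2 : (K : ℝ) < 1 / δ + 1 := Nat.ceil_lt_add_one (by positivity)
  have hinv : 1 ≤ 1 / δ := (one_le_div hδ0).2 hδ1
  have hK3 : (2 * K : ℝ) ≤ 4 / δ := by
    calc (2 * K : ℝ) ≤ 2 * (1 / δ + 1 / δ) := by linarith
      _ = _ := by ring
  have hKpos : 1 ≤ K := by
    have : (1 : ℝ) ≤ K := hinv.trans hK1
    exact_mod_cast this
  have hsum : Summable fun k => a k * x ^ k := by
    refine (summable_pow_mul_of_le hA' hx0.le hx1).congr fun k => ?_
    rw [abs_of_nonneg (ha0 k)]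
  have hxK : ∀ k ∈ Finset.Ico K (2 * K), Real.exp (-(4 / x₀)) ≤ x ^ k := fun k hk => by
    have hk' : k ≤ 2 * K := (Finset.mem_Ico.1 hk).2.le
    have h1 : Real.exp (-(δ / x)) ≤ x := by
      rw [Real.exp_neg, inv_le_comm₀ (Real.exp_pos _) hx0]
      have := Real.add_one_le_exp (δ / x)
      calc x⁻¹ = δ / x + 1 := by rw [hδ]; field_simp; ring
        _ ≤ _ := this
    calc Real.exp (-(4 / x₀)) ≤ Real.exp (((2 * K : ℕ) : ℝ) * (-(δ / x))) := by
          apply Real.exp_le_exp.2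
          push_cast
          have : 2 * (K : ℝ) * (δ / x) ≤ 4 / x₀ := by
            calc 2 * (K : ℝ) * (δ / x) ≤ 4 / δ * (δ / x₀) := by gcongr
              _ = _ := by field_simp
          linarith
      _ = Real.exp (-(δ / x)) ^ (2 * K) := by rw [Real.exp_nat_mul]
      _ ≤ x ^ (2 * K) := by gcongr
      _ ≤ x ^ k := pow_le_pow_of_le_one hx0.le hx1.le hk'
  have hVδ := hV.pos δ hδ0 hδ1
  have hterm : ∀ k ∈ Finset.Ico K (2 * K),
      Real.exp (-(4 / x₀)) * ((1 / δ) ^ q * (V δ)⁻¹) ≤ B * (a k * x ^ k) := fun k hk => by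
    have hk1 := (Finset.mem_Ico.1 hk).1
    have hkK : (K : ℝ) ≤ k := Nat.cast_le.2 hk1
    have h1 := ha1 k (hKpos.trans hk1)
    have h2 : (1 / δ) ^ q * (V δ)⁻¹ ≤ coeffWeight V q k := by
      unfold coeffWeight
      have := hV.weight_pos k
      gcongr
      · linarith
      · refine hV.mono _ _ (by positivity) ?_ hδ1
        rw [div_le_iff₀ (by positivity)]
        rw [div_le_iff₀ hδ0] at hK1
        nlinarith
    calc Real.exp (-(4 / x₀)) * ((1 / δ) ^ q * (V δ)⁻¹) ≤ x ^ k * (B * a k) := by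
          have := hxK k hk
          have h3 := h2.trans h1
          gcongr
      _ = _ := by ring
  have hfin : (K : ℝ) * (Real.exp (-(4 / x₀)) * ((1 / δ) ^ q * (V δ)⁻¹)) ≤
      B * ∑' k, a k * x ^ k := by
    calc (K : ℝ) * (Real.exp (-(4 / x₀)) * ((1 / δ) ^ q * (V δ)⁻¹))
        = ∑ k ∈ Finset.Ico K (2 * K), Real.exp (-(4 / x₀)) * ((1 / δ) ^ q * (V δ)⁻¹) := by
          rw [Finset.sum_const, Nat.card_Ico, nsmul_eq_mul]; congr 2; omega
      _ ≤ ∑ k ∈ Finset.Ico K (2 * K), B * (a k * x ^ k) := Finset.sum_le_sum hterm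
      _ = B * ∑ k ∈ Finset.Ico K (2 * K), a k * x ^ k := by rw [Finset.mul_sum]
      _ ≤ _ := by
          gcongr
          exact hsum.sum_le_tsum _ fun k _ => mul_nonneg (ha0 k) (by positivity)
  calc 1 / (δ ^ (q + 1) * V δ)
      = Real.exp (4 / x₀) * (1 / δ * (Real.exp (-(4 / x₀)) * ((1 / δ) ^ q * (V δ)⁻¹))) := by
        rw [Real.exp_neg, pow_succ, one_div_pow]; field_simp
    _ ≤ Real.exp (4 / x₀) * (K * (Real.exp (-(4 / x₀)) * ((1 / δ) ^ q * (V δ)⁻¹))) := by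
        gcongr
    _ ≤ Real.exp (4 / x₀) * (B * ∑' k, a k * x ^ k) := by gcongr
    _ = _ := by ring

end PowerSeries

/-! ### Lower bounds for means on circles -/

/-- Functions on the unit disc of the size `1 / U |1 - z|`, up to constants: an upper bound on the
whole disc, and a lower bound on the positive radius away from the origin. -/
structure SizeLike (U : ℝ → ℝ) (F : ℂ → ℂ) (A : ℝ) : Prop where
  diff : DifferentiableOn ℂ F (ball 0 1)
  le : ∀ z : ℂ, ‖z‖ < 1 → ‖F z‖ ≤ A / U (min ‖1 - z‖ 1)
  ge : ∀ x : ℝ, 1 / 256 ≤ x → x < 1 → 1 / U (1 - x) ≤ A * ‖F x‖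

lemma SizeLike.pos {U : ℝ → ℝ} {C : ℝ} {M : ℕ} (hU : TailFn U C M) {F : ℂ → ℂ} {A : ℝ}
    (hF : SizeLike U F A) : 0 < A := by
  have h1 := hF.ge (1 / 2) (by norm_num) (by norm_num)
  have h2 := hU.pos (1 - 1 / 2) (by norm_num) (by norm_num)
  have h3 : 0 < 1 / U (1 - 1 / 2) := by positivity
  by_contra h
  have := mul_nonpos_of_nonpos_of_nonneg (not_lt.1 h) (norm_nonneg (F ((1 / 2 : ℝ) : ℂ)))
  linarith

section Circle

/-- Since `Re (1 - ζ) ≥ 0`, the cross term in `|s + (1 - ζ)|²` is nonnegative, and `(s + d)² ≤ 2 (s²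
+ d²)`. -/
lemma add_le_two_mul_norm {s : ℝ} (hs : 0 ≤ s) {ζ : ℂ} (hζ : ‖ζ‖ ≤ 1) :
    s + ‖1 - ζ‖ ≤ 2 * ‖1 + (s : ℂ) - ζ‖ := by
  have hre : 0 ≤ (1 - ζ).re := by
    have := Complex.re_le_norm ζ
    simp only [Complex.sub_re, Complex.one_re]; linarith
  have h1 : ‖1 + (s : ℂ) - ζ‖ ^ 2 = s ^ 2 + 2 * s * (1 - ζ).re + ‖1 - ζ‖ ^ 2 := by
    rw [← Complex.normSq_eq_norm_sq, ← Complex.normSq_eq_norm_sq, Complex.normSq_apply,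
      Complex.normSq_apply]
    simp
    ring
  have h2 : (s + ‖1 - ζ‖) ^ 2 ≤ (2 * ‖1 + (s : ℂ) - ζ‖) ^ 2 := by
    have : 0 ≤ 2 * s * (1 - ζ).re := by positivity
    rw [mul_pow, h1]
    nlinarith [sq_nonneg (s - ‖1 - ζ‖)]
  exact (abs_le_of_sq_le_sq' h2 (by positivity)).2

/-- The numerator is at most `2 s`. For the denominator, the distance from `ζ` to `1 - s` dominates
`s`, hence a third of `s + |1 - ζ|`. -/
lemma poissonKernel_le {s : ℝ} (hs : 0 < s) (hs1 : s ≤ 1) {ζ : ℂ} (hζ : ‖ζ‖ = 1) :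
    poissonKernel 0 ((1 - s : ℝ) : ℂ) ζ ≤ 18 * (s / (s + ‖1 - ζ‖) ^ 2) := by
  have h1 : s ≤ ‖ζ - ((1 - s : ℝ) : ℂ)‖ := by
    have := norm_sub_norm_le ζ ((1 - s : ℝ) : ℂ)
    rw [hζ, Complex.norm_real, Real.norm_eq_abs, abs_of_nonneg (by linarith)] at this
    linarith
  have h2 : ‖1 - ζ‖ ≤ ‖ζ - ((1 - s : ℝ) : ℂ)‖ + s := by
    have : (1 : ℂ) - ζ = -(ζ - ((1 - s : ℝ) : ℂ)) + (s : ℂ) := by push_cast; ring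
    rw [this]
    refine (norm_add_le _ _).trans ?_
    rw [norm_neg, Complex.norm_real, Real.norm_eq_abs, abs_of_pos hs]
  rw [poissonKernel_def]
  simp only [sub_zero, hζ, one_pow, Complex.norm_real, Real.norm_eq_abs, sq_abs]
  have h3 : 0 < s + ‖1 - ζ‖ := by positivity
  calc (1 - (1 - s) ^ 2) / ‖ζ - ((1 - s : ℝ) : ℂ)‖ ^ 2
      ≤ (2 * s) / ((s + ‖1 - ζ‖) / 3) ^ 2 := by
        gcongr
        · nlinarith
        · linarith
    _ = _ := by field_simp; norm_num

lemma poissonKernel_nonneg {a : ℝ} (ha : 0 ≤ a) (ha1 : a ≤ 1) {ζ : ℂ} (hζ : ‖ζ‖ = 1) :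
    0 ≤ poissonKernel 0 (a : ℂ) ζ := by
  rw [poissonKernel_def]
  simp only [sub_zero, hζ, one_pow, Complex.norm_real, Real.norm_eq_abs, sq_abs]
  apply div_nonneg _ (by positivity)
  nlinarith

lemma continuousOn_poissonKernel {a : ℝ} (ha : 0 ≤ a) (ha1 : a < 1) :
    ContinuousOn (poissonKernel 0 (a : ℂ)) (sphere 0 1) := by
  unfold poissonKernel
  refine ContinuousOn.div (by fun_prop) (by fun_prop) fun ζ hζ => ?_
  have hζ1 : ‖ζ‖ = 1 := by simpa using hζ
  have : ‖ζ - 0 - ((a : ℂ) - 0)‖ ≠ 0 := by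
    rw [sub_zero, sub_zero, norm_ne_zero_iff, sub_ne_zero]
    rintro rfl
    rw [Complex.norm_real, Real.norm_eq_abs, abs_of_nonneg ha] at hζ1
    linarith
  positivity

lemma norm_circleAverage_le {f : ℂ → ℂ} {g : ℂ → ℝ} (hg : ContinuousOn g (sphere 0 1))
    (h : ∀ ζ ∈ sphere (0 : ℂ) 1, ‖f ζ‖ ≤ g ζ) :
    ‖Real.circleAverage f 0 1‖ ≤ Real.circleAverage g 0 1 := by
  unfold Real.circleAverage
  rw [norm_smul, Real.norm_eq_abs, abs_of_pos (by positivity), smul_eq_mul]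
  have hgi : CircleIntegrable g 0 1 := hg.circleIntegrable zero_le_one
  refine mul_le_mul_of_nonneg_left ?_ (by positivity)
  exact intervalIntegral.norm_integral_le_of_norm_le (by positivity)
    (.of_forall fun θ _ => h _ (circleMap_mem_sphere _ zero_le_one _)) hgi

variable {U : ℝ → ℝ} {C : ℝ} {M : ℕ} {F : ℂ → ℂ} {A : ℝ}

/-- The pointwise estimate behind the lower bound for means: the first power of `|F|` is controlled
by its power of exponent `p`, after damping near the point `1`. -/
lemma SizeLike.norm_mul_le (hU : TailFn U C M) (hF : SizeLike U F A) {p : ℝ} (hp : 0 < p)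
    {ε : ℝ} (hε : 0 < ε) :
    ∃ K, 0 < K ∧ ∀ (ρ s : ℝ) (ζ : ℂ), 0 ≤ ρ → ρ < 1 → 0 < s → s ≤ 1 → ‖ζ‖ = 1 →
      ‖F (ρ * ζ)‖ * (‖1 - ζ‖ / (s + ‖1 - ζ‖)) ^ (M + 1) ≤
        ε * (1 / U s) + K * (1 / U s) ^ (1 - p) *
          (‖F (ρ * ζ)‖ ^ p * (‖1 - ζ‖ / (s + ‖1 - ζ‖))) := by
  have hA := hF.pos hU
  have hC := hU.one_le
  set E := A * (C * 2 ^ M) with hE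
  have hE0 : 0 < E := by positivity
  refine ⟨ε ^ (1 - p) + E ^ (1 - p), by positivity, fun ρ s ζ hρ0 hρ1 hs hs1 hζ => ?_⟩
  have hUs := hU.pos s hs hs1
  set T := 1 / U s with hT
  have hT0 : 0 < T := by positivity
  set d := ‖1 - ζ‖ with hd
  have hd0 : 0 ≤ d := norm_nonneg _
  set X := ‖F (ρ * ζ)‖ with hX
  have hX0 : 0 ≤ X := norm_nonneg _
  set y := d / (s + d) with hy
  have hy0 : 0 ≤ y := by positivity
  have hy1 : y ≤ 1 := (div_le_one (by positivity)).2 (by linarith)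
  have hyM : y ^ (M + 1) ≤ y := pow_le_of_le_one hy0 hy1 (by omega)
  have hyM1 : y ^ (M + 1) ≤ 1 := pow_le_one₀ hy0 hy1
  have hR : 0 ≤ (X ^ p * y) := by positivity
  have hTp : 0 ≤ T ^ (1 - p) := by positivity
  have hXp : X = 0 ∨ X = X ^ p * X ^ (1 - p) := by
    rcases hX0.eq_or_lt with h | h
    · exact Or.inl h.symm
    · right; rw [← Real.rpow_add h]; simp
  rcases hXp with hX' | hX'
  · rw [hX']
    have : 0 ≤ (0 : ℝ) ^ p := Real.rpow_nonneg le_rfl _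
    simp only [zero_mul]
    positivity
  -- Write `X = X ^ p * X ^ (1 - p)`. For `p ≥ 1`, either `X ≤ ε T` and the first term suffices, or
  -- `X ^ (1 - p)` is at most `(ε T) ^ (1 - p)`. For `p ≤ 1` the upper bound for `F` is needed to
  -- control `X ^ (1 - p)`.
  rcases le_total 1 p with hp1 | hp1
  · by_cases hXε : X ≤ ε * T
    · calc X * y ^ (M + 1) ≤ ε * T * 1 := by gcongr
        _ ≤ _ := by
          rw [mul_one]
          have : 0 ≤ (ε ^ (1 - p) + E ^ (1 - p)) * T ^ (1 - p) * (X ^ p * y) := by positivity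
          linarith
    · have hXε' : ε * T < X := not_le.1 hXε
      have h1 : X ^ (1 - p) ≤ (ε * T) ^ (1 - p) :=
        Real.rpow_le_rpow_of_nonpos (by positivity) hXε'.le (by linarith)
      rw [Real.mul_rpow hε.le hT0.le] at h1
      calc X * y ^ (M + 1) ≤ X * y := by gcongr
        _ = X ^ p * X ^ (1 - p) * y := by rw [← hX']
        _ ≤ X ^ p * (ε ^ (1 - p) * T ^ (1 - p)) * y := by gcongr
        _ = ε ^ (1 - p) * T ^ (1 - p) * (X ^ p * y) := by ring
        _ ≤ _ := by
          have h2 : 0 ≤ E ^ (1 - p) * T ^ (1 - p) * (X ^ p * y) := by positivity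
          have h3 : 0 ≤ ε * T := by positivity
          linarith
  · rcases hd0.eq_or_lt with h | hdpos
    · have : y = 0 := by rw [hy, ← h]; simp
      rw [this]
      simp only [ne_eq, Nat.add_eq_zero_iff, one_ne_zero, and_false, not_false_eq_true, zero_pow,
        mul_zero, add_zero]
      positivity
    have hypos : 0 < y := by positivity
    have hd2 : d ≤ 2 := by
      calc d ≤ ‖(1 : ℂ)‖ + ‖ζ‖ := norm_sub_le _ _
        _ = 2 := by rw [hζ]; norm_num
    have hδd : d ≤ 2 * ‖1 - ρ * ζ‖ := by
      have h1 : ‖(ρ : ℂ) * ζ‖ = ρ := by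
        rw [norm_mul, hζ, mul_one, Complex.norm_real, Real.norm_eq_abs, abs_of_nonneg hρ0]
      have h2 : 1 - ρ ≤ ‖1 - ρ * ζ‖ := by
        have := norm_sub_norm_le (1 : ℂ) (ρ * ζ)
        rw [h1, norm_one] at this
        exact this
      have h3 : (1 : ℂ) - ζ = (1 - ρ * ζ) - ((1 - ρ : ℝ) : ℂ) * ζ := by push_cast; ring
      have h4 : ‖((1 - ρ : ℝ) : ℂ) * ζ‖ = 1 - ρ := by
        rw [norm_mul, hζ, mul_one, Complex.norm_real, Real.norm_eq_abs, abs_of_nonneg (by linarith)]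
      calc d = ‖(1 - ρ * ζ) - ((1 - ρ : ℝ) : ℂ) * ζ‖ := by rw [hd, h3]
        _ ≤ ‖1 - ρ * ζ‖ + (1 - ρ) := (norm_sub_le _ _).trans_eq (by rw [h4])
        _ ≤ _ := by linarith
    set δ := min ‖1 - (ρ : ℂ) * ζ‖ 1 with hδ
    have hδ0 : 0 < δ := lt_min (by linarith) one_pos
    have hUδ := hU.pos δ hδ0 (min_le_right _ _)
    have hylt : y⁻¹ = (s + d) / d := by rw [hy, inv_div]
    -- Here `s ≤ s + d = d / y` while `d` is at most twice the distance from `1` to `ρ ζ`, so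
    -- polynomial growth of `U` costs only a power `M` of `1 / y`.
    have hcmp : U s ≤ C * (2 * y⁻¹) ^ M * U δ := by
      refine hU.le_of_le_mul ?_ hδ0 (min_le_right _ _) hs hs1 ?_
      · have := (one_le_inv₀ hypos).2 hy1
        linarith
      · rw [hylt, hδ, mul_min_of_nonneg _ _ (by positivity)]
        refine le_min ?_ ?_
        · calc s ≤ s + d := by linarith
            _ = 2 * ((s + d) / d) * (d / 2) := by field_simp
            _ ≤ _ := by gcongr; linarith
        · rw [mul_one]
          calc s ≤ s + d := by linarith
            _ = (s + d) / d * d := by field_simp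
            _ ≤ (s + d) / d * 2 := by gcongr
            _ = _ := by ring
    have hXle : X ≤ E * (y⁻¹) ^ M * T := by
      have h1 : ‖F (ρ * ζ)‖ ≤ A / U δ := hF.le _ (by
        rw [norm_mul, hζ, mul_one, Complex.norm_real, Real.norm_eq_abs, abs_of_nonneg hρ0]
        exact hρ1)
      have h2 : 1 / U δ ≤ C * (2 * y⁻¹) ^ M * T := by
        rw [hT, div_le_iff₀ hUδ]
        rw [mul_one_div, div_mul_eq_mul_div, le_div_iff₀ hUs]
        linarith
      calc X ≤ A * (1 / U δ) := by rw [mul_one_div]; exact h1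
        _ ≤ A * (C * (2 * y⁻¹) ^ M * T) := by gcongr
        _ = _ := by rw [hE, mul_pow]; ring
    have hY : 1 ≤ (y⁻¹) ^ M := one_le_pow₀ ((one_le_inv₀ hypos).2 hy1)
    -- As `1 / y ≥ 1` and `1 - p ≤ 1`, the exponent `1 - p` on the power of `1 / y` can be raised to
    -- `1`; of the damping `y ^ (M + 1)` exactly one factor `y` then survives.
    have hX1p : X ^ (1 - p) ≤ E ^ (1 - p) * (y⁻¹) ^ M * T ^ (1 - p) := by
      calc X ^ (1 - p) ≤ (E * (y⁻¹) ^ M * T) ^ (1 - p) :=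
            Real.rpow_le_rpow hX0 hXle (by linarith)
        _ = E ^ (1 - p) * ((y⁻¹) ^ M) ^ (1 - p) * T ^ (1 - p) := by
            rw [Real.mul_rpow (by positivity) hT0.le, Real.mul_rpow hE0.le (by positivity)]
        _ ≤ E ^ (1 - p) * ((y⁻¹) ^ M) ^ (1 : ℝ) * T ^ (1 - p) := by
            gcongr
            linarith
        _ = _ := by rw [Real.rpow_one]
    have hyy : (y⁻¹) ^ M * y ^ (M + 1) = y := by
      rw [pow_succ, ← mul_assoc, ← mul_pow, inv_mul_cancel₀ hypos.ne', one_pow, one_mul]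
    calc X * y ^ (M + 1) = X ^ p * X ^ (1 - p) * y ^ (M + 1) := by rw [← hX']
      _ ≤ X ^ p * (E ^ (1 - p) * (y⁻¹) ^ M * T ^ (1 - p)) * y ^ (M + 1) := by gcongr
      _ = E ^ (1 - p) * T ^ (1 - p) * (X ^ p * ((y⁻¹) ^ M * y ^ (M + 1))) := by ring
      _ = E ^ (1 - p) * T ^ (1 - p) * (X ^ p * y) := by rw [hyy]
      _ ≤ _ := by
          have h2 : 0 ≤ ε ^ (1 - p) * T ^ (1 - p) * (X ^ p * y) := by positivity
          have h3 : 0 ≤ ε * T := by positivity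
          linarith

/-- The lower bound for means on circles. -/
lemma SizeLike.le_circleAverage (hU : TailFn U C M) (hF : SizeLike U F A) {p : ℝ} (hp : 0 < p) :
    ∃ K, 0 < K ∧ ∀ ρ s : ℝ, 1 / 32 ≤ ρ → ρ < 1 → 0 < s → s ≤ 7 / 8 → 1 - ρ ≤ 2 * s →
      (1 / U s) ^ p ≤ K * Real.circleAverage
        (fun ζ => ‖F (ρ * ζ)‖ ^ p * (‖1 - ζ‖ * s / (s + ‖1 - ζ‖) ^ 3)) 0 1 := by
  have hA := hF.pos hU
  have hC := hU.one_le
  set K₀ := A * (C * 3 ^ M) * 2 ^ (M + 1) * 2 ^ (M + 1) with hK₀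
  have hK₀p : 0 < K₀ := by positivity
  -- `K₀` collects all constants that multiply the error term, so this `ε` turns it into `T / 2`,
  -- which is absorbed at the end.
  obtain ⟨K, hK, hKF⟩ := hF.norm_mul_le hU hp (ε := 1 / (2 * K₀)) (by positivity)
  refine ⟨2 * (K₀ * (18 * K)), by positivity, fun ρ s hρ0 hρ1 hs hs1 hρs => ?_⟩
  have hUs := hU.pos s hs (by linarith)
  set T := 1 / U s with hT
  have hT0 : 0 < T := by positivity
  set a : ℝ := 1 - s with ha
  -- The damping factor is holomorphic on the closed disc, has modulus comparable to `|1 - ζ| / (s +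
  -- |1 - ζ|)` on the circle, and equals `1 / 2` at the point `a = 1 - s` where the Poisson formula
  -- is applied.
  set g : ℂ → ℂ := fun ζ => F (ρ * ζ) * ((1 - ζ) / (1 + (s : ℂ) - ζ)) ^ (M + 1) with hg
  have hmap : ∀ ζ : ℂ, ‖ζ‖ ≤ 1 → ‖(ρ : ℂ) * ζ‖ < 1 := fun ζ hζ => by
    rw [norm_mul, Complex.norm_real, Real.norm_eq_abs, abs_of_nonneg (by linarith)]
    calc ρ * ‖ζ‖ ≤ ρ * 1 := by gcongr
      _ < 1 := by linarith
  have hFd : DifferentiableOn ℂ (fun ζ : ℂ => F (ρ * ζ)) (closedBall 0 1) :=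
    hF.diff.comp (by fun_prop) fun ζ hζ => by
      simpa using hmap ζ (by simpa using hζ)
  have hden : ∀ ζ : ℂ, ‖ζ‖ ≤ 1 → 1 + (s : ℂ) - ζ ≠ 0 := fun ζ hζ h => by
    have := add_le_two_mul_norm hs.le hζ
    rw [h, norm_zero, mul_zero] at this
    linarith [norm_nonneg (1 - ζ)]
  have hgd : DifferentiableOn ℂ g (closedBall 0 1) := by
    refine hFd.mul (DifferentiableOn.pow (DifferentiableOn.div (by fun_prop) (by fun_prop)
      fun ζ hζ => hden ζ (by simpa using hζ)) _)
  have hgc : DiffContOnCl ℂ g (ball 0 1) :=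
    DifferentiableOn.diffContOnCl (hgd.mono closure_ball_subset_closedBall)
  have ha0 : 0 ≤ a := by rw [ha]; linarith
  have ha1 : a < 1 := by rw [ha]; linarith
  have hab : (a : ℂ) ∈ ball (0 : ℂ) 1 := by
    rw [mem_ball_zero_iff, Complex.norm_real, Real.norm_eq_abs, abs_of_nonneg ha0]; exact ha1
  have hP := hgc.circleAverage_poissonKernel_smul hab
  -- The Poisson formula for the constant function `1`.
  have hP1 : Real.circleAverage (poissonKernel 0 (a : ℂ)) 0 1 = 1 := by
    have := (diffContOnCl_const (c := (1 : ℂ)) (s := ball (0 : ℂ) 1)).circleAverage_poissonKernel_smul hab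
    have e : (poissonKernel 0 (a : ℂ) • fun _ : ℂ => (1 : ℂ)) =
        fun ζ => ((poissonKernel 0 (a : ℂ) ζ : ℝ) : ℂ) := by
      funext ζ; simp
    rw [e] at this
    unfold Real.circleAverage at this ⊢
    rw [intervalIntegral.integral_ofReal, ← Complex.ofReal_one] at this
    rw [Complex.real_smul, ← Complex.ofReal_mul] at this
    exact Complex.ofReal_injective this
  set h : ℂ → ℝ := fun ζ => ‖F (ρ * ζ)‖ ^ p * (‖1 - ζ‖ * s / (s + ‖1 - ζ‖) ^ 3) with hh
  have hhc : ContinuousOn h (sphere 0 1) := by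
    refine ContinuousOn.mul ?_ ?_
    · exact ContinuousOn.rpow_const ((hFd.continuousOn.mono sphere_subset_closedBall).norm)
        fun _ _ => Or.inr hp.le
    · refine ContinuousOn.div (by fun_prop) (by fun_prop) fun ζ _ => ?_
      have : 0 < s + ‖1 - ζ‖ := by positivity
      positivity
  have hPc := continuousOn_poissonKernel ha0 ha1
  set c₁ := 2 ^ (M + 1) * (1 / (2 * K₀) * T) with hc₁
  set c₂ := 2 ^ (M + 1) * (18 * (K * T ^ (1 - p))) with hc₂
  have hbound : ∀ ζ ∈ sphere (0 : ℂ) 1, ‖(poissonKernel 0 (a : ℂ) • g) ζ‖ ≤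
      c₁ * poissonKernel 0 (a : ℂ) ζ + c₂ * h ζ := fun ζ hζ => by
    have hζ1 : ‖ζ‖ = 1 := by simpa using hζ
    have hPn := poissonKernel_nonneg ha0 ha1.le hζ1
    have hPle := poissonKernel_le hs (by linarith) hζ1
    rw [← ha] at hPle
    have hb := hKF ρ s ζ (by linarith) hρ1 hs (by linarith) hζ1
    have h1 := add_le_two_mul_norm hs.le hζ1.le
    have hsd : 0 < s + ‖1 - ζ‖ := by positivity
    have h2 : ‖1 - ζ‖ / ‖1 + (s : ℂ) - ζ‖ ≤ 2 * (‖1 - ζ‖ / (s + ‖1 - ζ‖)) := by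
      calc ‖1 - ζ‖ / ‖1 + (s : ℂ) - ζ‖ ≤ ‖1 - ζ‖ / ((s + ‖1 - ζ‖) / 2) := by
            gcongr; linarith
        _ = _ := by field_simp
    rw [Pi.smul_apply', norm_smul, Real.norm_eq_abs, abs_of_nonneg hPn, hg]
    simp only [norm_mul, norm_pow, norm_div]
    calc poissonKernel 0 (a : ℂ) ζ * (‖F (ρ * ζ)‖ * (‖1 - ζ‖ / ‖1 + (s : ℂ) - ζ‖) ^ (M + 1))
        ≤ poissonKernel 0 (a : ℂ) ζ *
          (‖F (ρ * ζ)‖ * (2 * (‖1 - ζ‖ / (s + ‖1 - ζ‖))) ^ (M + 1)) := by gcongr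
      _ = 2 ^ (M + 1) * poissonKernel 0 (a : ℂ) ζ *
          (‖F (ρ * ζ)‖ * (‖1 - ζ‖ / (s + ‖1 - ζ‖)) ^ (M + 1)) := by rw [mul_pow]; ring
      _ ≤ 2 ^ (M + 1) * poissonKernel 0 (a : ℂ) ζ * (1 / (2 * K₀) * T + K * T ^ (1 - p) *
          (‖F (ρ * ζ)‖ ^ p * (‖1 - ζ‖ / (s + ‖1 - ζ‖)))) := by gcongr
      _ = c₁ * poissonKernel 0 (a : ℂ) ζ + 2 ^ (M + 1) * (K * T ^ (1 - p) *
          (‖F (ρ * ζ)‖ ^ p * (‖1 - ζ‖ / (s + ‖1 - ζ‖)))) * poissonKernel 0 (a : ℂ) ζ := by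
          rw [hc₁]; ring
      _ ≤ c₁ * poissonKernel 0 (a : ℂ) ζ + 2 ^ (M + 1) * (K * T ^ (1 - p) *
          (‖F (ρ * ζ)‖ ^ p * (‖1 - ζ‖ / (s + ‖1 - ζ‖)))) * (18 * (s / (s + ‖1 - ζ‖) ^ 2)) := by
          gcongr
      _ = _ := by rw [hc₂, hh]; field_simp
  have hPc' : ContinuousOn (fun ζ => c₁ * poissonKernel 0 (a : ℂ) ζ) (sphere 0 1) :=
    continuousOn_const.mul hPc
  have hhc' : ContinuousOn (fun ζ => c₂ * h ζ) (sphere 0 1) := continuousOn_const.mul hhc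
  have havg := norm_circleAverage_le (hPc'.add hhc') hbound
  rw [hP, show ((fun ζ => c₁ * poissonKernel 0 (a : ℂ) ζ) + fun ζ => c₂ * h ζ) =
    fun ζ => c₁ * poissonKernel 0 (a : ℂ) ζ + c₂ * h ζ from rfl,
    Real.circleAverage_fun_add (hPc'.circleIntegrable zero_le_one)
    (hhc'.circleIntegrable zero_le_one)] at havg
  have hc1 : Real.circleAverage (fun ζ => c₁ * poissonKernel 0 (a : ℂ) ζ) 0 1 = c₁ := by
    have := Real.circleAverage_fun_smul (a := c₁) (f := poissonKernel 0 (a : ℂ)) (c := 0) (R := 1)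
    simp only [smul_eq_mul] at this
    rw [this, hP1, mul_one]
  have hc2 : Real.circleAverage (fun ζ => c₂ * h ζ) 0 1 = c₂ * Real.circleAverage h 0 1 := by
    have := Real.circleAverage_fun_smul (a := c₂) (f := h) (c := 0) (R := 1)
    simpa only [smul_eq_mul] using this
  rw [hc1, hc2] at havg
  have hga : ‖g a‖ = ‖F ((ρ * a : ℝ) : ℂ)‖ * (1 / 2) ^ (M + 1) := by
    have e : (1 - (a : ℂ)) / (1 + (s : ℂ) - a) = ((1 / 2 : ℝ) : ℂ) := by
      have hs' : (s : ℂ) ≠ 0 := Complex.ofReal_ne_zero.2 hs.ne'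
      rw [ha]; push_cast
      rw [show (1 : ℂ) + s - (1 - s) = 2 * s by ring, show (1 : ℂ) - (1 - s) = s by ring]
      field_simp
    rw [hg]
    simp only [norm_mul, norm_pow, e]
    rw [Complex.norm_real, Real.norm_eq_abs, abs_of_pos (by norm_num)]
    push_cast
    rfl
  -- This is the origin of the threshold in `SizeLike.ge`: `ρ ≥ 1 / 32` and `a = 1 - s ≥ 1 / 8`.
  have hρa : 1 / 256 ≤ ρ * a := by
    calc (1 : ℝ) / 256 = 1 / 32 * (1 / 8) := by norm_num
      _ ≤ ρ * a := by gcongr; rw [ha]; linarith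
  have hρa1 : ρ * a < 1 := by nlinarith
  have hge := hF.ge (ρ * a) hρa hρa1
  -- From `1 - ρ ≤ 2 s` follows `1 - ρ a ≤ 3 s`.
  have hcmp : U (1 - ρ * a) ≤ C * 3 ^ M * U s := by
    refine hU.le_of_le_mul (by norm_num) hs (by linarith) (by linarith) (by nlinarith) ?_
    rw [ha]; nlinarith
  have hU1 := hU.pos (1 - ρ * a) (by linarith) (by nlinarith)
  have hTle : T ≤ A * (C * 3 ^ M) * ‖F ((ρ * a : ℝ) : ℂ)‖ := by
    calc T ≤ C * 3 ^ M * (1 / U (1 - ρ * a)) := by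
          rw [hT, div_le_iff₀ hUs, mul_one_div, div_mul_eq_mul_div, le_div_iff₀ hU1]
          linarith
      _ ≤ C * 3 ^ M * (A * ‖F ((ρ * a : ℝ) : ℂ)‖) := by gcongr
      _ = _ := by ring
  have hTg : T ≤ A * (C * 3 ^ M) * 2 ^ (M + 1) * ‖g a‖ := by
    rw [hga]
    refine hTle.trans (le_of_eq ?_)
    rw [one_div_pow]
    field_simp
  have hmain : T ≤ 1 / 2 * T + K₀ * (18 * K) * T ^ (1 - p) * Real.circleAverage h 0 1 := by
    calc T ≤ A * (C * 3 ^ M) * 2 ^ (M + 1) * (c₁ + c₂ * Real.circleAverage h 0 1) := by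
          refine hTg.trans ?_
          gcongr
      _ = _ := by rw [hc₁, hc₂, hK₀]; field_simp
  have hTT : T ^ p * T ^ (1 - p) = T := by rw [← Real.rpow_add hT0]; simp
  have hTp : 0 < T ^ (1 - p) := by positivity
  refine le_of_mul_le_mul_right ?_ hTp
  rw [hTT]
  calc T ≤ 2 * (K₀ * (18 * K) * T ^ (1 - p) * Real.circleAverage h 0 1) := by linarith
    _ = _ := by ring

end Circle

/-! ### Polar coordinates and unitary invariance -/

section Polar

lemma finrank_Cn (n : ℕ) : Module.finrank ℝ (Cn n) = 2 * n := by
  rw [← Module.finrank_mul_finrank ℝ ℂ (Cn n)]; simp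

lemma coe_smul_Cn {n : ℕ} (r : ℝ) (x : Cn n) : (r : ℂ) • x = r • x := by
  ext i; simp

lemma nontrivial_Cn {n : ℕ} (hn : 1 ≤ n) : Nontrivial (Cn n) := by
  have : Nonempty (Fin n) := ⟨⟨0, hn⟩⟩
  infer_instance

lemma lintegral_polar {n : ℕ} (hn : 1 ≤ n) {f : Cn n → ℝ≥0∞} (hf : Measurable f) :
    ∫⁻ x, f x = ∫⁻ r in Set.Ioi (0 : ℝ), ENNReal.ofReal (r ^ (2 * n - 1)) *
      ∫⁻ ξ : sphere (0 : Cn n) 1, f ((r : ℂ) • (ξ : Cn n))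
        ∂(volume : Measure (Cn n)).toSphere := by
  have := nontrivial_Cn hn
  have hpol := (volume : Measure (Cn n)).measurePreserving_homeomorphUnitSphereProd
  rw [finrank_Cn] at hpol
  calc ∫⁻ x, f x = ∫⁻ x in ({0}ᶜ : Set (Cn n)), f x := by
        rw [restrict_compl_singleton]
    _ = ∫⁻ x : ({(0 : Cn n)}ᶜ : Set (Cn n)), f x ∂(volume.comap Subtype.val) := by
        rw [← lintegral_subtype_comap (measurableSet_singleton _).compl]
    _ = ∫⁻ y : sphere (0 : Cn n) 1 × Set.Ioi (0 : ℝ), f ((y.2 : ℝ) • (y.1 : Cn n))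
          ∂((volume : Measure (Cn n)).toSphere.prod (Measure.volumeIoiPow (2 * n - 1))) := by
        rw [← hpol.lintegral_comp_emb (Homeomorph.measurableEmbedding _)]
        congr 1
        funext x
        congr 1
        have hx : ‖(x : Cn n)‖ ≠ 0 := norm_ne_zero_iff.2 x.2
        simp [smul_smul, hx]
    _ = ∫⁻ r : Set.Ioi (0 : ℝ), ∫⁻ ξ : sphere (0 : Cn n) 1, f ((r : ℝ) • (ξ : Cn n))
          ∂(volume : Measure (Cn n)).toSphere ∂(Measure.volumeIoiPow (2 * n - 1)) := by
        rw [lintegral_prod_symm]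
        exact (hf.comp (by fun_prop)).aemeasurable
    _ = ∫⁻ r : Set.Ioi (0 : ℝ), ENNReal.ofReal ((r : ℝ) ^ (2 * n - 1)) *
          ∫⁻ ξ : sphere (0 : Cn n) 1, f ((r : ℝ) • (ξ : Cn n))
          ∂(volume : Measure (Cn n)).toSphere ∂(Measure.comap Subtype.val volume) := by
        rw [Measure.volumeIoiPow, lintegral_withDensity_eq_lintegral_mul]
        · rfl
        · fun_prop
        · exact Measurable.lintegral_prod_left' (f := fun y : sphere (0 : Cn n) 1 × Set.Ioi (0 : ℝ) =>
            f ((y.2 : ℝ) • (y.1 : Cn n))) (hf.comp (by fun_prop))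
    _ = _ := by
        rw [lintegral_subtype_comap measurableSet_Ioi (fun r : ℝ => ENNReal.ofReal (r ^ (2 * n - 1)) *
          ∫⁻ ξ : sphere (0 : Cn n) 1, f (r • (ξ : Cn n)) ∂(volume : Measure (Cn n)).toSphere)]
        simp only [coe_smul_Cn]

lemma volume_ball_ne_zero (n : ℕ) : volume (ball (0 : Cn n) 1) ≠ 0 :=
  (measure_ball_pos _ _ one_pos).ne'

lemma volume_ball_ne_top (n : ℕ) : volume (ball (0 : Cn n) 1) ≠ ∞ := measure_ball_lt_top.ne

lemma toSphere_eq_smul {n : ℕ} (hn : 1 ≤ n) : (volume : Measure (Cn n)).toSphere =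
    (2 * n * volume (ball (0 : Cn n) 1)) • sphereMeasure n := by
  unfold sphereMeasure
  rw [smul_smul, Measure.toSphere_apply_univ, finrank_Cn]
  push_cast
  rw [ENNReal.mul_inv_cancel, one_smul]
  · have : n ≠ 0 := by omega
    simp [this, volume_ball_ne_zero]
  · exact ENNReal.mul_ne_top (ENNReal.mul_ne_top (by simp) (by simp)) (volume_ball_ne_top n)

lemma isProbabilityMeasure_sphereMeasure {n : ℕ} (hn : 1 ≤ n) :
    IsProbabilityMeasure (sphereMeasure n) := by
  have := nontrivial_Cn hn
  refine ⟨?_⟩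
  unfold sphereMeasure
  rw [Measure.smul_apply, smul_eq_mul, ENNReal.inv_mul_cancel]
  · exact fun h => Measure.toSphere_ne_zero (volume : Measure (Cn n)) (Measure.measure_univ_eq_zero.1 h)
  · exact measure_ne_top _ _

/-- A weight is measurable on `[0,1)` only, so integrals over the whole space are taken with its
extension by zero. -/
lemma measurable_indicator_weight {ω : ℝ → ℝ} (hω : IsRadialWeight ω) :
    Measurable ((Set.Ico (0 : ℝ) 1).indicator ω) := by
  refine measurable_of_restrict_of_restrict_compl (s := Set.Ico (0 : ℝ) 1) measurableSet_Ico ?_ ?_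
  · convert hω.measurable using 1
    funext t
    simp [Set.domRestrict_apply]
  · have : (Set.Ico (0 : ℝ) 1)ᶜ.domRestrict ((Set.Ico (0 : ℝ) 1).indicator ω) = fun _ => 0 := by
      funext t
      simp [Set.domRestrict_apply, Set.indicator_of_notMem t.2]
    rw [this]
    exact measurable_const

lemma lintegral_ballMeasure {n : ℕ} (f : Cn n → ℝ≥0∞) :
    ∫⁻ x, f x ∂(ballMeasure n) =
      (volume (ball (0 : Cn n) 1))⁻¹ * ∫⁻ x in ball (0 : Cn n) 1, f x := by
  unfold ballMeasure ProbabilityTheory.cond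
  rw [lintegral_smul_measure, smul_eq_mul]

/-- Weighted integrals over the ball in polar coordinates. -/
lemma lintegral_weightedMeasure {n : ℕ} (hn : 1 ≤ n) {ω : ℝ → ℝ} (hω : IsRadialWeight ω)
    {f : Cn n → ℝ≥0∞} (hf : Measurable f) :
    ∫⁻ x, f x ∂(weightedMeasure n ω) = 2 * n * ∫⁻ r in Set.Ioo (0 : ℝ) 1,
      ENNReal.ofReal (ω r) * ENNReal.ofReal (r ^ (2 * n - 1)) *
        ∫⁻ ξ, f ((r : ℂ) • (ξ : Cn n)) ∂(sphereMeasure n) := by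
  have hm := measurable_indicator_weight hω
  have hmw : weightedMeasure n ω = (ballMeasure n).withDensity fun z =>
      ENNReal.ofReal ((Set.Ico (0 : ℝ) 1).indicator ω ‖z‖) := by
    unfold weightedMeasure
    refine withDensity_congr_ae ?_
    have : ∀ᵐ z ∂(ballMeasure n), z ∈ ball (0 : Cn n) 1 := by
      unfold ballMeasure ProbabilityTheory.cond
      exact Measure.ae_smul_measure (ae_restrict_mem measurableSet_ball) _
    filter_upwards [this] with z hz
    rw [Set.indicator_of_mem]
    exact ⟨norm_nonneg z, by simpa using hz⟩
  rw [hmw, lintegral_withDensity_eq_lintegral_mul _ (by fun_prop) hf, lintegral_ballMeasure,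
    ← lintegral_indicator measurableSet_ball, lintegral_polar hn]
  swap
  · exact Measurable.indicator (by fun_prop) measurableSet_ball
  have hpt : ∀ r ∈ Set.Ioi (0 : ℝ), ENNReal.ofReal (r ^ (2 * n - 1)) *
      ∫⁻ ξ : sphere (0 : Cn n) 1, (ball (0 : Cn n) 1).indicator
        ((fun z => ENNReal.ofReal ((Set.Ico (0 : ℝ) 1).indicator ω ‖z‖)) * f) ((r : ℂ) • (ξ : Cn n))
        ∂(volume : Measure (Cn n)).toSphere =
      (Set.Ioo (0 : ℝ) 1).indicator (fun r => 2 * n * volume (ball (0 : Cn n) 1) *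
        (ENNReal.ofReal (ω r) * ENNReal.ofReal (r ^ (2 * n - 1)) *
        ∫⁻ ξ, f ((r : ℂ) • (ξ : Cn n)) ∂(sphereMeasure n))) r := by
    intro r hr
    have hr0 : 0 < r := hr
    have hnorm : ∀ ξ : sphere (0 : Cn n) 1, ‖(r : ℂ) • (ξ : Cn n)‖ = r := fun ξ => by
      rw [norm_smul, Complex.norm_real, Real.norm_eq_abs, abs_of_pos hr0]
      simp
    by_cases hr1 : r < 1
    · have hin : r ∈ Set.Ico (0 : ℝ) 1 := ⟨hr0.le, hr1⟩
      rw [Set.indicator_of_mem (show r ∈ Set.Ioo (0 : ℝ) 1 from ⟨hr0, hr1⟩)]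
      have : ∀ ξ : sphere (0 : Cn n) 1, (ball (0 : Cn n) 1).indicator
        ((fun z => ENNReal.ofReal ((Set.Ico (0 : ℝ) 1).indicator ω ‖z‖)) * f) ((r : ℂ) • (ξ : Cn n))
          = ENNReal.ofReal (ω r) * f ((r : ℂ) • (ξ : Cn n)) := fun ξ => by
        rw [Set.indicator_of_mem (by rw [mem_ball_zero_iff, hnorm]; exact hr1), Pi.mul_apply, hnorm,
          Set.indicator_of_mem hin]
      simp only [this]
      rw [lintegral_const_mul' _ _ ENNReal.ofReal_ne_top, toSphere_eq_smul hn, lintegral_smul_measure,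
        smul_eq_mul]
      ring
    · rw [Set.indicator_of_notMem (fun h => hr1 h.2)]
      have : ∀ ξ : sphere (0 : Cn n) 1, (ball (0 : Cn n) 1).indicator
        ((fun z => ENNReal.ofReal ((Set.Ico (0 : ℝ) 1).indicator ω ‖z‖)) * f) ((r : ℂ) • (ξ : Cn n))
          = 0 := fun ξ => by
        rw [Set.indicator_of_notMem (by rw [mem_ball_zero_iff, hnorm]; exact hr1)]
      simp only [this, lintegral_zero, mul_zero]
  rw [setLIntegral_congr_fun measurableSet_Ioi hpt, setLIntegral_indicator measurableSet_Ioo,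
    Set.inter_eq_left.2 Set.Ioo_subset_Ioi_self]
  rw [lintegral_const_mul', ← mul_assoc, ← mul_assoc]
  · congr 1
    rw [mul_comm _ (2 * (n : ℝ≥0∞)), mul_assoc, ENNReal.inv_mul_cancel (volume_ball_ne_zero n)
      (volume_ball_ne_top n), mul_one]
  · exact ENNReal.mul_ne_top (ENNReal.mul_ne_top (by simp) (by simp)) (volume_ball_ne_top n)

lemma isRadialWeight_one : IsRadialWeight fun _ => 1 :=
  ⟨fun _ _ => one_pos, measurable_const, by simp⟩

lemma weightedMeasure_one (n : ℕ) : weightedMeasure n (fun _ => 1) = ballMeasure n := by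
  unfold weightedMeasure
  simp

/-- The surface measure is the law of `x / ‖x‖` under the volume measure of the ball. -/
lemma lintegral_sphereMeasure {n : ℕ} (hn : 1 ≤ n) {f : Cn n → ℝ≥0∞} (hf : Measurable f) :
    ∫⁻ ξ : sphere (0 : Cn n) 1, f ξ ∂(sphereMeasure n) =
      ∫⁻ x, f (((‖x‖⁻¹ : ℝ) : ℂ) • x) ∂(ballMeasure n) := by
  rw [← weightedMeasure_one, lintegral_weightedMeasure hn isRadialWeight_one
    (f := fun x => f (((‖x‖⁻¹ : ℝ) : ℂ) • x)) (hf.comp (by fun_prop))]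
  have hpt : ∀ r ∈ Set.Ioo (0 : ℝ) 1, ENNReal.ofReal 1 * ENNReal.ofReal (r ^ (2 * n - 1)) *
      ∫⁻ ξ : sphere (0 : Cn n) 1, f (((‖(r : ℂ) • (ξ : Cn n)‖⁻¹ : ℝ) : ℂ) • ((r : ℂ) • (ξ : Cn n)))
        ∂(sphereMeasure n) =
      ENNReal.ofReal (r ^ (2 * n - 1)) * ∫⁻ ξ : sphere (0 : Cn n) 1, f ξ ∂(sphereMeasure n) := by
    intro r hr
    rw [ENNReal.ofReal_one, one_mul]
    congr 2
    funext ξ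
    congr 1
    have h1 : ‖(r : ℂ) • (ξ : Cn n)‖ = r := by
      rw [norm_smul, Complex.norm_real, Real.norm_eq_abs, abs_of_pos hr.1]
      simp
    have hr0 : (r : ℂ) ≠ 0 := Complex.ofReal_ne_zero.2 hr.1.ne'
    rw [h1, smul_smul, Complex.ofReal_inv, inv_mul_cancel₀ hr0, one_smul]
  rw [setLIntegral_congr_fun measurableSet_Ioo hpt]
  rw [lintegral_mul_const _ (by fun_prop), ← mul_assoc]
  have : ∫⁻ r in Set.Ioo (0 : ℝ) 1, ENNReal.ofReal (r ^ (2 * n - 1)) =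
      ENNReal.ofReal (1 / (2 * n)) := by
    rw [Measure.restrict_congr_set Ioo_ae_eq_Ioc,
      ← ofReal_integral_eq_lintegral_ofReal (intervalIntegral.intervalIntegrable_pow _).1,
      ← intervalIntegral.integral_of_le zero_le_one]
    · rw [integral_pow]
      congr 1
      have : ((2 * n - 1 : ℕ) : ℝ) + 1 = 2 * n := by
        rw [Nat.cast_sub (by omega)]; push_cast; ring
      rw [this]; simp
    · filter_upwards [ae_restrict_mem measurableSet_Ioc] with y hy
      exact pow_nonneg hy.1.le _
  rw [this]
  have h2 : (2 * (n : ℝ≥0∞)) = ENNReal.ofReal (2 * n) := by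
    rw [ENNReal.ofReal_mul (by norm_num)]; simp
  have hn' : (0 : ℝ) < n := by exact_mod_cast hn
  rw [h2, ← ENNReal.ofReal_mul (by positivity), mul_one_div_cancel (by positivity),
    ENNReal.ofReal_one, one_mul]

lemma measurePreserving_ballMeasure {n : ℕ} (T : Cn n ≃ₗᵢ[ℂ] Cn n) :
    MeasurePreserving T (ballMeasure n) (ballMeasure n) := by
  have hT : Continuous T := T.continuous
  refine ⟨hT.measurable, ?_⟩
  ext s hs
  have h1 : MeasurePreserving T (volume : Measure (Cn n)) volume := by
    let T' : Cn n ≃ₗᵢ[ℝ] Cn n := ⟨T.toLinearEquiv.restrictScalars ℝ, T.norm_map⟩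
    exact LinearIsometryEquiv.measurePreserving T'
  have h2 : T ⁻¹' (ball 0 1) = ball 0 1 := by
    ext x; simp
  rw [Measure.map_apply hT.measurable hs]
  unfold ballMeasure
  rw [ProbabilityTheory.cond_apply measurableSet_ball, ProbabilityTheory.cond_apply measurableSet_ball]
  congr 1
  conv_lhs => rw [← h2, ← Set.preimage_inter]
  exact h1.measure_preimage (measurableSet_ball.inter hs).nullMeasurableSet

lemma measurePreserving_weightedMeasure {n : ℕ} (T : Cn n ≃ₗᵢ[ℂ] Cn n) (ω : ℝ → ℝ) :
    MeasurePreserving T (weightedMeasure n ω) (weightedMeasure n ω) := by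
  have hT := measurePreserving_ballMeasure T
  refine ⟨hT.measurable, ?_⟩
  ext s hs
  rw [Measure.map_apply hT.measurable hs]
  unfold weightedMeasure
  rw [withDensity_apply _ hs, withDensity_apply _ (hT.measurable hs)]
  have := hT.setLIntegral_comp_preimage_emb T.toHomeomorph.measurableEmbedding
    (fun z => ENNReal.ofReal (ω ‖z‖)) s
  simpa using this

/-- Inherited from the volume of the ball, since the radial projection `x ↦ x / ‖x‖` commutes with
unitary maps. -/
lemma lintegral_sphereMeasure_comp {n : ℕ} (hn : 1 ≤ n) (T : Cn n ≃ₗᵢ[ℂ] Cn n)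
    {f : Cn n → ℝ≥0∞} (hf : Measurable f) :
    ∫⁻ ξ : sphere (0 : Cn n) 1, f (T ξ) ∂(sphereMeasure n) =
      ∫⁻ ξ : sphere (0 : Cn n) 1, f ξ ∂(sphereMeasure n) := by
  have hT := measurePreserving_ballMeasure T
  rw [lintegral_sphereMeasure hn hf, lintegral_sphereMeasure hn (f := fun x => f (T x))
    (hf.comp hT.measurable), ← hT.lintegral_comp (f := fun x => f (((‖x‖⁻¹ : ℝ) : ℂ) • x))
    (hf.comp (by fun_prop))]
  simp

end Polar

/-! ### Measures of nonisotropic balls and of tubes -/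

section Caps

/-- Complete `e` to an orthonormal basis and take coordinates. -/
lemma exists_isometry_apply_zero {m : ℕ} {e : Cn (m + 1)} (he : ‖e‖ = 1) :
    ∃ T : Cn (m + 1) ≃ₗᵢ[ℂ] Cn (m + 1), ∀ x, T x 0 = inner ℂ e x := by
  have hon : Orthonormal ℂ ((({0} : Set (Fin (m + 1))).domRestrict fun _ => e)) := by
    refine ⟨fun i => he, fun i j hij => ?_⟩
    exact absurd (Subsingleton.elim i j) hij
  obtain ⟨b, hb⟩ := hon.exists_orthonormalBasis_extension_of_card_eq (by simp)
  refine ⟨b.repr, fun x => ?_⟩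
  rw [b.repr_apply_apply, hb 0 (by simp)]

/-- A product set: one condition on the first coordinate, the same condition on all the others. -/
def box {m : ℕ} (A B : Set ℂ) : Set (Cn (m + 1)) := {x | x 0 ∈ A ∧ ∀ i : Fin m, x i.succ ∈ B}

/-- By uniqueness of Haar measure up to a factor, Euclidean volume is a constant multiple of the
product measure. The value of `c` plays no role, only that it is neither zero nor infinite. -/
lemma volume_box (m : ℕ) : ∃ c : ℝ≥0∞, c ≠ 0 ∧ c ≠ ∞ ∧ ∀ A B : Set ℂ, MeasurableSet A →
    MeasurableSet B → volume (box (m := m) A B) = c * (volume A * volume B ^ m) := by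
  let L : (Fin (m + 1) → ℂ) ≃L[ℝ] Cn (m + 1) :=
    (PiLp.continuousLinearEquiv 2 ℝ (fun _ : Fin (m + 1) => ℂ)).symm
  let μ' : Measure (Cn (m + 1)) := (volume : Measure (Fin (m + 1) → ℂ)).map L
  have hμ' : μ'.IsAddHaarMeasure := L.isAddHaarMeasure_map volume
  refine ⟨Measure.addHaarScalarFactor volume μ', ?_, by simp, fun A B hA hB => ?_⟩
  · simpa using (Measure.addHaarScalarFactor_pos_of_isAddHaarMeasure volume μ').ne'
  · have h1 : (volume : Measure (Cn (m + 1))) = Measure.addHaarScalarFactor volume μ' • μ' :=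
      Measure.isAddLeftInvariant_eq_smul volume μ'
    have hbox : MeasurableSet (box (m := m) A B) := by
      have : box (m := m) A B = (fun x => x 0) ⁻¹' A ∩ ⋂ i : Fin m, (fun x => x i.succ) ⁻¹' B := by
        ext x; simp [box]
      rw [this]
      refine MeasurableSet.inter (hA.preimage (by fun_prop)) (MeasurableSet.iInter fun i =>
        hB.preimage (by fun_prop))
    have h2 : L ⁻¹' (box (m := m) A B) =
        Set.pi Set.univ (Fin.cons A fun _ => B : Fin (m + 1) → Set ℂ) := by
      ext x
      simp only [box, Set.mem_preimage, Set.mem_ofPred_eq, Set.mem_pi, Set.mem_univ, forall_const]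
      rw [Fin.forall_fin_succ]
      rfl
    conv_lhs => rw [h1]
    rw [Measure.smul_apply, Measure.map_apply L.continuous.measurable hbox, h2, volume_pi_pi,
      Fin.prod_univ_succ]
    simp [ENNReal.smul_def]

lemma norm_sq_Cn {m : ℕ} (x : Cn (m + 1)) :
    ‖x‖ ^ 2 = ‖x 0‖ ^ 2 + ∑ i : Fin m, ‖x i.succ‖ ^ 2 := by
  rw [EuclideanSpace.norm_sq_eq, Fin.sum_univ_succ]

/-- A unitary map moves `e` to the first coordinate, and the surface measure is the law of `x / ‖x‖`
on the ball. Estimates on the sphere thus become inclusions between sets in the ball and boxes. -/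
lemma sphereMeasure_preimage {m : ℕ} {A : Set ℂ} (hA : MeasurableSet A) {e : Cn (m + 1)}
    (he : ‖e‖ = 1) :
    sphereMeasure (m + 1) {ξ | inner ℂ e (ξ : Cn (m + 1)) ∈ A} =
      ballMeasure (m + 1) {x | ((‖x‖⁻¹ : ℝ) : ℂ) * x 0 ∈ A} := by
  obtain ⟨T, hT⟩ := exists_isometry_apply_zero he
  have hm : Measurable fun x : Cn (m + 1) => A.indicator (fun _ => (1 : ℝ≥0∞)) (x 0) :=
    (measurable_const.indicator hA).comp (by fun_prop)
  have h1 := lintegral_sphereMeasure_comp (by omega) T hm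
  rw [lintegral_sphereMeasure (by omega) hm] at h1
  simp only [hT] at h1
  have e1 : (fun ξ : sphere (0 : Cn (m + 1)) 1 =>
      A.indicator (fun _ => (1 : ℝ≥0∞)) (inner ℂ e (ξ : Cn (m + 1)))) =
      {ξ : sphere (0 : Cn (m + 1)) 1 | inner ℂ e (ξ : Cn (m + 1)) ∈ A}.indicator fun _ => 1 := rfl
  have e2 : (fun x : Cn (m + 1) => A.indicator (fun _ => (1 : ℝ≥0∞))
      ((((‖x‖⁻¹ : ℝ) : ℂ) • x) 0)) =
      {x : Cn (m + 1) | ((‖x‖⁻¹ : ℝ) : ℂ) * x 0 ∈ A}.indicator fun _ => 1 := rfl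
  rw [e1, e2, lintegral_indicator_const, lintegral_indicator_const, one_mul, one_mul] at h1
  · exact h1
  · exact hA.preimage (by fun_prop)
  · exact hA.preimage (by fun_prop)

lemma ballMeasure_apply_le {n : ℕ} {S S' : Set (Cn n)} (h : ball 0 1 ∩ S ⊆ S') :
    ballMeasure n S ≤ (volume (ball (0 : Cn n) 1))⁻¹ * volume S' := by
  unfold ballMeasure
  rw [ProbabilityTheory.cond_apply measurableSet_ball]
  gcongr

lemma le_ballMeasure_apply {n : ℕ} {S S' : Set (Cn n)} (h : S' ⊆ ball 0 1 ∩ S) :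
    (volume (ball (0 : Cn n) 1))⁻¹ * volume S' ≤ ballMeasure n S := by
  unfold ballMeasure
  rw [ProbabilityTheory.cond_apply measurableSet_ball]
  gcongr

lemma norm_succ_le {m : ℕ} {x : Cn (m + 1)} {s : ℝ} (h : ‖x‖ ^ 2 - ‖x 0‖ ^ 2 ≤ 2 * s)
    (i : Fin m) : ‖x i.succ‖ ≤ √(2 * s) := by
  apply Real.le_sqrt_of_sq_le
  have h1 := norm_sq_Cn x
  have h2 : ‖x i.succ‖ ^ 2 ≤ ∑ i : Fin m, ‖x i.succ‖ ^ 2 :=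
    Finset.single_le_sum (f := fun i : Fin m => ‖x i.succ‖ ^ 2) (fun i _ => by positivity)
      (Finset.mem_univ i)
  linarith

lemma volume_closedBall_sqrt {s : ℝ} (hs : 0 ≤ s) :
    volume (closedBall (0 : ℂ) (√s)) = ENNReal.ofReal (s * Real.pi) := by
  rw [Complex.volume_closedBall, ← ENNReal.ofReal_pow (Real.sqrt_nonneg _), Real.sq_sqrt hs,
    ENNReal.ofReal_mul hs, ← NNReal.coe_real_pi, ENNReal.ofReal_coe_nnreal]

lemma volume_strip (s : ℝ) :
    volume {z : ℂ | |z.re| ≤ 1 ∧ |z.im| ≤ s} = ENNReal.ofReal (4 * s) := by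
  have h : {z : ℂ | |z.re| ≤ 1 ∧ |z.im| ≤ s} =
      Complex.measurableEquivRealProd ⁻¹' (Set.Icc (-1) 1 ×ˢ Set.Icc (-s) s) := by
    ext z; simp [abs_le]; tauto
  rw [h, Complex.volume_preserving_equiv_real_prod.measure_preimage
    (measurableSet_Icc.prod measurableSet_Icc).nullMeasurableSet, Measure.volume_eq_prod,
    Measure.prod_prod, Real.volume_Icc, Real.volume_Icc, ← ENNReal.ofReal_mul (by norm_num)]
  congr 1; ring

/-- Nonisotropic balls on the sphere. -/
lemma sphereMeasure_nonisotropic_le {n : ℕ} (hn : 1 ≤ n) :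
    ∃ C : ℝ≥0, ∀ e : Cn n, ‖e‖ = 1 → ∀ s : ℝ, 0 < s →
      sphereMeasure n {ξ | ‖1 - inner ℂ e (ξ : Cn n)‖ ≤ s} ≤ C * ENNReal.ofReal (s ^ n) := by
  obtain ⟨m, rfl⟩ : ∃ m, n = m + 1 := ⟨n - 1, by omega⟩
  obtain ⟨c, hc0, hc1, hc⟩ := volume_box m
  set b := (volume (ball (0 : Cn (m + 1)) 1))⁻¹ with hb
  have hbt : b ≠ ∞ := ENNReal.inv_ne_top.2 (volume_ball_ne_zero _)
  have hfin : b * c * ENNReal.ofReal (4 * (2 * Real.pi) ^ m) ≠ ∞ :=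
    ENNReal.mul_ne_top (ENNReal.mul_ne_top hbt hc1) ENNReal.ofReal_ne_top
  refine ⟨(b * c * ENNReal.ofReal (4 * (2 * Real.pi) ^ m)).toNNReal, fun e he s hs => ?_⟩
  rw [ENNReal.coe_toNNReal hfin]
  have hA : MeasurableSet {w : ℂ | ‖1 - w‖ ≤ s} :=
    measurableSet_le (by fun_prop) measurable_const
  have h1 := sphereMeasure_preimage hA he
  simp only [Set.mem_ofPred_eq] at h1
  rw [h1]
  -- Multiplying by `‖x‖ < 1` turns the condition into `|‖x‖ - x₀| ≤ s`. This confines `x₀` to a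
  -- strip of width of order `s`, and `‖x‖² - (Re x₀)² ≤ 2 s` confines each other coordinate to a
  -- disc of area of order `s`; the volumes multiply to `s ^ n`.
  have hsub : ball 0 1 ∩ {x : Cn (m + 1) | ‖1 - ((‖x‖⁻¹ : ℝ) : ℂ) * x 0‖ ≤ s} ⊆
      box {z : ℂ | |z.re| ≤ 1 ∧ |z.im| ≤ s} (closedBall 0 (√(2 * s))) := by
    rintro x ⟨hx1, hx⟩
    have hx1' : ‖x‖ < 1 := by simpa using hx1
    have hn0 := norm_nonneg x
    have hx0 : ‖x 0‖ ≤ ‖x‖ := PiLp.norm_apply_le x 0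
    have hre := Complex.abs_re_le_norm (x 0)
    have him := Complex.abs_im_le_norm (x 0)
    have key : ‖((‖x‖ : ℝ) : ℂ) - x 0‖ ≤ s := by
      rcases hn0.eq_or_lt with h | h
      · have : x 0 = 0 := by
          have : ‖x 0‖ ≤ 0 := by rw [h]; exact hx0
          simpa using this
        rw [this, ← h]; simpa using hs.le
      · have e1 : ((‖x‖ : ℝ) : ℂ) - x 0 = ((‖x‖ : ℝ) : ℂ) * (1 - ((‖x‖⁻¹ : ℝ) : ℂ) * x 0) := by
          have : ((‖x‖ : ℝ) : ℂ) ≠ 0 := Complex.ofReal_ne_zero.2 h.ne'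
          push_cast; field_simp
        rw [e1, norm_mul, Complex.norm_real, Real.norm_eq_abs, abs_of_pos h]
        calc ‖x‖ * ‖1 - ((‖x‖⁻¹ : ℝ) : ℂ) * x 0‖ ≤ 1 * s := by
              gcongr
              exact hx
          _ = s := one_mul s
    have k1 := (Complex.abs_re_le_norm _).trans key
    have k2 := (Complex.abs_im_le_norm _).trans key
    simp only [Complex.sub_re, Complex.ofReal_re, Complex.sub_im, Complex.ofReal_im, zero_sub,
      abs_neg] at k1 k2
    refine ⟨⟨by linarith, k2⟩, fun i => ?_⟩
    rw [mem_closedBall_zero_iff]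
    refine norm_succ_le ?_ i
    have hsq : (x 0).re ^ 2 ≤ ‖x 0‖ ^ 2 := by
      rw [← sq_abs (x 0).re]; gcongr
    have k3 := (abs_le.1 k1).2
    have k4 := (abs_le.1 hre).1
    have k5 := (abs_le.1 hre).2
    calc ‖x‖ ^ 2 - ‖x 0‖ ^ 2 ≤ ‖x‖ ^ 2 - (x 0).re ^ 2 := by linarith
      _ = (‖x‖ - (x 0).re) * (‖x‖ + (x 0).re) := by ring
      _ ≤ s * 2 := mul_le_mul k3 (by linarith) (by linarith) hs.le
      _ = _ := by ring
  refine (ballMeasure_apply_le hsub).trans ?_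
  rw [hc _ _ _ measurableSet_closedBall]
  swap
  · exact (measurableSet_le (continuous_abs.comp Complex.continuous_re).measurable
      measurable_const).inter
      (measurableSet_le (continuous_abs.comp Complex.continuous_im).measurable measurable_const)
  rw [volume_strip, volume_closedBall_sqrt (by positivity), ← ENNReal.ofReal_pow
    (by positivity), ← ENNReal.ofReal_mul (by positivity), mul_assoc (b * c),
    ← ENNReal.ofReal_mul (by positivity), mul_assoc b c]
  apply le_of_eq
  congr 3
  rw [mul_pow, mul_pow, pow_succ]; ring

/-- Neighbourhoods of a complex circle on the sphere, upper estimate. -/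
lemma sphereMeasure_tube_le {n : ℕ} (hn : 1 ≤ n) :
    ∃ C : ℝ≥0, ∀ e : Cn n, ‖e‖ = 1 → ∀ s : ℝ, 0 < s → s ≤ 1 →
      sphereMeasure n {ξ | 1 - s ≤ ‖inner ℂ e (ξ : Cn n)‖} ≤
        C * ENNReal.ofReal (s ^ (n - 1)) := by
  obtain ⟨m, rfl⟩ : ∃ m, n = m + 1 := ⟨n - 1, by omega⟩
  obtain ⟨c, hc0, hc1, hc⟩ := volume_box m
  set b := (volume (ball (0 : Cn (m + 1)) 1))⁻¹ with hb
  have hbt : b ≠ ∞ := ENNReal.inv_ne_top.2 (volume_ball_ne_zero _)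
  have hfin : b * c * ENNReal.ofReal (Real.pi * (2 * Real.pi) ^ m) ≠ ∞ :=
    ENNReal.mul_ne_top (ENNReal.mul_ne_top hbt hc1) ENNReal.ofReal_ne_top
  refine ⟨(b * c * ENNReal.ofReal (Real.pi * (2 * Real.pi) ^ m)).toNNReal,
    fun e he s hs hs1 => ?_⟩
  rw [ENNReal.coe_toNNReal hfin]
  have hA : MeasurableSet {w : ℂ | 1 - s ≤ ‖w‖} :=
    measurableSet_le measurable_const (by fun_prop)
  have h1 := sphereMeasure_preimage hA he
  simp only [Set.mem_ofPred_eq] at h1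
  rw [h1]
  have hsub : ball 0 1 ∩ {x : Cn (m + 1) | 1 - s ≤ ‖((‖x‖⁻¹ : ℝ) : ℂ) * x 0‖} ⊆
      box (closedBall 0 (√1)) (closedBall 0 (√(2 * s))) := by
    rintro x ⟨hx1, hx⟩
    have hx1' : ‖x‖ < 1 := by simpa using hx1
    have hn0 := norm_nonneg x
    have hx0 : ‖x 0‖ ≤ ‖x‖ := PiLp.norm_apply_le x 0
    have key : (1 - s) * ‖x‖ ≤ ‖x 0‖ := by
      rcases hn0.eq_or_lt with h | h
      · rw [← h, mul_zero]; exact norm_nonneg _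
      · have hx' : 1 - s ≤ ‖((‖x‖⁻¹ : ℝ) : ℂ) * x 0‖ := hx
        rw [norm_mul, Complex.norm_real, Real.norm_eq_abs, abs_of_pos (by positivity),
          inv_mul_eq_div, le_div_iff₀ h] at hx'
        exact hx'
    refine ⟨by rw [mem_closedBall_zero_iff, Real.sqrt_one]; linarith, fun i => ?_⟩
    rw [mem_closedBall_zero_iff]
    refine norm_succ_le ?_ i
    have h3 : ((1 - s) * ‖x‖) ^ 2 ≤ ‖x 0‖ ^ 2 :=
      pow_le_pow_left₀ (mul_nonneg (by linarith) hn0) key 2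
    have h4 : ‖x‖ ^ 2 ≤ 1 := pow_le_one₀ hn0 hx1'.le
    nlinarith [sq_nonneg ‖x‖, mul_nonneg (sq_nonneg s) (sq_nonneg ‖x‖)]
  refine (ballMeasure_apply_le hsub).trans ?_
  rw [hc _ _ measurableSet_closedBall measurableSet_closedBall,
    volume_closedBall_sqrt zero_le_one, volume_closedBall_sqrt (by positivity),
    ← ENNReal.ofReal_pow (by positivity), ← ENNReal.ofReal_mul (by positivity),
    mul_assoc (b * c), ← ENNReal.ofReal_mul (by positivity), mul_assoc b c]
  apply le_of_eq
  congr 3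
  rw [mul_pow, mul_pow, Nat.add_sub_cancel, mul_pow]; ring

/-- Neighbourhoods of a complex circle on the sphere, lower estimate. -/
lemma le_sphereMeasure_tube {n : ℕ} (hn : 1 ≤ n) :
    ∃ C : ℝ≥0, ∀ e : Cn n, ‖e‖ = 1 → ∀ s : ℝ, 0 < s → s ≤ 1 →
      ENNReal.ofReal (s ^ (n - 1)) ≤
        C * sphereMeasure n {ξ | 1 - s ≤ ‖inner ℂ e (ξ : Cn n)‖} := by
  obtain ⟨m, rfl⟩ : ∃ m, n = m + 1 := ⟨n - 1, by omega⟩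
  obtain ⟨c, hc0, hc1, hc⟩ := volume_box m
  set b := (volume (ball (0 : Cn (m + 1)) 1))⁻¹ with hb
  have hbt : b ≠ ∞ := ENNReal.inv_ne_top.2 (volume_ball_ne_zero _)
  have hb0 : b ≠ 0 := ENNReal.inv_ne_zero.2 (volume_ball_ne_top _)
  -- In this annulus `|x₀|² ≥ 1 / 16`, so other coordinates of total square at most `s / 16` change
  -- `‖x‖²` by at most `s |x₀|²`; and `1 / 4 + 1 / 16 < 1` keeps the box inside the ball.
  set R : Set ℂ := closedBall (0 : ℂ) (1 / 2) \ ball 0 (1 / 4) with hR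
  have hRm : MeasurableSet R := measurableSet_closedBall.diff measurableSet_ball
  have hR0 : volume R ≠ 0 := by
    have hsub : ball (3 / 8 : ℂ) (1 / 8) ⊆ R := by
      intro z hz
      rw [mem_ball, dist_eq_norm] at hz
      have h3 : ‖(3 / 8 : ℂ)‖ = 3 / 8 := by
        rw [show (3 / 8 : ℂ) = ((3 / 8 : ℝ) : ℂ) by push_cast; rfl, Complex.norm_real]
        norm_num
      have h4 : ‖z‖ ≤ ‖z - 3 / 8‖ + ‖(3 / 8 : ℂ)‖ := by
        simpa using norm_add_le (z - 3 / 8) (3 / 8 : ℂ)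
      have h5 : ‖(3 / 8 : ℂ)‖ ≤ ‖z‖ + ‖z - 3 / 8‖ := by
        have := norm_sub_le z (z - 3 / 8)
        simpa using this
      refine ⟨by rw [mem_closedBall_zero_iff]; linarith, ?_⟩
      rw [mem_ball_zero_iff]; linarith
    exact fun h => (measure_ball_pos volume (3 / 8 : ℂ) (by norm_num : (0 : ℝ) < 1 / 8)).ne'
      (measure_mono_null hsub h)
  have hRt : volume R ≠ ∞ :=
    ((measure_mono Set.sdiff_subset).trans_lt measure_closedBall_lt_top).ne
  set κ : ℝ := Real.pi / (16 * (m + 1)) with hκ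
  have hκ0 : 0 < κ := by positivity
  set D := b * c * volume R * ENNReal.ofReal (κ ^ m) with hD
  have hD0 : D ≠ 0 := by
    refine mul_ne_zero (mul_ne_zero (mul_ne_zero hb0 hc0) hR0) ?_
    simpa using pow_pos hκ0 m
  have hDt : D ≠ ∞ :=
    ENNReal.mul_ne_top (ENNReal.mul_ne_top (ENNReal.mul_ne_top hbt hc1) hRt) ENNReal.ofReal_ne_top
  refine ⟨D⁻¹.toNNReal, fun e he s hs hs1 => ?_⟩
  rw [ENNReal.coe_toNNReal (ENNReal.inv_ne_top.2 hD0)]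
  have hA : MeasurableSet {w : ℂ | 1 - s ≤ ‖w‖} :=
    measurableSet_le measurable_const (by fun_prop)
  have h1 := sphereMeasure_preimage hA he
  simp only [Set.mem_ofPred_eq] at h1
  rw [h1]
  have hsub : box R (closedBall 0 (√(s / (16 * (m + 1))))) ⊆
      ball 0 1 ∩ {x : Cn (m + 1) | 1 - s ≤ ‖((‖x‖⁻¹ : ℝ) : ℂ) * x 0‖} := by
    rintro x ⟨⟨hx1, hx2⟩, hx3⟩
    rw [mem_closedBall_zero_iff] at hx1
    rw [mem_ball_zero_iff, not_lt] at hx2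
    have hx4 : ∑ i : Fin m, ‖x i.succ‖ ^ 2 ≤ s / 16 := by
      calc ∑ i : Fin m, ‖x i.succ‖ ^ 2 ≤ ∑ _i : Fin m, s / (16 * (m + 1)) := by
            refine Finset.sum_le_sum fun i _ => ?_
            have := hx3 i
            rw [mem_closedBall_zero_iff] at this
            calc ‖x i.succ‖ ^ 2 ≤ √(s / (16 * (m + 1))) ^ 2 := by gcongr
              _ = _ := Real.sq_sqrt (by positivity)
        _ = m * (s / (16 * (m + 1))) := by simp
        _ ≤ (m + 1) * (s / (16 * (m + 1))) := by gcongr; linarith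
        _ = _ := by field_simp
    have hsq := norm_sq_Cn x
    have hx0 : ‖x 0‖ ^ 2 ≤ 1 / 4 := by
      calc ‖x 0‖ ^ 2 ≤ (1 / 2) ^ 2 := by gcongr
        _ = _ := by norm_num
    have hx0' : 1 / 16 ≤ ‖x 0‖ ^ 2 := by
      calc (1 : ℝ) / 16 = (1 / 4) ^ 2 := by norm_num
        _ ≤ _ := by gcongr
    have hxpos : 0 < ‖x‖ := by
      have : ‖x 0‖ ≤ ‖x‖ := PiLp.norm_apply_le x 0
      linarith
    refine ⟨?_, ?_⟩
    · rw [mem_ball_zero_iff]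
      by_contra h
      have : 1 ≤ ‖x‖ ^ 2 := one_le_pow₀ (not_lt.1 h)
      linarith
    · change 1 - s ≤ ‖((‖x‖⁻¹ : ℝ) : ℂ) * x 0‖
      rw [norm_mul, Complex.norm_real, Real.norm_eq_abs, abs_of_pos (by positivity),
        inv_mul_eq_div, le_div_iff₀ hxpos]
      have h5 : ((1 - s) * ‖x‖) ^ 2 ≤ ‖x 0‖ ^ 2 := by
        have h6 : (1 - s) ^ 2 ≤ 1 - s := by nlinarith
        have h7 : (1 - s) * ‖x‖ ^ 2 ≤ ‖x 0‖ ^ 2 := by nlinarith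
        calc ((1 - s) * ‖x‖) ^ 2 = (1 - s) ^ 2 * ‖x‖ ^ 2 := by ring
          _ ≤ (1 - s) * ‖x‖ ^ 2 := by gcongr
          _ ≤ _ := h7
      exact (abs_le_of_sq_le_sq' h5 (norm_nonneg _)).2
  have h2 := le_ballMeasure_apply hsub
  rw [hc _ _ hRm measurableSet_closedBall, volume_closedBall_sqrt (by positivity),
    ← ENNReal.ofReal_pow (by positivity)] at h2
  have h3 : b * (c * (volume R * ENNReal.ofReal ((s / (16 * (m + 1)) * Real.pi) ^ m))) =
      D * ENNReal.ofReal (s ^ (m + 1 - 1)) := by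
    have : (s / (16 * ((m : ℝ) + 1)) * Real.pi) ^ m = κ ^ m * s ^ m := by
      rw [← mul_pow]; congr 1; rw [hκ]; ring
    rw [this, ENNReal.ofReal_mul (by positivity), hD, Nat.add_sub_cancel]
    ring
  rw [h3] at h2
  calc ENNReal.ofReal (s ^ (m + 1 - 1)) = D⁻¹ * (D * ENNReal.ofReal (s ^ (m + 1 - 1))) := by
        rw [← mul_assoc, ENNReal.inv_mul_cancel hD0 hDt, one_mul]
    _ ≤ _ := by gcongr

end Caps

/-! ### Means over the sphere -/

section SphereMeans

variable {U : ℝ → ℝ} {C : ℝ} {M : ℕ} {F : ℂ → ℂ} {A : ℝ}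

/-- The density, in the variable `s = 1 - t`, of the growth of the means. -/
def meanDensity (n : ℕ) (U : ℝ → ℝ) (p s : ℝ) : ℝ := s ^ (n - 1) * (1 / U s) ^ p

lemma measurable_meanDensity (n : ℕ) (hUm : Measurable U) (p : ℝ) :
    Measurable (meanDensity n U p) := by
  unfold meanDensity
  fun_prop

lemma norm_inner_le_one {n : ℕ} {e : Cn n} (he : ‖e‖ = 1) (ξ : sphere (0 : Cn n) 1) :
    ‖inner ℂ e (ξ : Cn n)‖ ≤ 1 := by
  have := norm_inner_le_norm (𝕜 := ℂ) e (ξ : Cn n)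
  have hξ : ‖(ξ : Cn n)‖ = 1 := by simp
  rwa [he, hξ, one_mul] at this

lemma norm_real_mul {ρ : ℝ} (hρ : 0 ≤ ρ) (w : ℂ) : ‖(ρ : ℂ) * w‖ = ρ * ‖w‖ := by
  rw [norm_mul, Complex.norm_real, Real.norm_eq_abs, abs_of_nonneg hρ]

lemma one_sub_le_norm {ρ : ℝ} (hρ : 0 ≤ ρ) {w : ℂ} (hw : ‖w‖ ≤ 1) :
    1 - ρ ≤ ‖1 - (ρ : ℂ) * w‖ := by
  have := norm_sub_norm_le (1 : ℂ) ((ρ : ℂ) * w)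
  rw [norm_one, norm_real_mul hρ] at this
  nlinarith

/-- Replacing `w` by `ρ w` moves the point by at most `1 - ρ`, which is itself at most the distance
from `1` to `ρ w`. -/
lemma norm_one_sub_le {ρ : ℝ} (hρ : 0 ≤ ρ) (hρ1 : ρ ≤ 1) {w : ℂ} (hw : ‖w‖ ≤ 1) :
    ‖1 - w‖ ≤ 2 * ‖1 - (ρ : ℂ) * w‖ := by
  have h1 := one_sub_le_norm hρ hw
  have h2 : ‖((1 - ρ : ℝ) : ℂ) * w‖ ≤ 1 - ρ := by
    rw [norm_real_mul (by linarith)]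
    exact mul_le_of_le_one_right (by linarith) hw
  have h3 : (1 : ℂ) - w = (1 - ρ * w) - ((1 - ρ : ℝ) : ℂ) * w := by push_cast; ring
  rw [h3]
  refine (norm_sub_le _ _).trans ?_
  linarith

/-- A value at one point is controlled by an average over larger scales. -/
lemma rpow_le_lintegral_scales (hU : TailFn U C M) {p : ℝ} (hp : 0 < p) :
    ∃ K : ℝ≥0, ∀ a d : ℝ, 0 < a → a < 3 / 4 → a ≤ d → d ≤ 2 →
      ENNReal.ofReal ((1 / U (min d 1)) ^ p) ≤ K * ∫⁻ s in Set.Ioc a 1,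
        {s : ℝ | d ≤ 4 * s}.indicator (fun s => ENNReal.ofReal (s⁻¹ * (1 / U s) ^ p)) s := by
  have hC := hU.one_le
  set L := C * (4 / 3) ^ M with hL
  have hL0 : 0 < L := by positivity
  refine ⟨(4 * L ^ p).toNNReal, fun a d ha0 ha1 had hd2 => ?_⟩
  -- The window `(d', 4 d' / 3]` lies in `(a, 1]` and has mass at least `1 / 4` for `ds / s`. The
  -- cap `3 / 4` leaves room below `1`, and `d ≤ 2` still gives `d ≤ 4 s` on the window.
  set d' := min d (3 / 4) with hd'
  have hd'0 : 0 < d' := lt_min (by linarith) (by norm_num)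
  have hd'1 : d' ≤ 3 / 4 := min_le_right _ _
  have hd'd : d' ≤ min d 1 := le_min (min_le_left _ _) (by linarith)
  have hmin0 : 0 < min d 1 := hd'0.trans_le hd'd
  have hUm := hU.pos _ hmin0 (min_le_right _ _)
  have hsub : Set.Ioc d' (4 / 3 * d') ⊆ Set.Ioc a 1 := by
    intro s hs
    exact ⟨(le_min had ha1.le).trans_lt hs.1, by linarith [hs.2]⟩
  have hpt : ∀ s ∈ Set.Ioc d' (4 / 3 * d'),
      ENNReal.ofReal (3 / (4 * d') * ((1 / U (min d 1)) ^ p / L ^ p)) ≤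
      {s : ℝ | d ≤ 4 * s}.indicator (fun s => ENNReal.ofReal (s⁻¹ * (1 / U s) ^ p)) s := by
    intro s hs
    have hs0 : 0 < s := hd'0.trans hs.1
    have hs1 : s ≤ 1 := by linarith [hs.2]
    have hUs := hU.pos s hs0 hs1
    have hmem : s ∈ {s : ℝ | d ≤ 4 * s} := by
      change d ≤ 4 * s
      rcases le_total d (3 / 4) with h | h
      · rw [hd', min_eq_left h] at hs; linarith [hs.1]
      · rw [hd', min_eq_right h] at hs; linarith [hs.1]
    rw [Set.indicator_of_mem hmem]
    apply ENNReal.ofReal_le_ofReal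
    have h1 : U s ≤ L * U (min d 1) := hU.le_of_le_mul (by norm_num) hmin0 (min_le_right _ _) hs0 hs1
      (by linarith [hs.2])
    have h2 : (1 / U (min d 1)) ^ p / L ^ p ≤ (1 / U s) ^ p := by
      rw [← Real.div_rpow (by positivity) (by positivity)]
      apply Real.rpow_le_rpow (by positivity) _ hp.le
      rw [div_div, mul_comm]
      exact one_div_le_one_div_of_le hUs h1
    have h3 : 3 / (4 * d') ≤ s⁻¹ := by
      rw [← one_div, div_le_div_iff₀ (by positivity) hs0]
      linarith [hs.2]
    gcongr
  calc ENNReal.ofReal ((1 / U (min d 1)) ^ p)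
      = ENNReal.ofReal (4 * L ^ p) *
        (ENNReal.ofReal (3 / (4 * d') * ((1 / U (min d 1)) ^ p / L ^ p)) *
          ENNReal.ofReal (4 / 3 * d' - d')) := by
        rw [← ENNReal.ofReal_mul (by positivity), ← ENNReal.ofReal_mul (by positivity)]
        congr 1
        have : L ^ p ≠ 0 := by positivity
        field_simp
        ring
    _ = (4 * L ^ p).toNNReal * ∫⁻ s in Set.Ioc d' (4 / 3 * d'),
        ENNReal.ofReal (3 / (4 * d') * ((1 / U (min d 1)) ^ p / L ^ p)) := by
        rw [setLIntegral_const, Real.volume_Ioc]; rfl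
    _ ≤ _ := by
        refine mul_le_mul' le_rfl ?_
        exact (setLIntegral_mono' measurableSet_Ioc hpt).trans
          (lintegral_mono_set hsub)

/-- Layer-cake argument: the pointwise bound is spread over scales `s` with respect to `ds / s`,
Tonelli is applied, and the set where `|1 - ρ⟨ξ, e⟩| ≤ 4 s` lies in a nonisotropic ball of measure
at most a multiple of `s ^ n`. The quotient by `s` is the power `n - 1` in `meanDensity`. -/
lemma SizeLike.lintegral_sphere_le {n : ℕ} (hn : 1 ≤ n) (hU : TailFn U C M) (hUm : Measurable U)
    (hF : SizeLike U F A) {p : ℝ} (hp : 0 < p) :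
    ∃ K : ℝ≥0, ∀ (e : Cn n) (ρ : ℝ), ‖e‖ = 1 → 1 / 4 < ρ → ρ < 1 →
      ∫⁻ ξ : sphere (0 : Cn n) 1, ‖F (ρ * inner ℂ e (ξ : Cn n))‖ₑ ^ p ∂(sphereMeasure n) ≤
        K * ∫⁻ s in Set.Ioc (1 - ρ) 1, ENNReal.ofReal (meanDensity n U p s) := by
  have hA := hF.pos hU
  obtain ⟨K₁, hK₁⟩ := rpow_le_lintegral_scales hU hp
  obtain ⟨K₂, hK₂⟩ := sphereMeasure_nonisotropic_le hn
  have := isProbabilityMeasure_sphereMeasure hn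
  refine ⟨(A ^ p).toNNReal * K₁ * (K₂ * 8 ^ n), fun e ρ he hρ0 hρ1 => ?_⟩
  have hmS : MeasurableSet {q : sphere (0 : Cn n) 1 × ℝ |
      ‖1 - (ρ : ℂ) * inner ℂ e (q.1 : Cn n)‖ ≤ 4 * q.2} :=
    measurableSet_le (by fun_prop) (by fun_prop)
  have hjm : Measurable fun q : sphere (0 : Cn n) 1 × ℝ =>
      {s : ℝ | ‖1 - (ρ : ℂ) * inner ℂ e (q.1 : Cn n)‖ ≤ 4 * s}.indicator
        (fun s => ENNReal.ofReal (s⁻¹ * (1 / U s) ^ p)) q.2 := by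
    have : (fun q : sphere (0 : Cn n) 1 × ℝ =>
      {s : ℝ | ‖1 - (ρ : ℂ) * inner ℂ e (q.1 : Cn n)‖ ≤ 4 * s}.indicator
        (fun s => ENNReal.ofReal (s⁻¹ * (1 / U s) ^ p)) q.2) =
      {q : sphere (0 : Cn n) 1 × ℝ | ‖1 - (ρ : ℂ) * inner ℂ e (q.1 : Cn n)‖ ≤ 4 * q.2}.indicator
        (fun q => ENNReal.ofReal (q.2⁻¹ * (1 / U q.2) ^ p)) := rfl
    rw [this]
    exact Measurable.indicator (by fun_prop) hmS
  calc ∫⁻ ξ : sphere (0 : Cn n) 1, ‖F (ρ * inner ℂ e (ξ : Cn n))‖ₑ ^ p ∂(sphereMeasure n)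
      ≤ ∫⁻ ξ : sphere (0 : Cn n) 1, ((A ^ p).toNNReal * K₁ : ℝ≥0) * (∫⁻ s in Set.Ioc (1 - ρ) 1,
          {s : ℝ | ‖1 - (ρ : ℂ) * inner ℂ e (ξ : Cn n)‖ ≤ 4 * s}.indicator
          (fun s => ENNReal.ofReal (s⁻¹ * (1 / U s) ^ p)) s) ∂(sphereMeasure n) := by
        refine lintegral_mono fun ξ => ?_
        have hw := norm_inner_le_one he ξ
        set w := inner ℂ e (ξ : Cn n) with hwdef
        have h1 := one_sub_le_norm (ρ := ρ) (by linarith) hw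
        have h2 : ‖(ρ : ℂ) * w‖ < 1 := by
          rw [norm_real_mul (by linarith)]; nlinarith
        have h3 : ‖1 - (ρ : ℂ) * w‖ ≤ 2 := by
          refine (norm_sub_le _ _).trans ?_
          rw [norm_one]; linarith
        have h4 := hF.le _ h2
        have h5 : 0 < U (min ‖1 - (ρ : ℂ) * w‖ 1) :=
          hU.pos _ (lt_min (by linarith) one_pos) (min_le_right _ _)
        have h6 : ‖F (ρ * w)‖ ^ p ≤ A ^ p * (1 / U (min ‖1 - (ρ : ℂ) * w‖ 1)) ^ p := by
          rw [← Real.mul_rpow hA.le (by positivity), mul_one_div]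
          exact Real.rpow_le_rpow (norm_nonneg _) h4 hp.le
        calc ‖F (ρ * w)‖ₑ ^ p = ENNReal.ofReal (‖F (ρ * w)‖ ^ p) := by
              rw [← ofReal_norm, ENNReal.ofReal_rpow_of_nonneg (norm_nonneg _) hp.le]
          _ ≤ ENNReal.ofReal (A ^ p) *
              ENNReal.ofReal ((1 / U (min ‖1 - (ρ : ℂ) * w‖ 1)) ^ p) := by
              rw [← ENNReal.ofReal_mul (by positivity)]
              exact ENNReal.ofReal_le_ofReal h6
          _ ≤ ENNReal.ofReal (A ^ p) * (K₁ * ∫⁻ s in Set.Ioc (1 - ρ) 1,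
              {s : ℝ | ‖1 - (ρ : ℂ) * w‖ ≤ 4 * s}.indicator
              (fun s => ENNReal.ofReal (s⁻¹ * (1 / U s) ^ p)) s) := by
              gcongr
              exact hK₁ _ _ (by linarith) (by linarith) h1 h3
          _ = _ := by
              rw [← mul_assoc]; congr 1
    _ = ((A ^ p).toNNReal * K₁ : ℝ≥0) * ∫⁻ s in Set.Ioc (1 - ρ) 1,
          ∫⁻ ξ : sphere (0 : Cn n) 1, {s : ℝ | ‖1 - (ρ : ℂ) * inner ℂ e (ξ : Cn n)‖ ≤ 4 * s}.indicator
          (fun s => ENNReal.ofReal (s⁻¹ * (1 / U s) ^ p)) s ∂(sphereMeasure n) := by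
        rw [lintegral_const_mul' _ _ ENNReal.coe_ne_top, lintegral_lintegral_swap]
        exact hjm.aemeasurable
    _ ≤ ((A ^ p).toNNReal * K₁ : ℝ≥0) * ∫⁻ s in Set.Ioc (1 - ρ) 1,
          (K₂ * 8 ^ n : ℝ≥0) * ENNReal.ofReal (meanDensity n U p s) := by
        refine mul_le_mul' le_rfl ?_
        refine setLIntegral_mono' measurableSet_Ioc fun s hs => ?_
        have hs0 : 0 < s := by linarith [hs.1]
        have hUs := hU.pos s hs0 hs.2
        have e1 : (fun ξ : sphere (0 : Cn n) 1 =>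
            {s : ℝ | ‖1 - (ρ : ℂ) * inner ℂ e (ξ : Cn n)‖ ≤ 4 * s}.indicator
            (fun s => ENNReal.ofReal (s⁻¹ * (1 / U s) ^ p)) s) =
            {ξ : sphere (0 : Cn n) 1 | ‖1 - (ρ : ℂ) * inner ℂ e (ξ : Cn n)‖ ≤ 4 * s}.indicator
            (fun _ => ENNReal.ofReal (s⁻¹ * (1 / U s) ^ p)) := rfl
        rw [e1, lintegral_indicator_const]
        swap
        · exact measurableSet_le (by fun_prop) measurable_const
        have h1 : sphereMeasure n {ξ | ‖1 - (ρ : ℂ) * inner ℂ e (ξ : Cn n)‖ ≤ 4 * s} ≤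
            K₂ * ENNReal.ofReal ((8 * s) ^ n) := by
          refine (measure_mono ?_).trans (hK₂ e he (8 * s) (by positivity))
          intro ξ hξ
          have h2 := norm_one_sub_le (ρ := ρ) (by linarith) hρ1.le (norm_inner_le_one he ξ)
          have h3 : ‖1 - (ρ : ℂ) * inner ℂ e (ξ : Cn n)‖ ≤ 4 * s := hξ
          change ‖1 - inner ℂ e (ξ : Cn n)‖ ≤ 8 * s
          linarith
        calc ENNReal.ofReal (s⁻¹ * (1 / U s) ^ p) *
            sphereMeasure n {ξ | ‖1 - (ρ : ℂ) * inner ℂ e (ξ : Cn n)‖ ≤ 4 * s}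
            ≤ ENNReal.ofReal (s⁻¹ * (1 / U s) ^ p) * (K₂ * ENNReal.ofReal ((8 * s) ^ n)) := by
              gcongr
          _ = K₂ * ENNReal.ofReal (8 ^ n * meanDensity n U p s) := by
              rw [mul_left_comm, ← ENNReal.ofReal_mul (by positivity)]
              congr 2
              unfold meanDensity
              obtain ⟨m, rfl⟩ : ∃ m, n = m + 1 := ⟨n - 1, by omega⟩
              rw [mul_pow, Nat.add_sub_cancel, pow_succ s]
              field_simp
          _ = _ := by
              rw [ENNReal.ofReal_mul (by positivity), ← mul_assoc]
              congr 1
              rw [ENNReal.ofReal_pow (by norm_num)]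
              push_cast
              congr 2
              norm_num
    _ = _ := by
        rw [lintegral_const_mul' _ _ ENNReal.coe_ne_top, ← mul_assoc]
        push_cast
        rfl

/-- The weight of the Poisson type kernels at scale `s`. -/
def scaleWeight (s : ℝ) (w : ℂ) : ℝ := ‖1 - w‖ * s / (s + ‖1 - w‖) ^ 3

/-- The weight is at most `d / (s + d)²`, whose primitive is `-d / (s + d)`. Without the factor `d =
|1 - w|` left by the damping the integral would not be bounded uniformly in `w`. -/
lemma lintegral_scaleWeight_le (w : ℂ) :
    ∫⁻ s in Set.Ioc (0 : ℝ) 1, ENNReal.ofReal (scaleWeight s w) ≤ 1 := by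
  set d := ‖1 - w‖ with hd
  rcases (norm_nonneg (1 - w)).eq_or_lt with h | h
  · have : ∀ s, scaleWeight s w = 0 := fun s => by unfold scaleWeight; rw [← h]; simp
    simp [this]
  · rw [← hd] at h
    have hc : ContinuousOn (fun s : ℝ => d / (s + d) ^ 2) (Set.uIcc 0 1) := by
      refine ContinuousOn.div (by fun_prop) (by fun_prop) fun s hs => ?_
      rw [Set.uIcc_of_le zero_le_one] at hs
      have : 0 < s + d := by linarith [hs.1]
      positivity
    calc ∫⁻ s in Set.Ioc (0 : ℝ) 1, ENNReal.ofReal (scaleWeight s w)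
        ≤ ∫⁻ s in Set.Ioc (0 : ℝ) 1, ENNReal.ofReal (d / (s + d) ^ 2) := by
          refine setLIntegral_mono' measurableSet_Ioc fun s hs => ENNReal.ofReal_le_ofReal ?_
          have hs0 : 0 < s := hs.1
          unfold scaleWeight
          rw [div_le_div_iff₀ (by positivity) (by positivity)]
          have : 0 ≤ d * (s + d) ^ 2 * d := by positivity
          nlinarith
      _ = ENNReal.ofReal (∫ s in (0 : ℝ)..1, d / (s + d) ^ 2) := by
          rw [intervalIntegral.integral_of_le zero_le_one, ofReal_integral_eq_lintegral_ofReal]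
          · exact hc.intervalIntegrable.1
          · filter_upwards [ae_restrict_mem measurableSet_Ioc] with s hs
            have hs0 : 0 < s := hs.1
            change 0 ≤ d / (s + d) ^ 2
            positivity
      _ ≤ 1 := by
          rw [ENNReal.ofReal_le_one]
          rw [intervalIntegral.integral_eq_sub_of_hasDerivAt (f := fun s => -d / (s + d))]
          · have : 0 ≤ d / (1 + d) := by positivity
            have h2 : d / (0 + d) = 1 := by rw [zero_add, div_self h.ne']
            rw [neg_div, neg_div, h2]
            linarith
          · intro s hs
            rw [Set.uIcc_of_le zero_le_one] at hs
            have hsd : s + d ≠ 0 := by have := hs.1; positivity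
            have := ((hasDerivAt_id s).add_const d).fun_inv hsd
            have h9 : HasDerivAt (fun s => -d / (s + d)) (-d * (-1 / (id s + d) ^ 2)) s :=
              this.const_mul (-d)
            refine h9.congr_deriv ?_
            simp only [id_eq]
            ring
          · exact hc.intervalIntegrable

/-- The lower bound for means on a circle, as a statement about a rotated point. -/
lemma SizeLike.rpow_le_lintegral_rotations (hU : TailFn U C M) (hF : SizeLike U F A) {p : ℝ}
    (hp : 0 < p) :
    ∃ K : ℝ≥0, ∀ (ρ s : ℝ) (w : ℂ), 1 / 4 < ρ → ρ < 1 → 0 < s → s ≤ 7 / 8 → 1 - ρ ≤ s →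
      ‖w‖ ≤ 1 → 1 - s ≤ ‖w‖ →
      ENNReal.ofReal ((1 / U s) ^ p) ≤ K * ∫⁻ θ in Set.Ioc (0 : ℝ) (2 * Real.pi),
        ‖F (ρ * (Complex.exp (θ * Complex.I) * w))‖ₑ ^ p *
          ENNReal.ofReal (scaleWeight s (Complex.exp (θ * Complex.I) * w)) := by
  obtain ⟨K, hK, hKF⟩ := hF.le_circleAverage hU hp
  refine ⟨(K * ((2 * Real.pi)⁻¹ * 16)).toNNReal, fun ρ s w hρ0 hρ1 hs hs1 hρs hw1 hws => ?_⟩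
  have hw0 : 0 < ‖w‖ := by linarith
  have h1 := hKF (ρ * ‖w‖) s (by nlinarith) (by nlinarith) hs hs1 (by nlinarith)
  -- Starting the circle at the argument of `w` makes the points `ρ |w| ζ` those of the orbit of `ρ
  -- w` under rotations.
  rw [Real.circleAverage_eq_integral_add w.arg] at h1
  set f : ℂ → ℝ := fun ζ => ‖F ((ρ * ‖w‖ : ℝ) * ζ)‖ ^ p * (‖1 - ζ‖ * s / (s + ‖1 - ζ‖) ^ 3) with hf
  have hpt : ∀ θ : ℝ, ‖f (circleMap 0 1 (θ + w.arg))‖ₑ ≤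
      16 * (‖F (ρ * (Complex.exp (θ * Complex.I) * w))‖ₑ ^ p *
          ENNReal.ofReal (scaleWeight s (Complex.exp (θ * Complex.I) * w))) := by
    intro θ
    set ζ := circleMap 0 1 (θ + w.arg) with hζ
    have hζ1 : ‖ζ‖ = 1 := by rw [hζ]; simp
    have hζw : (‖w‖ : ℂ) * ζ = Complex.exp (θ * Complex.I) * w := by
      conv_rhs => rw [← Complex.norm_mul_exp_arg_mul_I w]
      rw [hζ, circleMap]
      push_cast
      rw [add_mul, Complex.exp_add]
      ring
    rw [← hζw]
    have hfn : 0 ≤ f ζ := by rw [hf]; positivity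
    have hd := norm_one_sub_le hw0.le hw1 hζ1.le
    have hd2 : ‖1 - (‖w‖ : ℂ) * ζ‖ ≤ ‖1 - ζ‖ + s := by
      have : (1 : ℂ) - ‖w‖ * ζ = (1 - ζ) + ((1 - ‖w‖ : ℝ) : ℂ) * ζ := by push_cast; ring
      rw [this]
      refine (norm_add_le _ _).trans ?_
      rw [norm_real_mul (by linarith), hζ1]
      linarith
    -- Passing from `ζ` to `|w| ζ` at scale `s`: a factor `2` from the numerator and `2 ^ 3` from
    -- the cube, as `1 - |w| ≤ s`.
    have hwt : ‖1 - ζ‖ * s / (s + ‖1 - ζ‖) ^ 3 ≤ 16 * scaleWeight s ((‖w‖ : ℂ) * ζ) := by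
      unfold scaleWeight
      set d := ‖1 - ζ‖
      set d' := ‖1 - (‖w‖ : ℂ) * ζ‖
      have hd0 : 0 ≤ d := norm_nonneg _
      have hd'0 : 0 ≤ d' := norm_nonneg _
      calc d * s / (s + d) ^ 3 ≤ (2 * d') * s / ((s + d') / 2) ^ 3 := by
            gcongr
            linarith
        _ = _ := by field_simp; ring
    have hFe : F ((ρ * ‖w‖ : ℝ) * ζ) = F (ρ * ((‖w‖ : ℂ) * ζ)) := by push_cast; rw [mul_assoc]
    calc ‖f ζ‖ₑ = ENNReal.ofReal (f ζ) := Real.enorm_eq_ofReal hfn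
      _ ≤ ENNReal.ofReal (‖F (ρ * ((‖w‖ : ℂ) * ζ))‖ ^ p * (16 * scaleWeight s ((‖w‖ : ℂ) * ζ))) := by
          apply ENNReal.ofReal_le_ofReal
          rw [hf]
          simp only [hFe]
          gcongr
      _ = _ := by
          rw [ENNReal.ofReal_mul (by positivity), ENNReal.ofReal_mul (by norm_num),
            ← ENNReal.ofReal_rpow_of_nonneg (norm_nonneg _) hp.le, ofReal_norm]
          rw [mul_left_comm]
          congr 1
          norm_num
  have h2 : ENNReal.ofReal (∫ θ in (0 : ℝ)..(2 * Real.pi), f (circleMap 0 1 (θ + w.arg))) ≤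
      16 * ∫⁻ θ in Set.Ioc (0 : ℝ) (2 * Real.pi),
        ‖F (ρ * (Complex.exp (θ * Complex.I) * w))‖ₑ ^ p *
          ENNReal.ofReal (scaleWeight s (Complex.exp (θ * Complex.I) * w)) := by
    rw [intervalIntegral.integral_of_le (by positivity)]
    refine (Real.ofReal_le_enorm _).trans ((enorm_integral_le_lintegral_enorm _).trans ?_)
    rw [← lintegral_const_mul' _ _ (by norm_num)]
    exact lintegral_mono hpt
  calc ENNReal.ofReal ((1 / U s) ^ p)
      ≤ ENNReal.ofReal (K * ((2 * Real.pi)⁻¹ •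
          ∫ θ in (0 : ℝ)..(2 * Real.pi), f (circleMap 0 1 (θ + w.arg)))) :=
        ENNReal.ofReal_le_ofReal h1
    _ = ENNReal.ofReal (K * (2 * Real.pi)⁻¹) *
        ENNReal.ofReal (∫ θ in (0 : ℝ)..(2 * Real.pi), f (circleMap 0 1 (θ + w.arg))) := by
        rw [smul_eq_mul, ← mul_assoc, ENNReal.ofReal_mul (by positivity)]
    _ ≤ ENNReal.ofReal (K * (2 * Real.pi)⁻¹) * (16 * ∫⁻ θ in Set.Ioc (0 : ℝ) (2 * Real.pi),
        ‖F (ρ * (Complex.exp (θ * Complex.I) * w))‖ₑ ^ p *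
          ENNReal.ofReal (scaleWeight s (Complex.exp (θ * Complex.I) * w))) := by gcongr
    _ = _ := by
        rw [← mul_assoc]
        congr 1
        rw [← mul_assoc, ← ENNReal.ofReal, ENNReal.ofReal_mul (p := K * (2 * Real.pi)⁻¹)
          (by positivity)]
        norm_num

/-- Multiplication by a number of modulus one. -/
def rotation (n : ℕ) (u : ℂ) (hu : ‖u‖ = 1) : Cn n ≃ₗᵢ[ℂ] Cn n where
  toLinearEquiv := LinearEquiv.smulOfNeZero ℂ (Cn n) u (by rintro rfl; simp at hu)
  norm_map' x := by simp [norm_smul, hu]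

lemma rotation_apply (n : ℕ) (u : ℂ) (hu : ‖u‖ = 1) (x : Cn n) : rotation n u hu x = u • x := rfl

/-- On the tube `|⟨ξ, e⟩| ≥ 1 - s` the circle estimate applies at every point. Its measure supplies
`s ^ (n - 1)`, and since the rotations preserve the surface measure, the average over them
disappears after Tonelli. -/
lemma SizeLike.scale_le_lintegral_sphere {n : ℕ} (hn : 1 ≤ n) (hU : TailFn U C M)
    (hF : SizeLike U F A) (hFm : Measurable F) {p : ℝ} (hp : 0 < p) :
    ∃ K : ℝ≥0, ∀ (e : Cn n) (ρ s : ℝ), ‖e‖ = 1 → 1 / 4 < ρ → ρ < 1 → 0 < s → s ≤ 7 / 8 →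
      1 - ρ ≤ s → ENNReal.ofReal (meanDensity n U p s) ≤
        K * ∫⁻ ξ : sphere (0 : Cn n) 1, ‖F (ρ * inner ℂ e (ξ : Cn n))‖ₑ ^ p *
          ENNReal.ofReal (scaleWeight s (inner ℂ e (ξ : Cn n))) ∂(sphereMeasure n) := by
  obtain ⟨K₁, hK₁⟩ := hF.rpow_le_lintegral_rotations hU hp
  obtain ⟨K₂, hK₂⟩ := le_sphereMeasure_tube hn
  have := isProbabilityMeasure_sphereMeasure hn
  refine ⟨K₂ * (K₁ * (2 * Real.pi).toNNReal), fun e ρ s he hρ0 hρ1 hs hs1 hρs => ?_⟩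
  set G : ℂ → ℝ≥0∞ := fun w => ‖F (ρ * w)‖ₑ ^ p * ENNReal.ofReal (scaleWeight s w) with hG
  have hGm : Measurable G := by
    have : Measurable (scaleWeight s) := by unfold scaleWeight; fun_prop
    fun_prop
  set S : Set (sphere (0 : Cn n) 1) := {ξ | 1 - s ≤ ‖inner ℂ e (ξ : Cn n)‖} with hS
  have hSm : MeasurableSet S := measurableSet_le measurable_const (by fun_prop)
  have hUs := hU.pos s hs (by linarith)
  have hrot : ∀ θ : ℝ, ∫⁻ ξ : sphere (0 : Cn n) 1,
      G (Complex.exp (θ * Complex.I) * inner ℂ e (ξ : Cn n)) ∂(sphereMeasure n) =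
      ∫⁻ ξ : sphere (0 : Cn n) 1, G (inner ℂ e (ξ : Cn n)) ∂(sphereMeasure n) := fun θ => by
    have := lintegral_sphereMeasure_comp hn
      (rotation n (Complex.exp (θ * Complex.I)) (Complex.norm_exp_ofReal_mul_I θ))
      (f := fun x => G (inner ℂ e x)) (hGm.comp (by fun_prop))
    simpa only [rotation_apply, inner_smul_right] using this
  have hmain : ENNReal.ofReal ((1 / U s) ^ p) * sphereMeasure n S ≤
      K₁ * ((2 * Real.pi).toNNReal *
        ∫⁻ ξ : sphere (0 : Cn n) 1, G (inner ℂ e (ξ : Cn n)) ∂(sphereMeasure n)) := by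
    calc ENNReal.ofReal ((1 / U s) ^ p) * sphereMeasure n S
        = ∫⁻ _ in S, ENNReal.ofReal ((1 / U s) ^ p) ∂(sphereMeasure n) := by
          rw [setLIntegral_const]
      _ ≤ ∫⁻ ξ in S, K₁ * (∫⁻ θ in Set.Ioc (0 : ℝ) (2 * Real.pi),
            G (Complex.exp (θ * Complex.I) * inner ℂ e (ξ : Cn n))) ∂(sphereMeasure n) := by
          refine setLIntegral_mono' hSm fun ξ hξ => ?_
          exact hK₁ ρ s _ hρ0 hρ1 hs hs1 hρs (norm_inner_le_one he ξ) hξ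
      _ ≤ ∫⁻ ξ : sphere (0 : Cn n) 1, K₁ * (∫⁻ θ in Set.Ioc (0 : ℝ) (2 * Real.pi),
            G (Complex.exp (θ * Complex.I) * inner ℂ e (ξ : Cn n))) ∂(sphereMeasure n) :=
          setLIntegral_le_lintegral _ _
      _ = K₁ * ∫⁻ θ in Set.Ioc (0 : ℝ) (2 * Real.pi), ∫⁻ ξ : sphere (0 : Cn n) 1,
            G (Complex.exp (θ * Complex.I) * inner ℂ e (ξ : Cn n)) ∂(sphereMeasure n) := by
          rw [lintegral_const_mul' _ _ ENNReal.coe_ne_top, lintegral_lintegral_swap]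
          exact (hGm.comp (by fun_prop : Measurable fun q : sphere (0 : Cn n) 1 × ℝ =>
            Complex.exp (q.2 * Complex.I) * inner ℂ e (q.1 : Cn n))).aemeasurable
      _ = _ := by
          simp only [hrot]
          rw [setLIntegral_const, Real.volume_Ioc, sub_zero, mul_comm _ (ENNReal.ofReal _)]
          rfl
  calc ENNReal.ofReal (meanDensity n U p s)
      = ENNReal.ofReal ((1 / U s) ^ p) * ENNReal.ofReal (s ^ (n - 1)) := by
        rw [← ENNReal.ofReal_mul (by positivity), meanDensity, mul_comm]
    _ ≤ ENNReal.ofReal ((1 / U s) ^ p) * (K₂ * sphereMeasure n S) := by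
        gcongr
        exact hK₂ e he s hs (by linarith)
    _ = K₂ * (ENNReal.ofReal ((1 / U s) ^ p) * sphereMeasure n S) := by ring
    _ ≤ K₂ * (K₁ * ((2 * Real.pi).toNNReal *
        ∫⁻ ξ : sphere (0 : Cn n) 1, G (inner ℂ e (ξ : Cn n)) ∂(sphereMeasure n))) := by gcongr
    _ = _ := by push_cast; ring

/-- The circle estimates stop at `s = 7 / 8`. The missing interval is compared with `(3/4, 7/8]`: it
has the same length, and there `1 / U` is at least as large while `s ^ (n - 1)` is bounded below. -/
lemma lintegral_meanDensity_le {n : ℕ} (hU : TailFn U C M) {p : ℝ} (hp : 0 < p) :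
    ∃ K : ℝ≥0, ∀ a : ℝ, 0 < a → a < 3 / 4 →
      ∫⁻ s in Set.Ioc a 1, ENNReal.ofReal (meanDensity n U p s) ≤
        K * ∫⁻ s in Set.Ioc a (7 / 8), ENNReal.ofReal (meanDensity n U p s) := by
  refine ⟨1 + ((4 / 3 : ℝ) ^ (n - 1)).toNNReal, fun a ha0 ha1 => ?_⟩
  set c := (1 / U (7 / 8)) ^ p with hc
  have hU7 := hU.pos (7 / 8) (by norm_num) (by norm_num)
  have hc0 : 0 < c := by positivity
  have h1 : ∫⁻ s in Set.Ioc (7 / 8 : ℝ) 1, ENNReal.ofReal (meanDensity n U p s) ≤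
      ENNReal.ofReal (c * (1 / 8)) := by
    calc ∫⁻ s in Set.Ioc (7 / 8 : ℝ) 1, ENNReal.ofReal (meanDensity n U p s)
        ≤ ∫⁻ s in Set.Ioc (7 / 8 : ℝ) 1, ENNReal.ofReal c := by
          refine setLIntegral_mono' measurableSet_Ioc fun s hs => ENNReal.ofReal_le_ofReal ?_
          have hs0 : 0 < s := by linarith [hs.1]
          have hUs := hU.pos s hs0 hs.2
          have h2 : (1 / U s) ^ p ≤ c := Real.rpow_le_rpow (by positivity)
            (one_div_le_one_div_of_le hU7 (hU.mono _ _ (by norm_num) hs.1.le hs.2)) hp.le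
          have h3 : s ^ (n - 1) ≤ 1 := pow_le_one₀ hs0.le hs.2
          calc meanDensity n U p s ≤ 1 * c := by unfold meanDensity; gcongr
            _ = c := one_mul c
      _ = _ := by
          rw [setLIntegral_const, Real.volume_Ioc, ← ENNReal.ofReal_mul hc0.le]
          norm_num
  have h2 : ENNReal.ofReal ((3 / 4) ^ (n - 1) * c * (1 / 8)) ≤
      ∫⁻ s in Set.Ioc a (7 / 8), ENNReal.ofReal (meanDensity n U p s) := by
    calc ENNReal.ofReal ((3 / 4) ^ (n - 1) * c * (1 / 8))
        = ∫⁻ s in Set.Ioc (3 / 4 : ℝ) (7 / 8), ENNReal.ofReal ((3 / 4) ^ (n - 1) * c) := by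
          rw [setLIntegral_const, Real.volume_Ioc, ← ENNReal.ofReal_mul (by positivity)]
          norm_num
      _ ≤ ∫⁻ s in Set.Ioc (3 / 4 : ℝ) (7 / 8), ENNReal.ofReal (meanDensity n U p s) := by
          refine setLIntegral_mono' measurableSet_Ioc fun s hs => ENNReal.ofReal_le_ofReal ?_
          have hs0 : 0 < s := by linarith [hs.1]
          have hUs := hU.pos s hs0 (by linarith [hs.2])
          have h2 : c ≤ (1 / U s) ^ p := Real.rpow_le_rpow (by positivity)
            (one_div_le_one_div_of_le hUs (hU.mono _ _ hs0 hs.2 (by norm_num))) hp.le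
          have h3 := hs.1.le
          unfold meanDensity
          gcongr
      _ ≤ _ := lintegral_mono_set (Set.Ioc_subset_Ioc_left ha1.le)
  have hunion : Set.Ioc a (7 / 8) ∪ Set.Ioc (7 / 8) 1 = Set.Ioc a 1 :=
    Set.Ioc_union_Ioc_eq_Ioc (by linarith) (by norm_num)
  rw [← hunion]
  refine (lintegral_union_le _ _ _).trans ?_
  have h3 : ENNReal.ofReal (c * (1 / 8)) = ((4 / 3 : ℝ) ^ (n - 1)).toNNReal *
      ENNReal.ofReal ((3 / 4) ^ (n - 1) * c * (1 / 8)) := by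
    rw [← ENNReal.ofReal, ← ENNReal.ofReal_mul (by positivity), mul_assoc ((3 / 4 : ℝ) ^ _),
      ← mul_assoc, ← mul_pow]
    norm_num
  push_cast
  rw [add_mul, one_mul]
  gcongr
  rw [h3] at h1
  exact h1.trans (by gcongr)

lemma lintegral_lintegral_scaleWeight_le {X : Type*} [MeasurableSpace X] {μ : Measure X}
    [SFinite μ] {H : X → ℝ≥0∞} (hH : Measurable H) {g : X → ℂ} (hg : Measurable g) :
    ∫⁻ s in Set.Ioc (0 : ℝ) 1, ∫⁻ x, H x * ENNReal.ofReal (scaleWeight s (g x)) ∂μ ≤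
      ∫⁻ x, H x ∂μ := by
  have hwm : Measurable fun q : ℝ × ℂ => scaleWeight q.1 q.2 := by unfold scaleWeight; fun_prop
  have h2 : Measurable fun q : ℝ × X => scaleWeight q.1 (g q.2) :=
    hwm.comp (measurable_fst.prodMk (hg.comp measurable_snd))
  rw [lintegral_lintegral_swap ((hH.comp measurable_snd).mul h2.ennreal_ofReal).aemeasurable]
  refine lintegral_mono fun x => ?_
  have h3 : Measurable fun s : ℝ => ENNReal.ofReal (scaleWeight s (g x)) :=
    (hwm.comp (measurable_id.prodMk measurable_const)).ennreal_ofReal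
  rw [lintegral_const_mul _ h3]
  exact mul_le_of_le_one_right' (lintegral_scaleWeight_le _)

/-- Integrate the estimate at scale `s` over all scales and exchange the integrals: at each point
the weights integrate in `s` to at most `1`, so what remains is the plain mean of `|F| ^ p`. -/
lemma SizeLike.le_lintegral_sphere {n : ℕ} (hn : 1 ≤ n) (hU : TailFn U C M)
    (hF : SizeLike U F A) (hFm : Measurable F) {p : ℝ} (hp : 0 < p) :
    ∃ K : ℝ≥0, ∀ (e : Cn n) (ρ : ℝ), ‖e‖ = 1 → 1 / 4 < ρ → ρ < 1 →
      ∫⁻ s in Set.Ioc (1 - ρ) 1, ENNReal.ofReal (meanDensity n U p s) ≤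
      K * ∫⁻ ξ : sphere (0 : Cn n) 1, ‖F (ρ * inner ℂ e (ξ : Cn n))‖ₑ ^ p ∂(sphereMeasure n) := by
  obtain ⟨K₁, hK₁⟩ := hF.scale_le_lintegral_sphere hn hU hFm hp
  obtain ⟨K₂, hK₂⟩ := lintegral_meanDensity_le (n := n) hU hp
  have := isProbabilityMeasure_sphereMeasure hn
  refine ⟨K₂ * K₁, fun e ρ he hρ0 hρ1 => ?_⟩
  have hHm : Measurable fun ξ : sphere (0 : Cn n) 1 => ‖F (ρ * inner ℂ e (ξ : Cn n))‖ₑ ^ p :=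
    ((hFm.comp (by fun_prop : Measurable fun ξ : sphere (0 : Cn n) 1 =>
      (ρ : ℂ) * inner ℂ e (ξ : Cn n))).enorm).pow_const p
  have hgm : Measurable fun ξ : sphere (0 : Cn n) 1 => inner ℂ e (ξ : Cn n) := by fun_prop
  calc ∫⁻ s in Set.Ioc (1 - ρ) 1, ENNReal.ofReal (meanDensity n U p s)
      ≤ K₂ * ∫⁻ s in Set.Ioc (1 - ρ) (7 / 8), ENNReal.ofReal (meanDensity n U p s) :=
        hK₂ _ (by linarith) (by linarith)
    _ ≤ K₂ * ∫⁻ s in Set.Ioc (1 - ρ) (7 / 8), K₁ * ∫⁻ ξ : sphere (0 : Cn n) 1,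
          ‖F (ρ * inner ℂ e (ξ : Cn n))‖ₑ ^ p *
          ENNReal.ofReal (scaleWeight s (inner ℂ e (ξ : Cn n))) ∂(sphereMeasure n) := by
        refine mul_le_mul' le_rfl ?_
        refine setLIntegral_mono' measurableSet_Ioc fun s hs => ?_
        exact hK₁ e ρ s he hρ0 hρ1 (by linarith [hs.1]) hs.2 hs.1.le
    _ ≤ K₂ * ∫⁻ s in Set.Ioc (0 : ℝ) 1, K₁ * ∫⁻ ξ : sphere (0 : Cn n) 1,
          ‖F (ρ * inner ℂ e (ξ : Cn n))‖ₑ ^ p *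
          ENNReal.ofReal (scaleWeight s (inner ℂ e (ξ : Cn n))) ∂(sphereMeasure n) :=
        mul_le_mul' le_rfl
          (lintegral_mono_set (Set.Ioc_subset_Ioc (by linarith) (by norm_num)))
    _ ≤ K₂ * (K₁ * ∫⁻ ξ : sphere (0 : Cn n) 1,
          ‖F (ρ * inner ℂ e (ξ : Cn n))‖ₑ ^ p ∂(sphereMeasure n)) := by
        rw [lintegral_const_mul' _ _ ENNReal.coe_ne_top]
        exact mul_le_mul' le_rfl (mul_le_mul' le_rfl (lintegral_lintegral_scaleWeight_le hHm hgm))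
    _ = _ := by push_cast; rw [mul_assoc]

end SphereMeans

/-! ### Tails of the weight and coefficients of the kernel -/

section Weights

/-- The tail integral in the variable `s = 1 - r`, extended to a monotone function. -/
def tailFun (ω : ℝ → ℝ) (s : ℝ) : ℝ :=
  ∫ t in Set.Ioo (1 - s) 1, (Set.Ico (0 : ℝ) 1).indicator ω t

variable {ω : ℝ → ℝ}

lemma IsRadialWeight.integrable_indicator (hω : IsRadialWeight ω) :
    Integrable ((Set.Ico (0 : ℝ) 1).indicator ω) :=
  (integrable_indicator_iff measurableSet_Ico).2 hω.integrable

lemma IsRadialWeight.indicator_nonneg (hω : IsRadialWeight ω) (t : ℝ) :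
    0 ≤ (Set.Ico (0 : ℝ) 1).indicator ω t :=
  Set.indicator_nonneg (fun t ht => (hω.pos t ht).le) t

lemma IsRadialWeight.monotone_tailFun (hω : IsRadialWeight ω) : Monotone (tailFun ω) := by
  intro s t hst
  refine setIntegral_mono_set hω.integrable_indicator.integrableOn
    (ae_of_all _ hω.indicator_nonneg) (ae_of_all _ ?_)
  exact Set.Ioo_subset_Ioo_left (by linarith)

lemma hat_eq_tailFun {s : ℝ} (hs : 0 ≤ s) (hs1 : s ≤ 1) :
    hat ω (1 - s) = tailFun ω s := by
  unfold hat tailFun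
  rw [intervalIntegral.integral_of_le (by linarith), integral_Ioc_eq_integral_Ioo]
  refine setIntegral_congr_fun measurableSet_Ioo fun t ht => ?_
  rw [Set.indicator_of_mem]
  exact ⟨by linarith [ht.1], ht.2⟩

lemma IsRadialWeight.intervalIntegrable (hω : IsRadialWeight ω) {s : ℝ} (hs : 0 ≤ s)
    (hs1 : s ≤ 1) : IntervalIntegrable ω volume (1 - s) 1 := by
  rw [intervalIntegrable_iff_integrableOn_Ico_of_le (by linarith)]
  exact hω.integrable.mono_set (Set.Ico_subset_Ico_left (by linarith))

lemma IsRadialWeight.tailFun_pos (hω : IsRadialWeight ω) {s : ℝ} (hs : 0 < s) (hs1 : s ≤ 1) :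
    0 < tailFun ω s := by
  rw [← hat_eq_tailFun hs.le hs1]
  exact intervalIntegral.intervalIntegral_pos_of_pos_on (hω.intervalIntegrable hs.le hs1)
    (fun t ht => hω.pos t ⟨by linarith [ht.1], ht.2⟩) (by linarith)

lemma IsRadialWeight.lintegral_eq_tailFun (hω : IsRadialWeight ω) {s : ℝ} (hs1 : s ≤ 1) :
    ∫⁻ t in Set.Ioo (1 - s) 1, ENNReal.ofReal (ω t) = ENNReal.ofReal (tailFun ω s) := by
  unfold tailFun
  rw [ofReal_integral_eq_lintegral_ofReal hω.integrable_indicator.integrableOn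
    (ae_of_all _ hω.indicator_nonneg)]
  refine setLIntegral_congr_fun measurableSet_Ioo fun t ht => ?_
  rw [Set.indicator_of_mem]
  exact ⟨by linarith [ht.1], ht.2⟩

lemma IsDoubling.tailFn (hω : IsDoubling ω) : ∃ C M, TailFn (tailFun ω) C M := by
  obtain ⟨D, hD0, hD⟩ := hω.doubling
  refine TailFn.of_doubling (D := D) (fun s h0 h1 => hω.tailFun_pos h0 h1)
    (fun s t _ h _ => hω.monotone_tailFun h) fun s h0 h1 => ?_
  have := hD (1 - s) ⟨by linarith, by linarith⟩
  rw [hat_eq_tailFun h0.le h1, show (1 + (1 - s)) / 2 = 1 - s / 2 by ring,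
    hat_eq_tailFun (by linarith) (by linarith)] at this
  exact this.le

/-- The size of the measure `ω dV` of a neighbourhood of a complex circle. -/
def tubeSize (n : ℕ) (ω : ℝ → ℝ) (s : ℝ) : ℝ := s ^ (n - 1) * tailFun ω s

lemma IsRadialWeight.measurable_tubeSize (hω : IsRadialWeight ω) (n : ℕ) :
    Measurable (tubeSize n ω) := by
  have := hω.monotone_tailFun.measurable
  unfold tubeSize
  fun_prop

lemma IsDoubling.tailFn_tubeSize (hω : IsDoubling ω) (n : ℕ) :
    ∃ C M, TailFn (tubeSize n ω) C M := by
  obtain ⟨C, M, h⟩ := hω.tailFn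
  exact ⟨_, _, (TailFn.pow (n - 1)).mul h⟩

lemma isFiniteMeasure_weightedMeasure {n : ℕ} (hn : 1 ≤ n) (hω : IsRadialWeight ω) :
    IsFiniteMeasure (weightedMeasure n ω) := by
  have := isProbabilityMeasure_sphereMeasure hn
  refine ⟨?_⟩
  rw [← lintegral_one, lintegral_weightedMeasure hn hω measurable_const]
  refine ENNReal.mul_lt_top (ENNReal.mul_lt_top (by simp) (by simp)) ?_
  calc ∫⁻ r in Set.Ioo (0 : ℝ) 1, ENNReal.ofReal (ω r) * ENNReal.ofReal (r ^ (2 * n - 1)) *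
        ∫⁻ _ : sphere (0 : Cn n) 1, 1 ∂(sphereMeasure n)
      ≤ ∫⁻ r in Set.Ioo (1 - 1 : ℝ) 1, ENNReal.ofReal (ω r) := by
        rw [sub_self]
        refine setLIntegral_mono' measurableSet_Ioo fun r hr => ?_
        rw [lintegral_one, measure_univ, mul_one]
        exact mul_le_of_le_one_right' (ENNReal.ofReal_le_one.2 (pow_le_one₀ hr.1.le hr.2.le))
    _ < ∞ := by
        rw [hω.lintegral_eq_tailFun le_rfl]
        exact ENNReal.ofReal_lt_top

lemma ae_mem_ball_weightedMeasure (n : ℕ) (ω : ℝ → ℝ) :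
    ∀ᵐ z ∂(weightedMeasure n ω), z ∈ ball (0 : Cn n) 1 := by
  have h1 : ∀ᵐ z ∂(ballMeasure n), z ∈ ball (0 : Cn n) 1 := by
    unfold ballMeasure ProbabilityTheory.cond
    exact Measure.ae_smul_measure (ae_restrict_mem measurableSet_ball) _
  exact (withDensity_absolutelyContinuous _ _).ae_le h1

lemma weightedMeasure_tube {n : ℕ} (hn : 1 ≤ n) (hω : IsRadialWeight ω) (e : Cn n) (s : ℝ) :
    weightedMeasure n ω {w | 1 - s ≤ ‖inner ℂ e w‖ ^ 2} = 2 * n * ∫⁻ r in Set.Ioo (0 : ℝ) 1,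
      ENNReal.ofReal (ω r) * ENNReal.ofReal (r ^ (2 * n - 1)) *
        sphereMeasure n {ξ | 1 - s ≤ (r * ‖inner ℂ e (ξ : Cn n)‖) ^ 2} := by
  have hS : MeasurableSet {w : Cn n | 1 - s ≤ ‖inner ℂ e w‖ ^ 2} :=
    measurableSet_le measurable_const (by fun_prop)
  rw [← lintegral_indicator_one hS, lintegral_weightedMeasure hn hω
    (measurable_one.indicator hS)]
  congr 1
  refine setLIntegral_congr_fun measurableSet_Ioo fun r hr => ?_
  congr 1
  have hS' : MeasurableSet {ξ : sphere (0 : Cn n) 1 | 1 - s ≤ (r * ‖inner ℂ e (ξ : Cn n)‖) ^ 2} :=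
    measurableSet_le measurable_const (by fun_prop)
  rw [← lintegral_indicator_one hS']
  congr 1
  funext ξ
  simp only [Set.indicator, Set.mem_ofPred_eq, inner_smul_right, norm_real_mul hr.1.le,
    Pi.one_apply]

/-- For a point `r ξ` of the tube, both `r` and `|⟨ξ, e⟩|` are at least `1 - s`, so its measure is
at most a tail of `ω` times the measure of a tube on the sphere. -/
lemma weightedMeasure_tube_le {n : ℕ} (hn : 1 ≤ n) (hω : IsRadialWeight ω) :
    ∃ B : ℝ≥0, ∀ e : Cn n, ‖e‖ = 1 → ∀ s : ℝ, 0 < s → s ≤ 1 →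
      weightedMeasure n ω {w | 1 - s ≤ ‖inner ℂ e w‖ ^ 2} ≤
        B * ENNReal.ofReal (tubeSize n ω s) := by
  obtain ⟨K, hK⟩ := sphereMeasure_tube_le hn
  refine ⟨2 * n * K, fun e he s hs hs1 => ?_⟩
  rw [weightedMeasure_tube hn hω]
  have hpt : ∀ r ∈ Set.Ioo (0 : ℝ) 1, ENNReal.ofReal (ω r) * ENNReal.ofReal (r ^ (2 * n - 1)) *
        sphereMeasure n {ξ | 1 - s ≤ (r * ‖inner ℂ e (ξ : Cn n)‖) ^ 2} ≤
      (Set.Ici (1 - s)).indicator (fun r => (K * ENNReal.ofReal (s ^ (n - 1))) *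
        ENNReal.ofReal (ω r)) r := by
    intro r hr
    have hsq : ∀ ξ : sphere (0 : Cn n) 1, (r * ‖inner ℂ e (ξ : Cn n)‖) ^ 2 ≤
        r * ‖inner ℂ e (ξ : Cn n)‖ := fun ξ => by
      have h1 := norm_inner_le_one he ξ
      have h0 := norm_nonneg (inner ℂ e (ξ : Cn n))
      exact pow_le_of_le_one (mul_nonneg hr.1.le h0)
        (mul_le_one₀ hr.2.le h0 h1) two_ne_zero
    by_cases hrs : r ∈ Set.Ici (1 - s)
    · rw [Set.indicator_of_mem hrs]
      have h1 : sphereMeasure n {ξ | 1 - s ≤ (r * ‖inner ℂ e (ξ : Cn n)‖) ^ 2} ≤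
          K * ENNReal.ofReal (s ^ (n - 1)) := by
        refine (measure_mono fun ξ hξ => ?_).trans (hK e he s hs hs1)
        have h2 : 1 - s ≤ (r * ‖inner ℂ e (ξ : Cn n)‖) ^ 2 := hξ
        exact h2.trans ((hsq ξ).trans (mul_le_of_le_one_left (norm_nonneg _) hr.2.le))
      calc ENNReal.ofReal (ω r) * ENNReal.ofReal (r ^ (2 * n - 1)) *
            sphereMeasure n {ξ | 1 - s ≤ (r * ‖inner ℂ e (ξ : Cn n)‖) ^ 2}
          ≤ ENNReal.ofReal (ω r) * 1 * (K * ENNReal.ofReal (s ^ (n - 1))) := by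
            gcongr
            exact ENNReal.ofReal_le_one.2 (pow_le_one₀ hr.1.le hr.2.le)
        _ = _ := by ring
    · have : {ξ : sphere (0 : Cn n) 1 | 1 - s ≤ (r * ‖inner ℂ e (ξ : Cn n)‖) ^ 2} = ∅ := by
        ext ξ
        simp only [Set.mem_ofPred_eq, Set.mem_empty_iff_false, iff_false, not_le]
        have h1 := norm_inner_le_one he ξ
        have h2 : r < 1 - s := not_le.1 hrs
        exact ((hsq ξ).trans (mul_le_of_le_one_right hr.1.le h1)).trans_lt h2
      rw [this, measure_empty, mul_zero]
      exact zero_le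
  calc 2 * n * ∫⁻ r in Set.Ioo (0 : ℝ) 1,
      ENNReal.ofReal (ω r) * ENNReal.ofReal (r ^ (2 * n - 1)) *
        sphereMeasure n {ξ | 1 - s ≤ (r * ‖inner ℂ e (ξ : Cn n)‖) ^ 2}
      ≤ 2 * n * ∫⁻ r in Set.Ioo (0 : ℝ) 1,
        (Set.Ici (1 - s)).indicator (fun r => (K * ENNReal.ofReal (s ^ (n - 1))) *
        ENNReal.ofReal (ω r)) r := by
        refine mul_le_mul' le_rfl ?_
        exact setLIntegral_mono' measurableSet_Ioo hpt
    _ ≤ 2 * n * ∫⁻ r in Set.Ico (1 - s) 1, (K * ENNReal.ofReal (s ^ (n - 1))) *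
        ENNReal.ofReal (ω r) := by
        rw [setLIntegral_indicator measurableSet_Ici]
        refine mul_le_mul' le_rfl (lintegral_mono_set ?_)
        rintro r ⟨h1, h2⟩
        exact ⟨h1, h2.2⟩
    _ = 2 * n * ((K * ENNReal.ofReal (s ^ (n - 1))) * ENNReal.ofReal (tailFun ω s)) := by
        rw [lintegral_const_mul' _ _ (ENNReal.mul_ne_top ENNReal.coe_ne_top ENNReal.ofReal_ne_top),
          ← hω.lintegral_eq_tailFun hs1, Measure.restrict_congr_set Ioo_ae_eq_Ico]
    _ = _ := by
        unfold tubeSize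
        rw [ENNReal.ofReal_mul (by positivity)]
        push_cast
        ring

/-- Conversely, `r > 1 - s / 8` and `|⟨ξ, e⟩| ≥ 1 - s / 4` force membership in the tube. Doubling of
`ω` brings the tail at `s / 8` back to `s`. -/
lemma le_weightedMeasure_tube {n : ℕ} (hn : 1 ≤ n) (hω : IsDoubling ω) :
    ∃ B : ℝ≥0, ∀ e : Cn n, ‖e‖ = 1 → ∀ s : ℝ, 0 < s → s ≤ 1 →
      ENNReal.ofReal (tubeSize n ω s) ≤
        B * weightedMeasure n ω {w | 1 - s ≤ ‖inner ℂ e w‖ ^ 2} := by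
  obtain ⟨K, hK⟩ := le_sphereMeasure_tube hn
  obtain ⟨C, M, hW⟩ := hω.tailFn
  have hC := hW.one_le
  set c : ℝ := C * 8 ^ M * 4 ^ (n - 1) * ((8 / 7) ^ (2 * n - 1)) with hc
  have hc0 : 0 ≤ c := by positivity
  refine ⟨c.toNNReal * K, fun e he s hs hs1 => ?_⟩
  rw [weightedMeasure_tube hn hω.toIsRadialWeight]
  set N := fun r : ℝ => sphereMeasure n {ξ | 1 - s ≤ (r * ‖inner ℂ e (ξ : Cn n)‖) ^ 2} with hN
  have hpt : ∀ r ∈ Set.Ioo (1 - s / 8) 1,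
      ENNReal.ofReal (ω r) * (ENNReal.ofReal ((7 / 8) ^ (2 * n - 1)) *
        ENNReal.ofReal ((s / 4) ^ (n - 1))) ≤
      K * (ENNReal.ofReal (ω r) * ENNReal.ofReal (r ^ (2 * n - 1)) * N r) := by
    intro r hr
    have h1 : ENNReal.ofReal ((s / 4) ^ (n - 1)) ≤ K * N r := by
      refine (hK e he (s / 4) (by positivity) (by linarith)).trans ?_
      refine mul_le_mul' le_rfl (measure_mono fun ξ hξ => ?_)
      have h2 : 1 - s / 4 ≤ ‖inner ℂ e (ξ : Cn n)‖ := hξ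
      change 1 - s ≤ (r * ‖inner ℂ e (ξ : Cn n)‖) ^ 2
      have h3 := hr.1
      have h4 : (1 - s / 8) * (1 - s / 4) ≤ r * ‖inner ℂ e (ξ : Cn n)‖ :=
        mul_le_mul h3.le h2 (by linarith) (by linarith)
      have h5 : 0 ≤ (1 - s / 8) * (1 - s / 4) := mul_nonneg (by linarith) (by linarith)
      have h6 : 1 - s / 2 ≤ (1 - s / 8) * (1 - s / 4) := by nlinarith
      have h7 : (1 - s / 2) ^ 2 ≤ (r * ‖inner ℂ e (ξ : Cn n)‖) ^ 2 :=
        pow_le_pow_left₀ (by linarith) (h6.trans h4) 2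
      nlinarith
    calc ENNReal.ofReal (ω r) * (ENNReal.ofReal ((7 / 8) ^ (2 * n - 1)) *
        ENNReal.ofReal ((s / 4) ^ (n - 1)))
        ≤ ENNReal.ofReal (ω r) * (ENNReal.ofReal (r ^ (2 * n - 1)) * (K * N r)) := by
          have h3 : 7 / 8 ≤ r := by linarith [hr.1]
          gcongr
      _ = _ := by ring
  have hint : ENNReal.ofReal (tailFun ω (s / 8)) * (ENNReal.ofReal ((7 / 8) ^ (2 * n - 1)) *
        ENNReal.ofReal ((s / 4) ^ (n - 1))) ≤ K * ∫⁻ r in Set.Ioo (0 : ℝ) 1,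
      ENNReal.ofReal (ω r) * ENNReal.ofReal (r ^ (2 * n - 1)) * N r := by
    rw [← hω.lintegral_eq_tailFun (by linarith), ← lintegral_mul_const',
      ← lintegral_const_mul' _ _ ENNReal.coe_ne_top]
    · refine (setLIntegral_mono' measurableSet_Ioo hpt).trans (lintegral_mono_set ?_)
      exact Set.Ioo_subset_Ioo_left (by linarith)
    · exact ENNReal.mul_ne_top ENNReal.ofReal_ne_top ENNReal.ofReal_ne_top
  have hWs : tailFun ω s ≤ C * 8 ^ M * tailFun ω (s / 8) :=
    hW.le_of_le_mul (by norm_num) (by positivity) (by linarith) hs hs1 (by linarith)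
  have hWp := hω.tailFun_pos (s := s / 8) (by positivity) (by linarith)
  calc ENNReal.ofReal (tubeSize n ω s)
      ≤ ENNReal.ofReal (c * (tailFun ω (s / 8) * ((7 / 8) ^ (2 * n - 1) * (s / 4) ^ (n - 1)))) := by
        apply ENNReal.ofReal_le_ofReal
        have h1 : (8 / 7 : ℝ) ^ (2 * n - 1) * (7 / 8) ^ (2 * n - 1) = 1 := by
          rw [← mul_pow]; norm_num
        have h2 : (4 : ℝ) ^ (n - 1) * (s / 4) ^ (n - 1) = s ^ (n - 1) := by
          rw [← mul_pow]; congr 1; ring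
        calc tubeSize n ω s = s ^ (n - 1) * tailFun ω s := rfl
          _ ≤ s ^ (n - 1) * (C * 8 ^ M * tailFun ω (s / 8)) := by gcongr
          _ = (4 ^ (n - 1) * (s / 4) ^ (n - 1)) * (C * 8 ^ M * tailFun ω (s / 8)) *
              ((8 / 7) ^ (2 * n - 1) * (7 / 8) ^ (2 * n - 1)) := by rw [h1, h2, mul_one]
          _ = _ := by rw [hc]; ring
    _ = c.toNNReal * (ENNReal.ofReal (tailFun ω (s / 8)) *
        (ENNReal.ofReal ((7 / 8) ^ (2 * n - 1)) * ENNReal.ofReal ((s / 4) ^ (n - 1)))) := by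
        rw [ENNReal.ofReal_mul hc0, ENNReal.ofReal_mul hWp.le,
          ENNReal.ofReal_mul (p := (7 / 8 : ℝ) ^ (2 * n - 1)) (by positivity)]
        rfl
    _ ≤ c.toNNReal * (K * ∫⁻ r in Set.Ioo (0 : ℝ) 1,
      ENNReal.ofReal (ω r) * ENNReal.ofReal (r ^ (2 * n - 1)) * N r) := by gcongr
    _ ≤ c.toNNReal * (K * (2 * n * ∫⁻ r in Set.Ioo (0 : ℝ) 1,
      ENNReal.ofReal (ω r) * ENNReal.ofReal (r ^ (2 * n - 1)) * N r)) := by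
        gcongr
        refine le_mul_of_one_le_left' ?_
        have : (1 : ℝ≥0∞) ≤ n := by exact_mod_cast hn
        calc (1 : ℝ≥0∞) = 1 * 1 := by norm_num
          _ ≤ 2 * n := by gcongr; norm_num
    _ = _ := by push_cast; ring

lemma exists_norm_eq_one {n : ℕ} (hn : 1 ≤ n) : ∃ e : Cn n, ‖e‖ = 1 :=
  ⟨EuclideanSpace.single ⟨0, hn⟩ 1, by simp⟩

/-- Unitary invariance; hence one coefficient sequence serves all directions `z / |z|`. -/
lemma integral_norm_inner_pow_eq {n : ℕ} (ω : ℝ → ℝ) {e e' : Cn n} (he : ‖e‖ = 1)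
    (he' : ‖e'‖ = 1) (k : ℕ) :
    ∫ w, (‖inner ℂ e w‖ ^ 2) ^ k ∂(weightedMeasure n ω) =
      ∫ w, (‖inner ℂ e' w‖ ^ 2) ^ k ∂(weightedMeasure n ω) := by
  obtain ⟨m, rfl⟩ : ∃ m, n = m + 1 := by
    rcases n with _ | m
    · have : e = 0 := Subsingleton.elim _ _
      rw [this, norm_zero] at he
      exact absurd he zero_ne_one
    · exact ⟨m, rfl⟩
  have key : ∀ {e : Cn (m + 1)}, ‖e‖ = 1 →
      ∫ w, (‖inner ℂ e w‖ ^ 2) ^ k ∂(weightedMeasure (m + 1) ω) =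
      ∫ w : Cn (m + 1), (‖w 0‖ ^ 2) ^ k ∂(weightedMeasure (m + 1) ω) := by
    intro e he
    obtain ⟨T, hT⟩ := exists_isometry_apply_zero he
    have := (measurePreserving_weightedMeasure T ω).integral_comp
      T.toHomeomorph.measurableEmbedding fun w : Cn (m + 1) => (‖w 0‖ ^ 2) ^ k
    simpa only [hT] using this
  rw [key he, key he']

/-- The coefficients of the reproducing kernel. -/
lemma exists_kernelCoeff {n : ℕ} (hn : 1 ≤ n) (hω : IsDoubling ω) :
    ∃ a : ℕ → ℝ, (∀ k, 0 < a k) ∧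
      (∀ (e : Cn n) (k : ℕ), ‖e‖ = 1 →
        a k * ∫ w, (‖inner ℂ e w‖ ^ 2) ^ k ∂(weightedMeasure n ω) = 1) ∧
      (∀ j, SymbolBound j (coeffWeight (tubeSize n ω) 0) a) ∧
      ∃ B, 0 < B ∧ ∀ k, coeffWeight (tubeSize n ω) 0 k ≤ B * a k := by
  obtain ⟨e₀, he₀⟩ := exists_norm_eq_one hn
  obtain ⟨C, M, hV⟩ := hω.tailFn_tubeSize n
  obtain ⟨B₁, hB₁⟩ := weightedMeasure_tube_le hn hω.toIsRadialWeight
  obtain ⟨B₂, hB₂⟩ := le_weightedMeasure_tube hn hω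
  have := isFiniteMeasure_weightedMeasure hn hω.toIsRadialWeight
  have hC := hV.one_le
  set y : Cn n → ℝ := fun w => ‖inner ℂ e₀ w‖ ^ 2 with hy
  have hym : Measurable y := by fun_prop
  -- The law of `|⟨w, e₀⟩|²`: its moments are the integrals to be inverted, and its tails are the
  -- measures of tubes.
  set ν := (weightedMeasure n ω).map y with hνdef
  have : IsFiniteMeasure ν := Measure.isFiniteMeasure_map _ _
  have hν : ∀ᵐ t ∂ν, t ∈ Set.Icc (0 : ℝ) 1 := by
    refine (ae_map_iff (p := fun t => t ∈ Set.Icc (0 : ℝ) 1) hym.aemeasurable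
      measurableSet_Icc).2 ?_
    filter_upwards [ae_mem_ball_weightedMeasure n ω] with w hw
    have hw1 : ‖w‖ < 1 := by simpa using hw
    have h1 : ‖inner ℂ e₀ w‖ ≤ 1 := by
      refine (norm_inner_le_norm _ _).trans ?_
      rw [he₀, one_mul]; exact hw1.le
    exact ⟨by positivity, pow_le_one₀ (norm_nonneg _) h1⟩
  have hνI : ∀ s, ν (Set.Ici (1 - s)) = weightedMeasure n ω {w | 1 - s ≤ ‖inner ℂ e₀ w‖ ^ 2} :=
    fun s => Measure.map_apply hym measurableSet_Ici
  have hup : ∀ s, 0 < s → s ≤ 1 → ν.real (Set.Ici (1 - s)) ≤ B₁ * tubeSize n ω s := by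
    intro s h0 h1
    have h2 := hB₁ e₀ he₀ s h0 h1
    rw [← hνI] at h2
    have h3 := ENNReal.toReal_mono (ENNReal.mul_ne_top ENNReal.coe_ne_top ENNReal.ofReal_ne_top) h2
    rwa [ENNReal.toReal_mul, ENNReal.toReal_ofReal (hV.pos s h0 h1).le] at h3
  have hlo : ∀ s, 0 < s → s ≤ 1 → tubeSize n ω s ≤ B₂ * ν.real (Set.Ici (1 - s)) := by
    intro s h0 h1
    have h2 := hB₂ e₀ he₀ s h0 h1
    rw [← hνI] at h2
    have h3 := ENNReal.toReal_mono (ENNReal.mul_ne_top ENNReal.coe_ne_top (measure_ne_top _ _)) h2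
    rwa [ENNReal.toReal_mul, ENNReal.toReal_ofReal (hV.pos s h0 h1).le] at h3
  have hmom : ∀ k : ℕ, ∫ t, t ^ k ∂ν = ∫ w, (‖inner ℂ e₀ w‖ ^ 2) ^ k ∂(weightedMeasure n ω) :=
    fun k => integral_map hym.aemeasurable (by fun_prop)
  obtain ⟨A, hA0, hA⟩ := le_moment hν hV hlo
  obtain ⟨A', hA'⟩ := moment_le hν hV hup
  have hpos : ∀ k : ℕ, 0 < ∫ t, t ^ k ∂ν := fun k => by
    have := (hV.weight_pos k).trans_le (hA k)
    exact pos_of_mul_pos_right this hA0.le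
  refine ⟨fun k => (∫ t, t ^ k ∂ν)⁻¹, fun k => inv_pos.2 (hpos k), fun e k he => ?_, fun j => ?_,
    |A'| + 1, by positivity, fun k => ?_⟩
  · rw [integral_norm_inner_pow_eq ω he he₀, ← hmom]
    exact inv_mul_cancel₀ (hpos k).ne'
  · have h1 := (moment_symbolBound hν hV hup j).inv (fun k => hV.weight_pos k) hpos A hA 1
      (fun k => by rw [one_mul]; exact hV.weight_antitone (Nat.le_succ k)) (C * 2 ^ M)
      (fun k => by
        refine (hV.weight_le (Nat.le_succ k)).trans ?_
        have := (hV.weight_pos (k + 1)).le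
        gcongr
        rw [div_le_iff₀ (by positivity)]
        push_cast
        linarith [(Nat.cast_nonneg k : (0 : ℝ) ≤ k)])
    have h2 : coeffWeight (tubeSize n ω) 0 = fun k : ℕ => (tubeSize n ω (1 / ((k : ℝ) + 1)))⁻¹ := by
      funext k; simp [coeffWeight]
    rw [h2]
    exact h1
  · have h1 := hV.weight_pos k
    have h2 : ∫ t, t ^ k ∂ν ≤ (|A'| + 1) * tubeSize n ω (1 / ((k : ℝ) + 1)) :=
      (hA' k).trans (mul_le_mul_of_nonneg_right (by linarith [le_abs_self A']) h1.le)
    simp only [coeffWeight, pow_zero, one_mul]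
    rw [inv_le_iff_one_le_mul₀ h1, mul_comm, ← mul_assoc, ← div_eq_mul_inv, one_le_div (hpos k),
      mul_comm]
    exact h2

end Weights

/-! ### Power series as functions on the disc -/

section DiscSeries

/-- The sum of a power series in the unit disc, extended by zero. -/
def discSeries (a : ℕ → ℝ) : ℂ → ℂ :=
  (ball (0 : ℂ) 1).indicator fun z => ∑' k, (a k : ℂ) * z ^ k

variable {a : ℕ → ℝ} {A : ℝ} {q : ℕ}

lemma discSeries_apply (a : ℕ → ℝ) {z : ℂ} (hz : ‖z‖ < 1) :
    discSeries a z = ∑' k, (a k : ℂ) * z ^ k :=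
  Set.indicator_of_mem (by simpa using hz) _

/-- Termwise differentiation on a disc of radius `r` with `|z| < r < 1`, where the derivatives are
dominated by a convergent series. -/
lemma hasDerivAt_discSeries (ha : ∀ k, |a k| ≤ A * ((k : ℝ) + 1) ^ q) {z : ℂ} (hz : ‖z‖ < 1) :
    HasDerivAt (discSeries a) (∑' k : ℕ, (a k : ℂ) * (k * z ^ (k - 1))) z := by
  obtain ⟨r, hr, hr1⟩ := exists_between hz
  have hr0 : 0 < r := (norm_nonneg z).trans_lt hr
  have hA : 0 ≤ A := by
    have := (abs_nonneg _).trans (ha 0)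
    simpa using this
  have hka : ∀ k : ℕ, |(k : ℝ) * |a k| * r⁻¹| ≤ A * r⁻¹ * ((k : ℝ) + 1) ^ (q + 1) := by
    intro k
    rw [abs_of_nonneg (by positivity)]
    calc (k : ℝ) * |a k| * r⁻¹ ≤ ((k : ℝ) + 1) * (A * ((k : ℝ) + 1) ^ q) * r⁻¹ := by
          gcongr
          · linarith
          · exact ha k
      _ = _ := by ring
  have hs := summable_pow_mul_of_le hka hr0.le hr1
  have key : HasDerivAt (fun z : ℂ => ∑' k, (a k : ℂ) * z ^ k)
      (∑' k : ℕ, (a k : ℂ) * (k * z ^ (k - 1))) z := by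
    refine hasDerivAt_tsum_of_isPreconnected (t := ball (0 : ℂ) r) hs isOpen_ball
      (convex_ball _ _).isPreconnected (fun k y _ => (hasDerivAt_pow k y).const_mul (a k : ℂ))
      (fun k y hy => ?_) (y₀ := z) (by simpa using hr)
      (summable_cpow_mul_of_le ha hz) (by simpa using hr)
    have hy' : ‖y‖ ≤ r := by simpa using (mem_ball_zero_iff.1 hy).le
    rcases k with _ | k
    · simp
    · simp only [Nat.add_sub_cancel, norm_mul, norm_pow, Complex.norm_real, Real.norm_eq_abs,
        Complex.norm_natCast]
      rw [abs_of_nonneg (by positivity : 0 ≤ ((k + 1 : ℕ) : ℝ) * |a (k + 1)| * r⁻¹)]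
      calc |a (k + 1)| * (((k + 1 : ℕ) : ℝ) * ‖y‖ ^ k)
          ≤ |a (k + 1)| * (((k + 1 : ℕ) : ℝ) * r ^ k) := by gcongr
        _ = _ := by rw [pow_succ]; field_simp
  refine key.congr_of_eventuallyEq ?_
  filter_upwards [isOpen_ball.mem_nhds (mem_ball_zero_iff.2 hz)] with y hy
  exact discSeries_apply a (mem_ball_zero_iff.1 hy)

lemma differentiableOn_discSeries (ha : ∀ k, |a k| ≤ A * ((k : ℝ) + 1) ^ q) :
    DifferentiableOn ℂ (discSeries a) (ball 0 1) := fun z hz =>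
  (hasDerivAt_discSeries ha (by simpa using hz)).differentiableAt.differentiableWithinAt

lemma mul_deriv_discSeries (ha : ∀ k, |a k| ≤ A * ((k : ℝ) + 1) ^ q) {z : ℂ} (hz : ‖z‖ < 1) :
    z * deriv (discSeries a) z = discSeries (fun k => k * a k) z := by
  rw [(hasDerivAt_discSeries ha hz).deriv, discSeries_apply _ hz, ← tsum_mul_left]
  congr 1
  funext k
  rcases k with _ | k
  · simp
  · simp only [Nat.add_sub_cancel]
    push_cast
    ring

lemma measurable_discSeries (ha : ∀ k, |a k| ≤ A * ((k : ℝ) + 1) ^ q) :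
    Measurable (discSeries a) := by
  have h : ContinuousOn (fun z : ℂ => ∑' k, (a k : ℂ) * z ^ k) (ball 0 1) :=
    (differentiableOn_discSeries ha).continuousOn.congr fun z hz =>
      (discSeries_apply a (mem_ball_zero_iff.1 hz)).symm
  unfold discSeries
  classical
  rw [← Set.piecewise_eq_indicator]
  exact h.measurable_piecewise continuousOn_const measurableSet_ball

/-- A power series whose coefficients are symbols has the expected size. -/
lemma sizeLike_discSeries {V : ℝ → ℝ} {C : ℝ} {M : ℕ} (hV : TailFn V C M)
    (ha : ∀ j, SymbolBound j (coeffWeight V q) a) (ha0 : ∀ k, 0 ≤ a k) {B : ℝ} (hB : 0 < B)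
    (ha1 : ∀ k, 1 ≤ k → coeffWeight V q k ≤ B * a k) :
    ∃ D, SizeLike (fun s => s ^ (q + 1) * V s) (discSeries a) D := by
  obtain ⟨E, hE⟩ := (ha 0).bound
  obtain ⟨A', hA'⟩ := exists_abs_le_pow hV hE
  obtain ⟨A₁, hA₁0, hA₁⟩ := norm_tsum_le hV ha
  obtain ⟨A₂, hA₂0, hA₂⟩ := le_tsum_real hV ha0 hB hE ha1 (x₀ := 1 / 256) (by norm_num)
  refine ⟨A₁ + A₂, differentiableOn_discSeries hA', fun z hz => ?_, fun x hx hx1 => ?_⟩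
  · rw [discSeries_apply a hz]
    refine (hA₁ z hz).trans ?_
    have hpos : 0 < min ‖1 - z‖ 1 := by
      refine lt_min (norm_pos_iff.2 fun h => ?_) one_pos
      rw [← sub_eq_zero.1 h] at hz
      simp at hz
    have := hV.pos _ hpos (min_le_right _ _)
    gcongr
    linarith
  · have hx0 : 0 ≤ x := by linarith
    have hxn : ‖(x : ℂ)‖ < 1 := by
      rwa [Complex.norm_real, Real.norm_eq_abs, abs_of_nonneg hx0]
    have h1 : discSeries a (x : ℂ) = ((∑' k, a k * x ^ k : ℝ) : ℂ) := by
      rw [discSeries_apply a hxn]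
      push_cast
      rfl
    have h2 : 0 ≤ ∑' k, a k * x ^ k := tsum_nonneg fun k => mul_nonneg (ha0 k) (by positivity)
    rw [h1, Complex.norm_real, Real.norm_eq_abs, abs_of_nonneg h2]
    refine (hA₂ x hx hx1).trans ?_
    gcongr
    linarith

end DiscSeries

/-! ### Averaging over circles of unitary maps -/

section Rotations

lemma inner_self_eq_one {n : ℕ} {e : Cn n} (he : ‖e‖ = 1) : inner ℂ e e = 1 := by
  simp [inner_self_eq_norm_sq_to_K, he]

lemma inner_axial_eq_zero {n : ℕ} {e : Cn n} (he : ‖e‖ = 1) (w : Cn n) :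
    inner ℂ (inner ℂ e w • e) (w - inner ℂ e w • e) = 0 := by
  rw [inner_sub_right, inner_smul_left, inner_smul_left, inner_smul_right, inner_self_eq_one he,
    mul_one, sub_self]

/-- The rotation by `u` about the complex line through `e`. -/
def axialRotation {n : ℕ} (e : Cn n) (he : ‖e‖ = 1) (u : ℂ) (hu : ‖u‖ = 1) :
    Cn n ≃ₗᵢ[ℂ] Cn n :=
  LinearIsometry.toLinearIsometryEquiv
    { toLinearMap := (innerSL ℂ e).toLinearMap.smulRight e +
        u • (LinearMap.id - (innerSL ℂ e).toLinearMap.smulRight e)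
      norm_map' := fun w => by
        have h0 := inner_axial_eq_zero he w
        have h1 := norm_add_sq_eq_norm_sq_add_norm_sq_of_inner_eq_zero (𝕜 := ℂ) _ _ h0
        have h2 := norm_add_sq_eq_norm_sq_add_norm_sq_of_inner_eq_zero (𝕜 := ℂ)
          (inner ℂ e w • e) (u • (w - inner ℂ e w • e)) (by rw [inner_smul_right, h0, mul_zero])
        rw [norm_smul u, hu, one_mul, ← h1, add_sub_cancel] at h2
        exact (mul_self_inj (norm_nonneg _) (norm_nonneg _)).1 h2 }
    rfl

/-- Pythagoras. Allowing all `|u| ≤ 1` keeps the whole disc in `u` inside the ball, which the mean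
value property requires. -/
lemma norm_axial_le {n : ℕ} {e : Cn n} (he : ‖e‖ = 1) {u : ℂ} (hu : ‖u‖ ≤ 1) (w : Cn n) :
    ‖inner ℂ e w • e + u • (w - inner ℂ e w • e)‖ ≤ ‖w‖ := by
  have h0 := inner_axial_eq_zero he w
  have h1 := norm_add_sq_eq_norm_sq_add_norm_sq_of_inner_eq_zero (𝕜 := ℂ) _ _ h0
  have h2 := norm_add_sq_eq_norm_sq_add_norm_sq_of_inner_eq_zero (𝕜 := ℂ)
    (inner ℂ e w • e) (u • (w - inner ℂ e w • e)) (by rw [inner_smul_right, h0, mul_zero])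
  rw [add_sub_cancel] at h1
  have h3 : ‖u • (w - inner ℂ e w • e)‖ ≤ ‖w - inner ℂ e w • e‖ := by
    rw [norm_smul]
    exact mul_le_of_le_one_left (norm_nonneg _) hu
  refine abs_le_of_sq_le_sq' ?_ (norm_nonneg _) |>.2
  nlinarith [norm_nonneg (u • (w - inner ℂ e w • e))]

/-- An integral is unchanged when the integrand is averaged over a circle of measure preserving
maps. -/
lemma integral_circleAverage_comp {X : Type*} [MeasurableSpace X] {μ : Measure X}
    [IsFiniteMeasure μ] {T : ℂ → X → X} (hT : Measurable fun q : ℂ × X => T q.1 q.2)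
    (hTμ : ∀ u, ‖u‖ = 1 → MeasurePreserving (T u) μ μ) {g : X → ℂ} (hg : Measurable g)
    (hgi : Integrable g μ) :
    Integrable (fun w => Real.circleAverage (fun u => g (T u w)) 0 1) μ ∧
      ∫ w, Real.circleAverage (fun u => g (T u w)) 0 1 ∂μ = ∫ w, g w ∂μ := by
  have hu : ∀ θ : ℝ, ‖circleMap 0 1 θ‖ = 1 := fun θ => by simp
  have hcomp : ∀ θ : ℝ, ∀ h : X → ℝ, Measurable h →
      ∫ w, h (T (circleMap 0 1 θ) w) ∂μ = ∫ w, h w ∂μ := fun θ h hh => by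
    have hp := hTμ _ (hu θ)
    conv_rhs => rw [← hp.map_eq]
    exact (integral_map hp.measurable.aemeasurable hh.aestronglyMeasurable).symm
  have hcomp' : ∀ θ : ℝ, ∫ w, g (T (circleMap 0 1 θ) w) ∂μ = ∫ w, g w ∂μ := fun θ => by
    have hp := hTμ _ (hu θ)
    conv_rhs => rw [← hp.map_eq]
    exact (integral_map hp.measurable.aemeasurable hg.aestronglyMeasurable).symm
  have hm : Measurable fun q : ℝ × X => g (T (circleMap 0 1 q.1) q.2) :=
    hg.comp (hT.comp (((by fun_prop : Measurable (circleMap 0 1)).comp measurable_fst).prodMk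
      measurable_snd))
  have hint : Integrable (fun q : ℝ × X => g (T (circleMap 0 1 q.1) q.2))
      ((volume.restrict (Set.Ioc 0 (2 * Real.pi))).prod μ) := by
    rw [integrable_prod_iff hm.aestronglyMeasurable]
    refine ⟨ae_of_all _ fun θ => ?_, ?_⟩
    · exact (hTμ _ (hu θ)).integrable_comp_of_integrable hgi
    · have : (fun θ : ℝ => ∫ w, ‖g (T (circleMap 0 1 θ) w)‖ ∂μ) = fun _ => ∫ w, ‖g w‖ ∂μ := by
        funext θ
        exact hcomp θ (fun w => ‖g w‖) hg.norm
      rw [this]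
      exact integrable_const _
  have hpi : (0 : ℝ) ≤ 2 * Real.pi := by positivity
  have hswap := integral_integral_swap (f := fun (θ : ℝ) (w : X) => g (T (circleMap 0 1 θ) w)) hint
  simp only [Real.circleAverage_def, intervalIntegral.integral_of_le hpi]
  refine ⟨hint.integral_prod_right.smul _, ?_⟩
  rw [integral_smul, ← hswap]
  simp only [hcomp']
  rw [setIntegral_const, ← smul_assoc, Measure.real, Real.volume_Ioc, sub_zero,
    ENNReal.toReal_ofReal hpi, smul_eq_mul, inv_mul_cancel₀ (by positivity), one_smul]

end Rotations

/-! ### Pairing with powers of a linear form -/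

section Kernel

variable {n : ℕ} {ω : ℝ → ℝ}

/-- Fourier coefficients of a holomorphic function on circles are Taylor coefficients. -/
lemma circleAverage_mul_conj_pow {g : ℂ → ℂ} (hg : DifferentiableOn ℂ g (ball 0 1)) {l : ℂ}
    (hl : ‖l‖ < 1) (k : ℕ) :
    Real.circleAverage (fun u => g (l * u) * (starRingEnd ℂ) u ^ k) 0 1 =
      l ^ k * ((k.factorial : ℂ)⁻¹ * iteratedDeriv k g 0) := by
  have hmaps : Set.MapsTo (l * ·) (closedBall (0 : ℂ) 1) (ball 0 1) := fun u hu => by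
    rw [mem_ball_zero_iff, norm_mul]
    have hu1 : ‖u‖ ≤ 1 := by simpa using hu
    nlinarith [norm_nonneg l, norm_nonneg u]
  have hG : DiffContOnCl ℂ (fun u => g (l * u)) (ball 0 1) := by
    refine DifferentiableOn.diffContOnCl ?_
    rw [closure_ball _ one_ne_zero]
    exact hg.comp (by fun_prop) hmaps
  have h1 := hG.circleIntegral_one_div_sub_center_pow_smul one_pos k
  have h2 : iteratedDeriv k (fun u => g (l * u)) 0 = l ^ k * iteratedDeriv k g 0 := by
    have h0 : (0 : ℂ) ∈ ball (0 : ℂ) 1 := mem_ball_self one_pos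
    have h3 := iteratedDerivWithin_comp_const_smul h0 isOpen_ball.uniqueDiffOn
      (hg.contDiffOn (n := k) isOpen_ball) l (hmaps.mono_left ball_subset_closedBall)
    rw [iteratedDerivWithin_of_isOpen isOpen_ball h0] at h3
    simp only [mul_zero] at h3
    rwa [iteratedDerivWithin_of_isOpen isOpen_ball h0] at h3
  have h3 : Set.EqOn (fun u => g (l * u) * (starRingEnd ℂ) u ^ k)
      (fun u => g (l * u) * (u ^ k)⁻¹) (sphere 0 |1|) := fun u hu => by
    have hu1 : ‖u‖ = 1 := by simpa using hu
    simp only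
    rw [← inv_pow, Complex.inv_def, Complex.normSq_eq_norm_sq, hu1]
    simp
  rw [Real.circleAverage_congr_sphere h3, Real.circleAverage_eq_circleIntegral one_ne_zero]
  have h4 : (fun z : ℂ => (z - 0)⁻¹ • (g (l * z) * (z ^ k)⁻¹)) =
      fun z => (1 / (z - 0) ^ (k + 1)) • g (l * z) := by
    funext z
    simp only [sub_zero, smul_eq_mul, one_div, pow_succ, mul_inv]
    ring
  rw [h4, h1, h2]
  have : (2 * Real.pi * Complex.I : ℂ) ≠ 0 := Complex.two_pi_I_ne_zero
  simp only [smul_eq_mul]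
  field_simp

lemma norm_inner_lt_one {e w : Cn n} (he : ‖e‖ = 1) (hw : w ∈ ball (0 : Cn n) 1) :
    ‖inner ℂ e w‖ < 1 := by
  refine (norm_inner_le_norm e w).trans_lt ?_
  rw [he, one_mul]
  simpa using hw

lemma differentiableOn_slice {f : Cn n → ℂ} (hf : DifferentiableOn ℂ f (ball 0 1)) {e : Cn n}
    (he : ‖e‖ = 1) : DifferentiableOn ℂ (fun l : ℂ => f (l • e)) (ball 0 1) :=
  hf.comp (by fun_prop) fun l hl => by
    rw [mem_ball_zero_iff, norm_smul, he, mul_one]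
    simpa using hl

lemma measurable_indicator_ball {f : Cn n → ℂ} (hf : DifferentiableOn ℂ f (ball 0 1)) :
    Measurable ((ball (0 : Cn n) 1).indicator f) := by
  classical
  rw [← Set.piecewise_eq_indicator]
  exact hf.continuousOn.measurable_piecewise continuousOn_const measurableSet_ball

lemma integrable_mul_conj_inner_pow {f : Cn n → ℂ} (hf : Integrable f (weightedMeasure n ω))
    {e : Cn n} (he : ‖e‖ = 1) (k : ℕ) :
    Integrable (fun w => f w * (starRingEnd ℂ) (inner ℂ e w) ^ k) (weightedMeasure n ω) := by
  refine hf.mono (hf.aestronglyMeasurable.mul ?_) ?_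
  · have : Continuous fun w : Cn n => (starRingEnd ℂ) (inner ℂ e w) ^ k :=
      (Complex.continuous_conj.comp (by fun_prop)).pow k
    exact this.aestronglyMeasurable
  · filter_upwards [ae_mem_ball_weightedMeasure n ω] with w hw
    rw [norm_mul, norm_pow, RCLike.norm_conj]
    exact mul_le_of_le_one_right (norm_nonneg _)
      (pow_le_one₀ (norm_nonneg _) (norm_inner_lt_one he hw).le)

/-- Pairing with a power of a linear form picks out a Taylor coefficient of a slice. -/
lemma integral_mul_conj_inner_pow [IsFiniteMeasure (weightedMeasure n ω)] {f : Cn n → ℂ}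
    (hf : DifferentiableOn ℂ f (ball 0 1)) (hfi : Integrable f (weightedMeasure n ω))
    {e : Cn n} (he : ‖e‖ = 1) (k : ℕ) :
    ∫ w, f w * (starRingEnd ℂ) (inner ℂ e w) ^ k ∂(weightedMeasure n ω) =
      ((∫ w, (‖inner ℂ e w‖ ^ 2) ^ k ∂(weightedMeasure n ω) : ℝ) : ℂ) *
        ((k.factorial : ℂ)⁻¹ * iteratedDeriv k (fun l : ℂ => f (l • e)) 0) := by
  -- Nothing is known about `f` outside the ball; the truncation is Borel measurable everywhere, as
  -- the averaging lemma requires.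
  set F := (ball (0 : Cn n) 1).indicator f with hF
  have hFf : ∀ w ∈ ball (0 : Cn n) 1, F w = f w := fun w hw => Set.indicator_of_mem hw f
  have hFm : Measurable F := measurable_indicator_ball hf
  have hFae : F =ᵐ[weightedMeasure n ω] f := by
    filter_upwards [ae_mem_ball_weightedMeasure n ω] with w hw using hFf w hw
  have hFi : Integrable F (weightedMeasure n ω) := hfi.congr hFae.symm
  have hconj : Measurable fun w : Cn n => (starRingEnd ℂ) (inner ℂ e w) ^ k :=
    ((Complex.continuous_conj.comp (by fun_prop)).pow k).measurable
  -- averaging over rotations about the line through `e`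
  have hax := integral_circleAverage_comp (μ := weightedMeasure n ω)
    (T := fun u w => inner ℂ e w • e + u • (w - inner ℂ e w • e)) (by fun_prop)
    (fun u hu => measurePreserving_weightedMeasure (axialRotation e he u hu) ω)
    (hFm.mul hconj) (integrable_mul_conj_inner_pow hFi he k)
  have hinner : ∀ (u : ℂ) (w : Cn n),
      inner ℂ e (inner ℂ e w • e + u • (w - inner ℂ e w • e)) = inner ℂ e w := fun u w => by
    rw [inner_add_right, inner_smul_right, inner_smul_right, inner_sub_right, inner_smul_right,
      inner_self_eq_one he]
    ring
  have hax1 : ∀ w ∈ ball (0 : Cn n) 1, Real.circleAverage (fun u : ℂ =>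
      (F * fun w => (starRingEnd ℂ) (inner ℂ e w) ^ k)
        (inner ℂ e w • e + u • (w - inner ℂ e w • e))) 0 1 =
      F (inner ℂ e w • e) * (starRingEnd ℂ) (inner ℂ e w) ^ k := by
    intro w hw
    have hmem : ∀ u : ℂ, ‖u‖ ≤ 1 →
        inner ℂ e w • e + u • (w - inner ℂ e w • e) ∈ ball (0 : Cn n) 1 := fun u hu =>
      mem_ball_zero_iff.2 ((norm_axial_le he hu w).trans_lt (mem_ball_zero_iff.1 hw))
    have hd : DiffContOnCl ℂ (fun u : ℂ => f (inner ℂ e w • e + u • (w - inner ℂ e w • e)) *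
        (starRingEnd ℂ) (inner ℂ e w) ^ k) (ball 0 |1|) := by
      refine DifferentiableOn.diffContOnCl ?_
      rw [abs_one, closure_ball _ one_ne_zero]
      refine DifferentiableOn.mul_const (hf.comp (by fun_prop) fun u hu => ?_) _
      exact hmem u (by simpa using hu)
    -- The mean value property at `u = 0` replaces `w` by its projection onto the line through `e`,
    -- without changing `⟨w, e⟩`.
    have h1 := hd.circleAverage
    have h2 := hmem 0 (by simp)
    simp only [zero_smul, add_zero] at h1 h2
    rw [hFf _ h2, ← h1]
    refine Real.circleAverage_congr_sphere fun u hu => ?_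
    simp only [Pi.mul_apply, hinner]
    rw [hFf _ (hmem u (by simpa using (mem_sphere_zero_iff_norm.1 hu).le))]
  have hax1' : (fun w => Real.circleAverage (fun u : ℂ =>
      (F * fun w => (starRingEnd ℂ) (inner ℂ e w) ^ k)
        (inner ℂ e w • e + u • (w - inner ℂ e w • e))) 0 1) =ᵐ[weightedMeasure n ω]
      fun w => F (inner ℂ e w • e) * (starRingEnd ℂ) (inner ℂ e w) ^ k := by
    filter_upwards [ae_mem_ball_weightedMeasure n ω] with w hw using hax1 w hw
  -- averaging over scalar rotations
  have hrot := integral_circleAverage_comp (μ := weightedMeasure n ω)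
    (T := fun u w => u • w) (by fun_prop)
    (fun u hu => measurePreserving_weightedMeasure (rotation n u hu) ω)
    ((hFm.comp (by fun_prop : Measurable fun w : Cn n => inner ℂ e w • e)).mul hconj)
    (hax.1.congr hax1')
  have hrot1 : ∀ w ∈ ball (0 : Cn n) 1, Real.circleAverage (fun u : ℂ =>
      ((F ∘ fun w : Cn n => inner ℂ e w • e) * fun w => (starRingEnd ℂ) (inner ℂ e w) ^ k)
        (u • w)) 0 1 = (((‖inner ℂ e w‖ ^ 2) ^ k : ℝ) : ℂ) *
        ((k.factorial : ℂ)⁻¹ * iteratedDeriv k (fun l : ℂ => f (l • e)) 0) := by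
    intro w hw
    have hl := norm_inner_lt_one he hw
    set l := inner ℂ e w with hldef
    have h1 := circleAverage_mul_conj_pow (differentiableOn_slice hf he) hl k
    have h2 : Set.EqOn (fun u : ℂ =>
        ((F ∘ fun w : Cn n => inner ℂ e w • e) * fun w => (starRingEnd ℂ) (inner ℂ e w) ^ k)
        (u • w)) (fun u => (starRingEnd ℂ) l ^ k •
          (f ((l * u) • e) * (starRingEnd ℂ) u ^ k)) (sphere 0 |1|) := fun u hu => by
      have hu1 : ‖u‖ = 1 := by simpa using hu
      have h3 : (u * l) • e ∈ ball (0 : Cn n) 1 := by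
        rw [mem_ball_zero_iff, norm_smul, norm_mul, hu1, he]
        simpa using hl
      simp only [Pi.mul_apply, Function.comp_apply, inner_smul_right, ← hldef, map_mul, mul_pow,
        smul_eq_mul]
      rw [hFf _ h3, mul_comm u l]
      ring
    rw [Real.circleAverage_congr_sphere h2, Real.circleAverage_fun_smul, h1, smul_eq_mul,
      ← mul_assoc, ← mul_pow]
    congr 2
    rw [← Complex.normSq_eq_norm_sq, ← Complex.normSq_eq_conj_mul_self]
    push_cast
    rfl
  calc ∫ w, f w * (starRingEnd ℂ) (inner ℂ e w) ^ k ∂(weightedMeasure n ω)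
      = ∫ w, F w * (starRingEnd ℂ) (inner ℂ e w) ^ k ∂(weightedMeasure n ω) := by
        refine integral_congr_ae ?_
        filter_upwards [hFae] with w hw
        rw [hw]
    _ = ∫ w, F (inner ℂ e w • e) * (starRingEnd ℂ) (inner ℂ e w) ^ k ∂(weightedMeasure n ω) := by
        rw [← integral_congr_ae hax1']
        exact hax.2.symm
    _ = ∫ w, (((‖inner ℂ e w‖ ^ 2) ^ k : ℝ) : ℂ) *
        ((k.factorial : ℂ)⁻¹ * iteratedDeriv k (fun l : ℂ => f (l • e)) 0)
          ∂(weightedMeasure n ω) := by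
        refine hrot.2.symm.trans (integral_congr_ae ?_)
        filter_upwards [ae_mem_ball_weightedMeasure n ω] with w hw using hrot1 w hw
    _ = _ := by
        rw [integral_mul_const, integral_complex_ofReal]

end Kernel

/-! ### The reproducing kernel and its radial derivative -/

section Reproducing

variable {n : ℕ} {ω : ℝ → ℝ}

lemma norm_inner_lt_one_of_norm_lt {z w : Cn n} (hz : ‖z‖ < 1) (hw : w ∈ ball (0 : Cn n) 1) :
    ‖inner ℂ z w‖ < 1 := by
  have hw1 : ‖w‖ < 1 := by simpa using hw
  refine (norm_inner_le_norm z w).trans_lt ?_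
  nlinarith [norm_nonneg z, norm_nonneg w]

lemma norm_discSeries_le {a : ℕ → ℝ} {A : ℝ} {q : ℕ} (ha : ∀ k, |a k| ≤ A * ((k : ℝ) + 1) ^ q)
    {r : ℝ} (hr0 : 0 ≤ r) (hr : r < 1) {z : ℂ} (hz : ‖z‖ ≤ r) :
    ‖discSeries a z‖ ≤ ∑' k, |a k| * r ^ k := by
  have hs : Summable fun k => |a k| * r ^ k :=
    summable_pow_mul_of_le ha hr0 hr
  rw [discSeries_apply a (hz.trans_lt hr)]
  refine tsum_of_norm_bounded hs.hasSum fun k => ?_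
  rw [norm_mul, norm_pow, Complex.norm_real, Real.norm_eq_abs]
  gcongr

lemma memBergmanTwo_discSeries [IsFiniteMeasure (weightedMeasure n ω)] {a : ℕ → ℝ} {A : ℝ} {q : ℕ}
    (ha : ∀ k, |a k| ≤ A * ((k : ℝ) + 1) ^ q) {z : Cn n} (hz : ‖z‖ < 1) :
    MemBergmanTwo ω fun w => discSeries a (inner ℂ z w) := by
  refine ⟨(differentiableOn_discSeries ha).comp (innerSL ℂ z).differentiable.differentiableOn
    fun w hw => mem_ball_zero_iff.2 (norm_inner_lt_one_of_norm_lt hz hw), ?_⟩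
  refine MemLp.of_bound ((measurable_discSeries ha).comp
    (by fun_prop : Measurable fun w : Cn n => inner ℂ z w)).aestronglyMeasurable
    (∑' k, |a k| * ‖z‖ ^ k) ?_
  filter_upwards [ae_mem_ball_weightedMeasure n ω] with w hw
  refine norm_discSeries_le ha (norm_nonneg z) hz ((norm_inner_le_norm z w).trans ?_)
  exact mul_le_of_le_one_right (norm_nonneg z) (by simpa using (mem_ball_zero_iff.1 hw).le)

/-- Integrate the conjugated series termwise against `f`. The relation `a k * m_k = 1` leaves in the
`k`-th place the Taylor term of the slice `l ↦ f (l e)` at `l = t`, and the Taylor series sums to `f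
(t e)`. -/
lemma isKernelAt_discSeries [IsFiniteMeasure (weightedMeasure n ω)] {a : ℕ → ℝ} {A : ℝ} {q : ℕ}
    (ha : ∀ k, |a k| ≤ A * ((k : ℝ) + 1) ^ q) {e : Cn n} (he : ‖e‖ = 1)
    (hae : ∀ k, a k * ∫ w, (‖inner ℂ e w‖ ^ 2) ^ k ∂(weightedMeasure n ω) = 1) {t : ℝ}
    (ht0 : 0 ≤ t) (ht1 : t < 1) :
    IsKernelAt ω ((t : ℂ) • e) fun w => discSeries a (inner ℂ ((t : ℂ) • e) w) := by
  have hz : ‖(t : ℂ) • e‖ < 1 := by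
    rwa [norm_smul, he, mul_one, Complex.norm_real, Real.norm_eq_abs, abs_of_nonneg ht0]
  refine ⟨memBergmanTwo_discSeries ha hz, fun f hf => ?_⟩
  have hfi : Integrable f (weightedMeasure n ω) := hf.2.integrable (by norm_num)
  set F : ℕ → Cn n → ℂ := fun k w =>
    ((a k * t ^ k : ℝ) : ℂ) * (f w * (starRingEnd ℂ) (inner ℂ e w) ^ k) with hF
  have hFi : ∀ k, Integrable (F k) (weightedMeasure n ω) := fun k =>
    (integrable_mul_conj_inner_pow hfi he k).const_mul _
  have hsum : Summable fun k => |a k| * t ^ k :=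
    summable_pow_mul_of_le ha ht0 ht1
  have hFs : Summable fun k => ∫ w, ‖F k w‖ ∂(weightedMeasure n ω) := by
    refine Summable.of_nonneg_of_le (fun k => integral_nonneg fun w => norm_nonneg _) (fun k => ?_)
      (hsum.mul_right (∫ w, ‖f w‖ ∂(weightedMeasure n ω)))
    rw [← integral_const_mul]
    refine integral_mono_ae (hFi k).norm (hfi.norm.const_mul _) ?_
    filter_upwards [ae_mem_ball_weightedMeasure n ω] with w hw
    simp only [hF, norm_mul, norm_pow, Complex.norm_real, Real.norm_eq_abs, RCLike.norm_conj,
      abs_of_nonneg ht0]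
    refine mul_le_mul_of_nonneg_left ?_ (by positivity)
    exact mul_le_of_le_one_right (norm_nonneg _)
      (pow_le_one₀ (norm_nonneg _) (norm_inner_lt_one he hw).le)
  have h1 := hasSum_integral_of_summable_integral_norm hFi hFs
  have h2 : ∀ k, ∫ w, F k w ∂(weightedMeasure n ω) = (k.factorial : ℂ)⁻¹ • ((t : ℂ) - 0) ^ k •
      iteratedDeriv k (fun l : ℂ => f (l • e)) 0 := fun k => by
    rw [integral_const_mul, integral_mul_conj_inner_pow hf.1 hfi he k, ← mul_assoc,
      ← Complex.ofReal_mul, mul_right_comm, hae k]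
    simp only [sub_zero, smul_eq_mul]
    push_cast
    ring
  have htn : (t : ℂ) ∈ ball (0 : ℂ) 1 := by
    rwa [mem_ball_zero_iff, Complex.norm_real, Real.norm_eq_abs, abs_of_nonneg ht0]
  have h3 := Complex.hasSum_taylorSeries_on_ball (differentiableOn_slice hf.1 he) htn
  simp only [h2] at h1
  rw [h3.unique h1]
  refine integral_congr_ae ?_
  filter_upwards [ae_mem_ball_weightedMeasure n ω] with w hw
  rw [discSeries_apply a (norm_inner_lt_one_of_norm_lt hz hw), Complex.conj_tsum, ← tsum_mul_left]
  congr 1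
  funext k
  simp only [hF, inner_smul_left, map_mul, map_pow, Complex.conj_ofReal, mul_pow]
  push_cast
  ring

lemma IsRadialWeight.weightedMeasure_pos_of_isOpen (hω : IsRadialWeight ω) {O : Set (Cn n)}
    (hO : IsOpen O) (hOb : O ⊆ ball 0 1) (hne : O.Nonempty) : weightedMeasure n ω O ≠ 0 := by
  intro h
  have hb : ballMeasure n O = 0 := by
    have hm : AEMeasurable (fun z => ENNReal.ofReal (ω ‖z‖)) (ballMeasure n) := by
      have h1 := measurable_indicator_weight hω
      refine ⟨fun z : Cn n => ENNReal.ofReal ((Set.Ico (0 : ℝ) 1).indicator ω ‖z‖), by fun_prop, ?_⟩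
      have : ∀ᵐ z ∂(ballMeasure n), z ∈ ball (0 : Cn n) 1 := by
        unfold ballMeasure ProbabilityTheory.cond
        exact Measure.ae_smul_measure (ae_restrict_mem measurableSet_ball) _
      filter_upwards [this] with z hz
      rw [Set.indicator_of_mem]
      exact ⟨norm_nonneg z, by simpa using hz⟩
    unfold weightedMeasure at h
    rw [withDensity_apply_eq_zero' hm] at h
    have hsub : O ⊆ {z : Cn n | ENNReal.ofReal (ω ‖z‖) ≠ 0} ∩ O := fun z hz => by
      have hzn : ‖z‖ < 1 := by simpa using hOb hz
      exact ⟨(ENNReal.ofReal_pos.2 (hω.pos _ ⟨norm_nonneg z, hzn⟩)).ne', hz⟩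
    exact measure_mono_null hsub h
  rw [ballMeasure, ProbabilityTheory.cond_apply measurableSet_ball,
    Set.inter_eq_self_of_subset_right hOb, mul_eq_zero] at hb
  rcases hb with hb | hb
  · exact volume_ball_ne_top n (ENNReal.inv_eq_zero.1 hb)
  · exact (hO.measure_pos volume hne).ne' hb

/-- The reproducing kernel is determined on the ball. -/
lemma IsKernelAt.eqOn (hω : IsRadialWeight ω) {z : Cn n} {B₁ B₂ : Cn n → ℂ}
    (h₁ : IsKernelAt ω z B₁) (h₂ : IsKernelAt ω z B₂) : Set.EqOn B₁ B₂ (ball 0 1) := by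
  set D : Cn n → ℂ := fun w => B₁ w - B₂ w with hD
  have hDd : DifferentiableOn ℂ D (ball 0 1) := h₁.1.1.sub h₂.1.1
  have hDm : MemBergmanTwo ω D := ⟨hDd, h₁.1.2.sub h₂.1.2⟩
  have hint : ∀ B : Cn n → ℂ, MemLp B 2 (weightedMeasure n ω) →
      Integrable (fun w => D w * (starRingEnd ℂ) (B w)) (weightedMeasure n ω) := fun B hB =>
    hDm.2.integrable_mul hB.star
  have h0 : ∫ w, D w * (starRingEnd ℂ) (D w) ∂(weightedMeasure n ω) = 0 := by
    have h3 := h₁.2 D hDm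
    have h4 := h₂.2 D hDm
    have h5 : ∀ w, D w * (starRingEnd ℂ) (D w) =
        D w * (starRingEnd ℂ) (B₁ w) - D w * (starRingEnd ℂ) (B₂ w) := fun w => by
      rw [← mul_sub, ← map_sub]
    simp only [h5]
    rw [integral_sub (hint _ h₁.1.2) (hint _ h₂.1.2), ← h3, ← h4, sub_self]
  -- The difference of two kernels is orthogonal to itself, so it vanishes almost everywhere;
  -- continuity and positivity of the weight on open sets give vanishing at every point of the ball.
  have h5 : ∀ w, D w * (starRingEnd ℂ) (D w) = ((‖D w‖ ^ 2 : ℝ) : ℂ) := fun w => by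
    rw [Complex.mul_conj, Complex.normSq_eq_norm_sq]
  have h6 : ∫ w, ‖D w‖ ^ 2 ∂(weightedMeasure n ω) = 0 := by
    simp only [h5] at h0
    rw [integral_complex_ofReal] at h0
    exact_mod_cast h0
  rw [integral_eq_zero_iff_of_nonneg (fun w => by positivity) (hDm.2.integrable_norm_pow two_ne_zero)]
    at h6
  intro w hw
  by_contra hne
  have hO : IsOpen (ball (0 : Cn n) 1 ∩ D ⁻¹' {0}ᶜ) :=
    hDd.continuousOn.isOpen_inter_preimage isOpen_ball isOpen_compl_singleton
  refine hω.weightedMeasure_pos_of_isOpen hO Set.inter_subset_left ⟨w, hw, ?_⟩ ?_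
  · exact sub_ne_zero.2 hne
  · refine measure_mono_null (fun x hx => ?_) (ae_iff.1 h6)
    have h7 : D x ≠ 0 := hx.2
    simpa using h7

lemma bergmanKernel_eqOn (hω : IsRadialWeight ω) {z : Cn n} {B : Cn n → ℂ}
    (h : IsKernelAt ω z B) : Set.EqOn (bergmanKernel ω z) B (ball 0 1) := by
  have hex : ∃ B : Cn n → ℂ, IsKernelAt ω z B := ⟨B, h⟩
  have : bergmanKernel ω z = hex.choose := dif_pos hex
  rw [this]
  exact hex.choose_spec.eqOn hω h

lemma radialDeriv_eq_fderiv (f : Cn n → ℂ) (w : Cn n) : radialDeriv f w = fderiv ℂ f w w := by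
  have h : w = ∑ k : Fin n, w k • EuclideanSpace.single k (1 : ℂ) := by
    simpa using ((EuclideanSpace.basisFun (Fin n) ℂ).sum_repr w).symm
  have h1 : ∀ L : Cn n →L[ℂ] ℂ, L w = ∑ k, w k * L (EuclideanSpace.single k 1) := fun L => by
    conv_lhs => rw [h, map_sum]
    simp only [map_smul, smul_eq_mul]
  exact (h1 _).symm

/-- By the chain rule, on functions of `λ = ⟨w, z⟩` the radial derivative acts as `λ d/dλ`, which
multiplies the `k`-th coefficient by `k`. -/
lemma radialDeriv_eqOn {a : ℕ → ℝ} {A : ℝ} {q : ℕ} (ha : ∀ k, |a k| ≤ A * ((k : ℝ) + 1) ^ q)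
    {z : Cn n} (hz : ‖z‖ < 1) {B : Cn n → ℂ}
    (hB : Set.EqOn B (fun w => discSeries a (inner ℂ z w)) (ball 0 1)) :
    Set.EqOn (radialDeriv B) (fun w => discSeries (fun k => k * a k) (inner ℂ z w))
      (ball 0 1) := by
  intro w hw
  have hzw := norm_inner_lt_one_of_norm_lt hz hw
  rw [radialDeriv_eq_fderiv, (hB.eventuallyEq_of_mem (isOpen_ball.mem_nhds hw)).fderiv_eq]
  have h1 := (differentiableOn_discSeries ha).differentiableAt
    (isOpen_ball.mem_nhds (mem_ball_zero_iff.2 hzw))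
  have h2 := h1.hasDerivAt.comp_hasFDerivAt (x := w) (f := innerSL ℂ z) (innerSL ℂ z).hasFDerivAt
  have h3 : fderiv ℂ (fun w => discSeries a (inner ℂ z w)) w = _ := h2.fderiv
  rw [h3]
  simp only [_root_.smul_apply, innerSL_apply_apply, smul_eq_mul]
  rw [mul_comm]
  exact mul_deriv_discSeries ha hzw

end Reproducing

/-! ### Identification of the integrals -/

section Assembly

variable {n : ℕ} {ω υ : ℝ → ℝ}

/-- The reciprocal size of the kernel (`q = 0`) and of its radial derivative (`q = 1`). -/
def kernelSize (n : ℕ) (ω : ℝ → ℝ) (q : ℕ) (s : ℝ) : ℝ := s ^ (q + 1) * tubeSize n ω s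

lemma IsDoubling.tailFn_kernelSize (hω : IsDoubling ω) (n q : ℕ) :
    ∃ C M, TailFn (kernelSize n ω q) C M := by
  obtain ⟨C, M, h⟩ := hω.tailFn_tubeSize n
  exact ⟨_, _, (TailFn.pow (q + 1)).mul h⟩

lemma IsRadialWeight.measurable_kernelSize (hω : IsRadialWeight ω) (n q : ℕ) :
    Measurable (kernelSize n ω q) := by
  have := hω.measurable_tubeSize n
  unfold kernelSize
  fun_prop

lemma exists_eq_norm_smul (hn : 1 ≤ n) (z : Cn n) :
    ∃ e : Cn n, ‖e‖ = 1 ∧ z = ((‖z‖ : ℝ) : ℂ) • e := by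
  rcases eq_or_ne z 0 with rfl | h
  · obtain ⟨e, he⟩ := exists_norm_eq_one hn
    exact ⟨e, he, by simp⟩
  · refine ⟨((‖z‖⁻¹ : ℝ) : ℂ) • z, ?_, ?_⟩
    · rw [norm_smul, Complex.norm_real, norm_inv, norm_norm,
        inv_mul_cancel₀ (norm_ne_zero_iff.2 h)]
    · rw [smul_smul, ← Complex.ofReal_mul, mul_inv_cancel₀ (norm_ne_zero_iff.2 h),
        Complex.ofReal_one, one_smul]

/-- The kernel and its radial derivative are functions of `⟨w, z⟩` of known size. -/
lemma exists_kernel_profile (hn : 1 ≤ n) (hω : IsDoubling ω) :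
    ∃ F₀ F₁ : ℂ → ℂ, Measurable F₀ ∧ Measurable F₁ ∧
      (∃ A, SizeLike (kernelSize n ω 0) F₀ A) ∧ (∃ A, SizeLike (kernelSize n ω 1) F₁ A) ∧
      ∀ z : Cn n, ‖z‖ < 1 →
        Set.EqOn (bergmanKernel ω z) (fun w => F₀ (inner ℂ z w)) (ball 0 1) ∧
        Set.EqOn (radialDeriv (bergmanKernel ω z)) (fun w => F₁ (inner ℂ z w)) (ball 0 1) := by
  obtain ⟨a, ha0, hae, has, B, hB0, hB⟩ := exists_kernelCoeff hn hω
  obtain ⟨C, M, hV⟩ := hω.tailFn_tubeSize n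
  have := isFiniteMeasure_weightedMeasure hn hω.toIsRadialWeight
  have hC := hV.one_le
  obtain ⟨E, hE⟩ := (has 0).bound
  obtain ⟨A, hA⟩ := exists_abs_le_pow hV hE
  have hw1 : ∀ k, (fun k : ℕ => ((k : ℝ) + 1) * coeffWeight (tubeSize n ω) 0 k) k =
      coeffWeight (tubeSize n ω) 1 k := fun k => by simp [coeffWeight]
  -- Multiplication by the symbol `k` of order one raises the weight from `q = 0` to `q = 1`.
  have has1 : ∀ j, SymbolBound j (coeffWeight (tubeSize n ω) 1) fun k => k * a k := fun j => by
    have h := (SymbolBound.natCast j).mul (has j) (fun k => by positivity)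
      (fun k => (coeffWeight_pos hV k).le) 2 fun k => by
        push_cast
        linarith [(Nat.cast_nonneg k : (0 : ℝ) ≤ k)]
    rwa [funext hw1] at h
  obtain ⟨E₁, hE₁⟩ := (has1 0).bound
  obtain ⟨A₁, hA₁⟩ := exists_abs_le_pow hV hE₁
  refine ⟨discSeries a, discSeries fun k => k * a k, measurable_discSeries hA,
    measurable_discSeries hA₁, sizeLike_discSeries hV has (fun k => (ha0 k).le) hB0 fun k _ => hB k,
    sizeLike_discSeries hV has1 (fun k => mul_nonneg (Nat.cast_nonneg k) (ha0 k).le)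
      (B := 2 * B) (by positivity) fun k hk => ?_, fun z hz => ?_⟩
  · rw [← hw1]
    have hk1 : (1 : ℝ) ≤ k := by exact_mod_cast hk
    calc ((k : ℝ) + 1) * coeffWeight (tubeSize n ω) 0 k ≤ (2 * k) * (B * a k) := by
          refine mul_le_mul (by linarith) (hB k) (coeffWeight_pos hV k).le (by positivity)
      _ = _ := by ring
  · obtain ⟨e, he, hze⟩ := exists_eq_norm_smul hn z
    have hker := isKernelAt_discSeries hA he (fun k => hae e k he) (norm_nonneg z) hz
    rw [← hze] at hker
    have h1 := bergmanKernel_eqOn hω.toIsRadialWeight hker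
    exact ⟨h1, radialDeriv_eqOn hA hz h1⟩

lemma eLpNorm_ofReal_rpow {X : Type*} [MeasurableSpace X] {μ : Measure X} {f : X → ℂ} {p : ℝ}
    (hp : 0 < p) : eLpNorm f (ENNReal.ofReal p) μ ^ p = ∫⁻ x, ‖f x‖ₑ ^ p ∂μ := by
  rw [eLpNorm_eq_lintegral_rpow_enorm_toReal (by simpa using hp) ENNReal.ofReal_ne_top,
    ENNReal.toReal_ofReal hp.le, ← ENNReal.rpow_mul, one_div, inv_mul_cancel₀ hp.ne',
    ENNReal.rpow_one]

/-- Bookkeeping of exponents: `U(s) = s^(n+q) ω̂(1 - s)`, so `s^(n-1) U(s)^(-p)` is the integrand of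
the theorem at `t = 1 - s`. -/
lemma meanDensity_kernelSize (hn : 1 ≤ n) (hω : IsRadialWeight ω) (q : ℕ) (p : ℝ) {s : ℝ}
    (hs : 0 < s) (hs1 : s ≤ 1) :
    meanDensity n (kernelSize n ω q) p s =
      1 / (tailFun ω s ^ p * s ^ (((n : ℝ) + q) * p - n + 1)) := by
  have hW := hω.tailFun_pos hs hs1
  have h1 : kernelSize n ω q s = s ^ (n + q) * tailFun ω s := by
    unfold kernelSize tubeSize
    rw [← mul_assoc, ← pow_add]
    congr 2
    omega
  have h2 : s ^ (n - 1) = s ^ ((n : ℝ) - 1) := by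
    rw [← Real.rpow_natCast, Nat.cast_sub hn, Nat.cast_one]
  have h3 : (s ^ (n + q)) ^ p = s ^ (((n : ℝ) + q) * p) := by
    rw [← Real.rpow_natCast, ← Real.rpow_mul hs.le]
    push_cast
    rfl
  unfold meanDensity
  rw [h1, h2, Real.div_rpow zero_le_one (by positivity), Real.one_rpow,
    Real.mul_rpow (by positivity) hW.le, h3,
    show ((n : ℝ) + q) * p - n + 1 = ((n : ℝ) + q) * p - (n - 1) by ring, Real.rpow_sub hs (_ * p)]
  have := Real.rpow_pos_of_pos hW p
  have := Real.rpow_pos_of_pos hs ((n : ℝ) - 1)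
  have := Real.rpow_pos_of_pos hs (((n : ℝ) + q) * p)
  generalize tailFun ω s ^ p = a, s ^ ((n : ℝ) - 1) = b, s ^ (((n : ℝ) + q) * p) = c at *
  field_simp

/-- Change of variables `s = 1 - t`. -/
lemma ofReal_intervalIntegral_eq_lintegral {g h : ℝ → ℝ} {ρ K : ℝ} (hρ0 : 0 ≤ ρ)
    (hh : Measurable h) (h0 : ∀ s ∈ Set.Ioc (1 - ρ) 1, 0 ≤ h s)
    (hK : ∀ s ∈ Set.Ioc (1 - ρ) 1, h s ≤ K) (hgh : ∀ t ∈ Set.Ico 0 ρ, g t = h (1 - t)) :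
    ENNReal.ofReal (∫ t in (0 : ℝ)..ρ, g t) = ∫⁻ s in Set.Ioc (1 - ρ) 1, ENNReal.ofReal (h s) := by
  have h1 : ∫ t in (0 : ℝ)..ρ, g t = ∫ t in (0 : ℝ)..ρ, h (1 - t) := by
    rw [intervalIntegral.integral_of_le hρ0, intervalIntegral.integral_of_le hρ0,
      integral_Ioc_eq_integral_Ioo, integral_Ioc_eq_integral_Ioo]
    exact setIntegral_congr_fun measurableSet_Ioo fun t ht => hgh t ⟨ht.1.le, ht.2⟩
  rw [h1, intervalIntegral.integral_comp_sub_left (fun s => h s) 1, sub_zero,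
    intervalIntegral.integral_of_le (by linarith), ofReal_integral_eq_lintegral_ofReal]
  · refine Measure.integrableOn_of_bounded (M := K) (by simp) hh.aestronglyMeasurable ?_
    filter_upwards [ae_restrict_mem measurableSet_Ioc] with s hs
    rw [Real.norm_eq_abs, abs_of_nonneg (h0 s hs)]
    exact hK s hs
  · filter_upwards [ae_restrict_mem measurableSet_Ioc] with s hs using h0 s hs

lemma meanDensity_nonneg {U : ℝ → ℝ} {C : ℝ} {M : ℕ} (hU : TailFn U C M) (p : ℝ) {s : ℝ}
    (hs : 0 < s) (hs1 : s ≤ 1) : 0 ≤ meanDensity n U p s := by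
  have := hU.pos s hs hs1
  unfold meanDensity
  positivity

lemma meanDensity_le {U : ℝ → ℝ} {C : ℝ} {M : ℕ} (hU : TailFn U C M) {p : ℝ} (hp : 0 < p)
    {a s b : ℝ} (ha : 0 < a) (has : a ≤ s) (hsb : s ≤ b) (hb1 : b ≤ 1) :
    meanDensity n U p s ≤ b ^ (n - 1) * (1 / U a) ^ p := by
  have h1 := hU.pos a ha (has.trans (hsb.trans hb1))
  have h2 := hU.mono s a ha has (hsb.trans hb1)
  have h3 : 0 < s := ha.trans_le has
  have h4 := hU.pos s h3 (hsb.trans hb1)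
  have h5 : 0 ≤ b := h3.le.trans hsb
  unfold meanDensity
  gcongr

lemma le_meanDensity {U : ℝ → ℝ} {C : ℝ} {M : ℕ} (hU : TailFn U C M) {p : ℝ} (hp : 0 < p)
    {a s b : ℝ} (ha : 0 < a) (has : a ≤ s) (hsb : s ≤ b) (hb1 : b ≤ 1) :
    a ^ (n - 1) * (1 / U b) ^ p ≤ meanDensity n U p s := by
  have h0 : 0 < s := ha.trans_le has
  have h1 := hU.pos s h0 (hsb.trans hb1)
  have h2 := hU.mono b s h0 hsb hb1
  have h3 := hU.pos b (h0.trans_le hsb) hb1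
  unfold meanDensity
  gcongr

/-- Exchange of the radial integrals. -/
lemma lintegral_mul_lintegral_Ioc {u h : ℝ → ℝ≥0∞} (hu : Measurable u) (hh : Measurable h)
    {c R : ℝ} (hR : 0 < R) :
    (∫⁻ r in Set.Ioo c 1, u r * ∫⁻ s in Set.Ioc (1 - r * R) 1, h s) =
      ∫⁻ s in Set.Ioc (1 - R) 1, h s * ∫⁻ r in Set.Ioo (max c ((1 - s) / R)) 1, u r := by
  have h1 : ∀ r ∈ Set.Ioo c 1, u r * ∫⁻ s in Set.Ioc (1 - r * R) 1, h s =
      ∫⁻ s in Set.Ioc (1 - R) 1, u r * (Set.Ioi (1 - r * R)).indicator h s := fun r hr => by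
    rw [lintegral_const_mul _ (hh.indicator measurableSet_Ioi),
      setLIntegral_indicator measurableSet_Ioi]
    congr 3
    ext s
    simp only [Set.mem_Ioc, Set.mem_inter_iff, Set.mem_Ioi]
    constructor
    · rintro ⟨h1, h2⟩
      exact ⟨h1, by nlinarith [hr.2], h2⟩
    · rintro ⟨h1, _, h2⟩
      exact ⟨h1, h2⟩
  have hS : MeasurableSet {x : ℝ × ℝ | 1 - x.1 * R < x.2} :=
    measurableSet_lt (by fun_prop) (by fun_prop)
  have hm : Measurable fun x : ℝ × ℝ => u x.1 * (Set.Ioi (1 - x.1 * R)).indicator h x.2 :=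
    (hu.comp measurable_fst).mul ((hh.comp measurable_snd).indicator hS)
  rw [setLIntegral_congr_fun measurableSet_Ioo h1, lintegral_lintegral_swap hm.aemeasurable]
  congr 1
  funext s
  have h2 : ∀ r, u r * (Set.Ioi (1 - r * R)).indicator h s =
      (Set.Ioi ((1 - s) / R)).indicator (fun r => h s * u r) r := fun r => by
    have : s ∈ Set.Ioi (1 - r * R) ↔ r ∈ Set.Ioi ((1 - s) / R) := by
      rw [Set.mem_Ioi, Set.mem_Ioi, div_lt_iff₀ hR]
      constructor <;> intro <;> linarith
    by_cases hr : r ∈ Set.Ioi ((1 - s) / R)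
    · rw [Set.indicator_of_mem hr, Set.indicator_of_mem (this.2 hr), mul_comm]
    · rw [Set.indicator_of_notMem hr, Set.indicator_of_notMem fun h => hr (this.1 h), mul_zero]
  simp only [h2]
  rw [setLIntegral_indicator measurableSet_Ioi, lintegral_const_mul _ hu]
  congr 3
  ext r
  simp only [Set.mem_Ioo, Set.mem_inter_iff, Set.mem_Ioi, max_lt_iff]
  tauto

end Assembly

/-! ### Integral means of the kernel -/

section Norms

variable {n : ℕ} {ω υ : ℝ → ℝ} {p A : ℝ} {q : ℕ} {F : ℂ → ℂ}

/-- The integral of `|F|^p` over the image of a sphere under a linear form. -/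
def profileMean (p : ℝ) (F : ℂ → ℂ) (e : Cn n) (ρ : ℝ) : ℝ≥0∞ :=
  ∫⁻ ξ : sphere (0 : Cn n) 1, ‖F (ρ * inner ℂ e (ξ : Cn n))‖ₑ ^ p ∂(sphereMeasure n)

lemma inner_profile (r t : ℝ) (e ξ : Cn n) :
    inner ℂ ((t : ℂ) • e) ((r : ℂ) • ξ) = ((r * t : ℝ) : ℂ) * inner ℂ e ξ := by
  rw [inner_smul_left, inner_smul_right, Complex.conj_ofReal]
  push_cast
  ring

lemma smul_mem_ball {r : ℝ} (hr : 0 ≤ r) (hr1 : r < 1) (ξ : sphere (0 : Cn n) 1) :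
    (r : ℂ) • (ξ : Cn n) ∈ ball (0 : Cn n) 1 := by
  rw [mem_ball_zero_iff, norm_smul, Complex.norm_real, Real.norm_eq_abs, abs_of_nonneg hr]
  simpa using hr1

lemma integralMean_rpow_eq (hp : 0 < p) {f : Cn n → ℂ} {t : ℝ} {e : Cn n}
    (hf : Set.EqOn f (fun w => F (inner ℂ ((t : ℂ) • e) w)) (ball 0 1)) {r : ℝ} (hr : 0 ≤ r)
    (hr1 : r < 1) : integralMean p r f ^ p = profileMean p F e (r * t) := by
  unfold integralMean profileMean
  rw [eLpNorm_ofReal_rpow hp]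
  refine lintegral_congr fun ξ => ?_
  rw [hf (smul_mem_ball hr hr1 ξ)]
  simp only [inner_profile]

lemma bergmanNorm_rpow_eq (hn : 1 ≤ n) (hυ : IsRadialWeight υ) (hp : 0 < p) (hF : Measurable F)
    {f : Cn n → ℂ} {t : ℝ} {e : Cn n}
    (hf : Set.EqOn f (fun w => F (inner ℂ ((t : ℂ) • e) w)) (ball 0 1)) :
    bergmanNorm p υ f ^ p = 2 * n * ∫⁻ r in Set.Ioo (0 : ℝ) 1,
      ENNReal.ofReal (υ r) * ENNReal.ofReal (r ^ (2 * n - 1)) * profileMean p F e (r * t) := by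
  unfold bergmanNorm
  rw [eLpNorm_ofReal_rpow hp]
  have h1 : ∫⁻ w, ‖f w‖ₑ ^ p ∂(weightedMeasure n υ) =
      ∫⁻ w, ‖F (inner ℂ ((t : ℂ) • e) w)‖ₑ ^ p ∂(weightedMeasure n υ) := by
    refine lintegral_congr_ae ?_
    filter_upwards [ae_mem_ball_weightedMeasure n υ] with w hw
    rw [hf hw]
  have hm : Measurable fun w : Cn n => ‖F (inner ℂ ((t : ℂ) • e) w)‖ₑ ^ p :=
    (hF.comp (by fun_prop : Measurable fun w : Cn n => inner ℂ ((t : ℂ) • e) w)).enorm.pow_const p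
  rw [h1, lintegral_weightedMeasure hn hυ hm]
  simp only [inner_profile, profileMean]

lemma exists_comparable {X : Type*} {P : X → Prop} {f g : X → ℝ≥0∞}
    (h₁ : ∃ K : ℝ≥0, ∀ x, P x → f x ≤ K * g x) (h₂ : ∃ K : ℝ≥0, ∀ x, P x → g x ≤ K * f x) :
    ∃ C : ℝ≥0, 0 < C ∧ ∀ x, P x → Comparable C (f x) (g x) := by
  obtain ⟨K₁, h₁⟩ := h₁
  obtain ⟨K₂, h₂⟩ := h₂
  refine ⟨K₁ + K₂ + 1, by positivity, fun x hx => ⟨(h₁ x hx).trans ?_, (h₂ x hx).trans ?_⟩⟩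
  · gcongr
    rw [add_assoc]
    exact le_self_add
  · gcongr
    rw [add_comm K₁, add_assoc]
    exact le_self_add

lemma ofReal_integral_kernelSize (hn : 1 ≤ n) (hω : IsDoubling ω) (hp : 0 < p) (q : ℕ) {ρ : ℝ}
    (hρ0 : 0 ≤ ρ) (hρ1 : ρ < 1) :
    ENNReal.ofReal (∫ t in (0 : ℝ)..ρ,
      1 / (hat ω t ^ p * (1 - t) ^ (((n : ℝ) + q) * p - n + 1))) =
      ∫⁻ s in Set.Ioc (1 - ρ) 1, ENNReal.ofReal (meanDensity n (kernelSize n ω q) p s) := by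
  obtain ⟨C, M, hU⟩ := hω.tailFn_kernelSize n q
  have h0 : 0 < 1 - ρ := by linarith
  refine ofReal_intervalIntegral_eq_lintegral hρ0
    (measurable_meanDensity n (hω.measurable_kernelSize n q) p)
    (fun s hs => meanDensity_nonneg hU p (h0.trans hs.1) hs.2)
    (fun s hs => meanDensity_le hU hp h0 hs.1.le hs.2 le_rfl) fun t ht => ?_
  rw [meanDensity_kernelSize hn hω.toIsRadialWeight q p (by linarith [ht.2]) (by linarith [ht.1]),
    ← hat_eq_tailFun (by linarith [ht.2]) (by linarith [ht.1]), sub_sub_cancel]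

lemma ofReal_integral_mul_kernelSize (hn : 1 ≤ n) (hω : IsDoubling ω) (hυ : IsRadialWeight υ)
    (hp : 0 < p) (q : ℕ) {ρ : ℝ} (hρ0 : 0 ≤ ρ) (hρ1 : ρ < 1) :
    ENNReal.ofReal (∫ t in (0 : ℝ)..ρ,
      hat υ t / (hat ω t ^ p * (1 - t) ^ (((n : ℝ) + q) * p - n + 1))) =
      ∫⁻ s in Set.Ioc (1 - ρ) 1,
        ENNReal.ofReal (tailFun υ s * meanDensity n (kernelSize n ω q) p s) := by
  obtain ⟨C, M, hU⟩ := hω.tailFn_kernelSize n q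
  have h0 : 0 < 1 - ρ := by linarith
  have hd : ∀ s ∈ Set.Ioc (1 - ρ) 1, 0 ≤ meanDensity n (kernelSize n ω q) p s := fun s hs =>
    meanDensity_nonneg hU p (h0.trans hs.1) hs.2
  have hN : ∀ s ∈ Set.Ioc (1 - ρ) 1, 0 ≤ tailFun υ s := fun s hs =>
    (hυ.tailFun_pos (h0.trans hs.1) hs.2).le
  refine ofReal_intervalIntegral_eq_lintegral hρ0
    (hυ.monotone_tailFun.measurable.mul (measurable_meanDensity n (hω.measurable_kernelSize n q) p))
    (fun s hs => mul_nonneg (hN s hs) (hd s hs))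
    (fun s hs => mul_le_mul (hυ.monotone_tailFun hs.2)
      (meanDensity_le hU hp h0 hs.1.le hs.2 le_rfl) (hd s hs)
      (hυ.tailFun_pos one_pos le_rfl).le) fun t ht => ?_
  rw [meanDensity_kernelSize hn hω.toIsRadialWeight q p (by linarith [ht.2]) (by linarith [ht.1]),
    ← hat_eq_tailFun (by linarith [ht.2]) (by linarith [ht.1]),
    ← hat_eq_tailFun (by linarith [ht.2]) (by linarith [ht.1]), sub_sub_cancel, mul_one_div]

lemma comparable_integralMean (hn : 1 ≤ n) (hω : IsDoubling ω) (hp : 0 < p) (hFm : Measurable F)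
    (hF : SizeLike (kernelSize n ω q) F A) {f : Cn n → Cn n → ℂ}
    (hf : ∀ z, ‖z‖ < 1 → Set.EqOn (f z) (fun w => F (inner ℂ z w)) (ball 0 1)) :
    ∃ C : ℝ≥0, 0 < C ∧ ∀ (r : ℝ) (z : Cn n), 0 < r → r < 1 → ‖z‖ < 1 → 1 / 4 < r * ‖z‖ →
      Comparable C (integralMean p r (f z) ^ p) (ENNReal.ofReal (∫ t in (0 : ℝ)..(r * ‖z‖),
        1 / (hat ω t ^ p * (1 - t) ^ (((n : ℝ) + q) * p - n + 1)))) := by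
  obtain ⟨C, M, hU⟩ := hω.tailFn_kernelSize n q
  have hUm := hω.measurable_kernelSize n q
  obtain ⟨K₁, hK₁⟩ := hF.lintegral_sphere_le hn hU hUm hp
  obtain ⟨K₂, hK₂⟩ := hF.le_lintegral_sphere hn hU hFm hp
  have key : ∀ (r : ℝ) (z : Cn n), 0 < r → r < 1 → ‖z‖ < 1 → ∃ e : Cn n, ‖e‖ = 1 ∧
      integralMean p r (f z) ^ p = profileMean p F e (r * ‖z‖) := fun r z hr0 hr1 hz => by
    obtain ⟨e, he, hze⟩ := exists_eq_norm_smul hn z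
    refine ⟨e, he, integralMean_rpow_eq hp ?_ hr0.le hr1⟩
    rw [← hze]
    exact hf z hz
  have hρ1 : ∀ (r : ℝ) (z : Cn n), 0 < r → r < 1 → ‖z‖ < 1 → r * ‖z‖ < 1 :=
    fun r z h0 h1 h2 => mul_lt_one_of_nonneg_of_lt_one_left h0.le h1 h2.le
  have hup : ∃ K : ℝ≥0, ∀ x : ℝ × Cn n, 0 < x.1 ∧ x.1 < 1 ∧ ‖x.2‖ < 1 ∧ 1 / 4 < x.1 * ‖x.2‖ →
      integralMean p x.1 (f x.2) ^ p ≤ K * ENNReal.ofReal (∫ t in (0 : ℝ)..(x.1 * ‖x.2‖),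
        1 / (hat ω t ^ p * (1 - t) ^ (((n : ℝ) + q) * p - n + 1))) := by
    refine ⟨K₁, fun ⟨r, z⟩ ⟨h0, h1, h2, h3⟩ => ?_⟩
    obtain ⟨e, he, hez⟩ := key r z h0 h1 h2
    have h4 := hρ1 r z h0 h1 h2
    simp only
    rw [hez, ofReal_integral_kernelSize hn hω hp q (by positivity) h4]
    exact hK₁ e _ he h3 h4
  have hlo : ∃ K : ℝ≥0, ∀ x : ℝ × Cn n, 0 < x.1 ∧ x.1 < 1 ∧ ‖x.2‖ < 1 ∧ 1 / 4 < x.1 * ‖x.2‖ →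
      ENNReal.ofReal (∫ t in (0 : ℝ)..(x.1 * ‖x.2‖),
        1 / (hat ω t ^ p * (1 - t) ^ (((n : ℝ) + q) * p - n + 1))) ≤
      K * integralMean p x.1 (f x.2) ^ p := by
    refine ⟨K₂, fun ⟨r, z⟩ ⟨h0, h1, h2, h3⟩ => ?_⟩
    obtain ⟨e, he, hez⟩ := key r z h0 h1 h2
    have h4 := hρ1 r z h0 h1 h2
    simp only
    rw [hez, ofReal_integral_kernelSize hn hω hp q (by positivity) h4]
    exact hK₂ e _ he h3 h4
  obtain ⟨C, hC0, hC⟩ := exists_comparable hup hlo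
  exact ⟨C, hC0, fun r z h0 h1 h2 h3 => hC (r, z) ⟨h0, h1, h2, h3⟩⟩

/-- Covers the radii `r |z| ≤ 1 / 4`, which the estimates of means leave out but the integral over
the ball contains. -/
lemma profileMean_le_of_small (hn : 1 ≤ n) {U : ℝ → ℝ} {C : ℝ} {M : ℕ} (hU : TailFn U C M)
    (hF : SizeLike U F A) (hp : 0 < p) {e : Cn n} (he : ‖e‖ = 1) {ρ : ℝ} (hρ0 : 0 ≤ ρ)
    (hρ1 : ρ ≤ 1 / 4) :
    profileMean p F e ρ ≤ ENNReal.ofReal ((A / U (3 / 4)) ^ p) := by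
  have := isProbabilityMeasure_sphereMeasure hn
  have hA := hF.pos hU
  unfold profileMean
  calc ∫⁻ ξ : sphere (0 : Cn n) 1, ‖F (ρ * inner ℂ e (ξ : Cn n))‖ₑ ^ p ∂(sphereMeasure n)
      ≤ ∫⁻ _ : sphere (0 : Cn n) 1, ENNReal.ofReal ((A / U (3 / 4)) ^ p) ∂(sphereMeasure n) := by
        refine lintegral_mono fun ξ => ?_
        have h1 := norm_inner_le_one he ξ
        have h2 : ‖(ρ : ℂ) * inner ℂ e (ξ : Cn n)‖ ≤ 1 / 4 := by
          rw [norm_real_mul hρ0]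
          exact (mul_le_of_le_one_right hρ0 h1).trans hρ1
        have h3 : 3 / 4 ≤ min ‖1 - (ρ : ℂ) * inner ℂ e (ξ : Cn n)‖ 1 := by
          refine le_min ?_ (by norm_num)
          linarith [one_sub_le_norm hρ0 h1]
        have h4 := hU.pos (3 / 4) (by norm_num) (by norm_num)
        have h5 := hU.mono _ _ (by norm_num) h3 (min_le_right _ _)
        have h6 : ‖F (ρ * inner ℂ e (ξ : Cn n))‖ ≤ A / U (3 / 4) :=
          (hF.le _ (h2.trans_lt (by norm_num))).trans (by gcongr)
        rw [← ofReal_norm, ENNReal.ofReal_rpow_of_nonneg (norm_nonneg _) hp.le]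
        exact ENNReal.ofReal_le_ofReal (Real.rpow_le_rpow (norm_nonneg _) h6 hp.le)
    _ = _ := by rw [lintegral_const, measure_univ, mul_one]

end Norms

/-! ### Weighted norms of the kernel -/

section BergmanNorm

variable {n : ℕ} {ω υ : ℝ → ℝ} {p A C : ℝ} {M q : ℕ} {F : ℂ → ℂ} {U : ℝ → ℝ}

/-- Gives a positive quantity, independent of `z`, against which the bounded contribution of small
radii is absorbed. -/
lemma lintegral_tailFun_mul_meanDensity_pos (hU : TailFn U C M) (hUm : Measurable U)
    (hυ : IsRadialWeight υ) :
    ∫⁻ s in Set.Ioc (1 / 2 : ℝ) 1, ENNReal.ofReal (tailFun υ s * meanDensity n U p s) ≠ 0 := by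
  have hm : Measurable fun s => tailFun υ s * meanDensity n U p s :=
    hυ.monotone_tailFun.measurable.mul (measurable_meanDensity n hUm p)
  rw [← pos_iff_ne_zero, setLIntegral_pos_iff hm.ennreal_ofReal]
  have : Set.Ioc (1 / 2 : ℝ) 1 ⊆ Function.support
      (fun s => ENNReal.ofReal (tailFun υ s * meanDensity n U p s)) ∩ Set.Ioc (1 / 2 : ℝ) 1 := by
    intro s hs
    have h0 : 0 < s := by linarith [hs.1]
    have h1 := hυ.tailFun_pos h0 hs.2
    have h2 := hU.pos s h0 hs.2
    have h3 : 0 < meanDensity n U p s := by unfold meanDensity; positivity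
    exact ⟨(ENNReal.ofReal_pos.2 (mul_pos h1 h3)).ne', hs⟩
  refine lt_of_lt_of_le ?_ (measure_mono this)
  rw [Real.volume_Ioc, ENNReal.ofReal_pos]
  norm_num

/-- The part of the integral near the lower endpoint is controlled by the rest. -/
lemma lintegral_Ioc_le_of_doubling (hU : TailFn U C M) (hυ : IsRadialWeight υ) (hp : 0 < p) :
    ∃ K : ℝ≥0, ∀ a : ℝ, 0 < a → a < 1 / 4 →
      ∫⁻ s in Set.Ioc a 1, ENNReal.ofReal (tailFun υ s * meanDensity n U p s) ≤
        K * ∫⁻ s in Set.Ioc (2 * a) 1, ENNReal.ofReal (tailFun υ s * meanDensity n U p s) := by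
  have hC := hU.one_le
  set L := C * 4 ^ M with hL
  have hL0 : 0 < L := by positivity
  refine ⟨(L ^ p).toNNReal + 1, fun a ha0 ha1 => ?_⟩
  set h : ℝ → ℝ≥0∞ := fun s => ENNReal.ofReal (tailFun υ s * meanDensity n U p s) with hh
  set X : ℝ := tailFun υ (2 * a) * ((2 * a) ^ (n - 1) * (1 / U (4 * a)) ^ p) with hX
  have hN := hυ.tailFun_pos (s := 2 * a) (by linarith) (by linarith)
  have h4 := hU.pos (4 * a) (by linarith) (by linarith)
  have h1 := hU.pos a ha0 (by linarith)
  have hX0 : 0 ≤ X := by positivity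
  -- The piece `(a, 2a]` is compared with `(2a, 4a]`, which lies in `(0, 1]` because `a < 1 / 4`;
  -- both integrands are compared with the constant `X`.
  have hup : ∀ s ∈ Set.Ioc a (2 * a), h s ≤ ENNReal.ofReal (L ^ p * X) := fun s hs => by
    have hU4 : 1 / U a ≤ L * (1 / U (4 * a)) := by
      have := hU.le_of_le_mul (L := 4) (by norm_num) ha0 (by linarith) (s := 4 * a) (by linarith)
        (by linarith) le_rfl
      rw [mul_one_div, div_le_div_iff₀ h1 h4]
      linarith
    refine ENNReal.ofReal_le_ofReal ?_
    calc tailFun υ s * meanDensity n U p s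
        ≤ tailFun υ (2 * a) * ((2 * a) ^ (n - 1) * (1 / U a) ^ p) :=
          mul_le_mul (hυ.monotone_tailFun hs.2) (meanDensity_le hU hp ha0 hs.1.le hs.2 (by linarith))
            (meanDensity_nonneg hU p (ha0.trans hs.1) (by linarith [hs.2])) hN.le
      _ ≤ tailFun υ (2 * a) * ((2 * a) ^ (n - 1) * (L * (1 / U (4 * a))) ^ p) := by gcongr
      _ = L ^ p * X := by
          rw [Real.mul_rpow hL0.le (by positivity), hX]
          ring
  have hlo : ∀ s ∈ Set.Ioc (2 * a) (4 * a), ENNReal.ofReal X ≤ h s := fun s hs => by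
    refine ENNReal.ofReal_le_ofReal ?_
    have h0 : 0 < 2 * a := by linarith
    exact mul_le_mul (hυ.monotone_tailFun hs.1.le) (le_meanDensity hU hp h0 hs.1.le hs.2 (by linarith))
      (by positivity) (hυ.tailFun_pos (h0.trans hs.1) (by linarith [hs.2])).le
  have hI : ∫⁻ s in Set.Ioc a (2 * a), h s ≤
      (L ^ p).toNNReal * ∫⁻ s in Set.Ioc (2 * a) 1, h s := by
    calc ∫⁻ s in Set.Ioc a (2 * a), h s
        ≤ ∫⁻ _ in Set.Ioc a (2 * a), ENNReal.ofReal (L ^ p * X) :=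
          setLIntegral_mono' measurableSet_Ioc hup
      _ = ENNReal.ofReal (L ^ p) * (ENNReal.ofReal X * ENNReal.ofReal a) := by
          rw [setLIntegral_const, Real.volume_Ioc, ENNReal.ofReal_mul (by positivity), mul_assoc]
          congr 3
          ring
      _ ≤ ENNReal.ofReal (L ^ p) * (ENNReal.ofReal X * ENNReal.ofReal (4 * a - 2 * a)) := by
          gcongr
          linarith
      _ = ENNReal.ofReal (L ^ p) * ∫⁻ _ in Set.Ioc (2 * a) (4 * a), ENNReal.ofReal X := by
          rw [setLIntegral_const, Real.volume_Ioc]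
      _ ≤ ENNReal.ofReal (L ^ p) * ∫⁻ s in Set.Ioc (2 * a) (4 * a), h s :=
          mul_le_mul' le_rfl (setLIntegral_mono' measurableSet_Ioc hlo)
      _ ≤ _ := mul_le_mul' le_rfl (lintegral_mono_set (Set.Ioc_subset_Ioc_right (by linarith)))
  rw [← Set.Ioc_union_Ioc_eq_Ioc (by linarith : a ≤ 2 * a) (by linarith : 2 * a ≤ 1),
    lintegral_union measurableSet_Ioc (Set.Ioc_disjoint_Ioc_of_le le_rfl)]
  push_cast
  rw [add_mul, one_mul]
  gcongr

lemma IsRadialWeight.lintegral_Ioo_eq (hυ : IsRadialWeight υ) {x : ℝ} (hx : 0 ≤ x) :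
    ∫⁻ r in Set.Ioo x 1, ENNReal.ofReal ((Set.Ico (0 : ℝ) 1).indicator υ r) =
      ENNReal.ofReal (tailFun υ (1 - x)) := by
  rw [← hυ.lintegral_eq_tailFun (by linarith), sub_sub_cancel]
  refine setLIntegral_congr_fun measurableSet_Ioo fun r hr => ?_
  rw [Set.indicator_of_mem]
  exact ⟨hx.trans hr.1.le, hr.2⟩

/-- Upper estimate of weighted integrals of the sphere means. -/
lemma SizeLike.lintegral_profileMean_le (hn : 1 ≤ n) (hU : TailFn U C M) (hUm : Measurable U)
    (hF : SizeLike U F A) (hp : 0 < p) (hυ : IsRadialWeight υ) :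
    ∃ K : ℝ≥0, ∀ (e : Cn n) (R : ℝ), ‖e‖ = 1 → 6 / 7 < R → R < 1 →
      2 * n * (∫⁻ r in Set.Ioo (0 : ℝ) 1, ENNReal.ofReal (υ r) *
        ENNReal.ofReal (r ^ (2 * n - 1)) * profileMean p F e (r * R)) ≤
      K * ∫⁻ s in Set.Ioc (1 - R) 1, ENNReal.ofReal (tailFun υ s * meanDensity n U p s) := by
  obtain ⟨K₁, hK₁⟩ := hF.lintegral_sphere_le hn hU hUm hp
  -- `k` is a multiple large enough for the integral over `(1/2, 1]` to dominate the contribution of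
  -- the radii `r R ≤ 1 / 4`; it depends on neither `e` nor `R`.
  obtain ⟨k, hk⟩ := ENNReal.exists_nat_mul_gt
    (lintegral_tailFun_mul_meanDensity_pos (n := n) (p := p) hU hUm hυ)
    (ENNReal.mul_ne_top (ENNReal.ofReal_ne_top (r := (A / U (3 / 4)) ^ p))
      (ENNReal.ofReal_ne_top (r := tailFun υ 1)))
  refine ⟨2 * n * (K₁ + k), fun e R he hR hR1 => ?_⟩
  have hR0 : 0 < R := by linarith
  set u : ℝ → ℝ≥0∞ := fun r => ENNReal.ofReal ((Set.Ico (0 : ℝ) 1).indicator υ r) with hu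
  have hum : Measurable u := (measurable_indicator_weight hυ).ennreal_ofReal
  set d : ℝ → ℝ≥0∞ := fun s => ENNReal.ofReal (meanDensity n U p s) with hd
  have hdm : Measurable d := (measurable_meanDensity n hUm p).ennreal_ofReal
  set S := ENNReal.ofReal ((A / U (3 / 4)) ^ p) with hS
  have hpt : ∀ r ∈ Set.Ioo (0 : ℝ) 1, ENNReal.ofReal (υ r) *
        ENNReal.ofReal (r ^ (2 * n - 1)) * profileMean p F e (r * R) ≤
      K₁ * (u r * ∫⁻ s in Set.Ioc (1 - r * R) 1, d s) + S * u r := by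
    intro r hr
    have hur : ENNReal.ofReal (υ r) = u r := by
      rw [hu]
      simp only
      rw [Set.indicator_of_mem]
      exact ⟨hr.1.le, hr.2⟩
    have h1 : profileMean p F e (r * R) ≤ K₁ * (∫⁻ s in Set.Ioc (1 - r * R) 1, d s) + S := by
      rcases lt_or_ge (1 / 4) (r * R) with h | h
      · exact (hK₁ e _ he h (mul_lt_one_of_nonneg_of_lt_one_left hr.1.le hr.2 hR1.le)).trans
          le_self_add
      · exact (profileMean_le_of_small hn hU hF hp he (mul_nonneg hr.1.le hR0.le) h).trans
          le_add_self
    calc ENNReal.ofReal (υ r) * ENNReal.ofReal (r ^ (2 * n - 1)) * profileMean p F e (r * R)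
        ≤ u r * 1 * (K₁ * (∫⁻ s in Set.Ioc (1 - r * R) 1, d s) + S) := by
          rw [hur]
          gcongr
          exact ENNReal.ofReal_le_one.2 (pow_le_one₀ hr.1.le hr.2.le)
      _ = _ := by ring
  have hT := lintegral_mul_lintegral_Ioc hum hdm (c := 0) hR0
  have hmain : (∫⁻ r in Set.Ioo (0 : ℝ) 1, u r * ∫⁻ s in Set.Ioc (1 - r * R) 1, d s) ≤
      ∫⁻ s in Set.Ioc (1 - R) 1, ENNReal.ofReal (tailFun υ s * meanDensity n U p s) := by
    rw [hT]
    refine setLIntegral_mono' measurableSet_Ioc fun s hs => ?_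
    have hs0 : 0 < s := by linarith [hs.1]
    -- Dividing by `R < 1` only shortens the tail of `υ`, so no doubling is used here.
    have h1 : 1 - s ≤ max 0 ((1 - s) / R) := by
      refine le_trans ?_ (le_max_right _ _)
      rw [le_div_iff₀ hR0]
      nlinarith [hs.2]
    calc d s * ∫⁻ r in Set.Ioo (max 0 ((1 - s) / R)) 1, u r
        ≤ d s * ∫⁻ r in Set.Ioo (1 - s) 1, u r :=
          mul_le_mul' le_rfl (lintegral_mono_set (Set.Ioo_subset_Ioo_left h1))
      _ = _ := by
          rw [hυ.lintegral_Ioo_eq (by linarith [hs.2]), sub_sub_cancel, mul_comm,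
            ENNReal.ofReal_mul (hυ.tailFun_pos hs0 hs.2).le]
  have hrest : S * ∫⁻ r in Set.Ioo (0 : ℝ) 1, u r ≤
      k * ∫⁻ s in Set.Ioc (1 - R) 1, ENNReal.ofReal (tailFun υ s * meanDensity n U p s) := by
    rw [hυ.lintegral_Ioo_eq le_rfl, sub_zero]
    refine hk.le.trans (mul_le_mul' le_rfl (lintegral_mono_set ?_))
    exact Set.Ioc_subset_Ioc_left (by linarith)
  calc 2 * n * (∫⁻ r in Set.Ioo (0 : ℝ) 1, ENNReal.ofReal (υ r) *
        ENNReal.ofReal (r ^ (2 * n - 1)) * profileMean p F e (r * R))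
      ≤ 2 * n * (∫⁻ r in Set.Ioo (0 : ℝ) 1,
          (K₁ * (u r * ∫⁻ s in Set.Ioc (1 - r * R) 1, d s) + S * u r)) :=
        mul_le_mul' le_rfl (setLIntegral_mono' measurableSet_Ioo hpt)
    _ = 2 * n * (K₁ * (∫⁻ r in Set.Ioo (0 : ℝ) 1, u r * ∫⁻ s in Set.Ioc (1 - r * R) 1, d s) +
          S * ∫⁻ r in Set.Ioo (0 : ℝ) 1, u r) := by
        rw [lintegral_add_right _ (hum.const_mul S), lintegral_const_mul' _ _ ENNReal.coe_ne_top,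
          lintegral_const_mul _ hum]
    _ ≤ 2 * n * (K₁ * (∫⁻ s in Set.Ioc (1 - R) 1,
            ENNReal.ofReal (tailFun υ s * meanDensity n U p s)) +
          k * ∫⁻ s in Set.Ioc (1 - R) 1,
            ENNReal.ofReal (tailFun υ s * meanDensity n U p s)) := by gcongr
    _ = _ := by push_cast; ring

/-- Lower estimate of weighted integrals of the sphere means. -/
lemma SizeLike.le_lintegral_profileMean (hn : 1 ≤ n) (hU : TailFn U C M) (hUm : Measurable U)
    (hF : SizeLike U F A) (hFm : Measurable F) (hp : 0 < p) (hυ : IsDoubling υ) :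
    ∃ K : ℝ≥0, ∀ (e : Cn n) (R : ℝ), ‖e‖ = 1 → 6 / 7 < R → R < 1 →
      ∫⁻ s in Set.Ioc (1 - R) 1, ENNReal.ofReal (tailFun υ s * meanDensity n U p s) ≤
      K * (2 * n * (∫⁻ r in Set.Ioo (0 : ℝ) 1, ENNReal.ofReal (υ r) *
        ENNReal.ofReal (r ^ (2 * n - 1)) * profileMean p F e (r * R))) := by
  obtain ⟨K₁, hK₁⟩ := hF.le_lintegral_sphere hn hU hFm hp
  obtain ⟨K₂, hK₂⟩ := lintegral_Ioc_le_of_doubling (n := n) hU hυ.toIsRadialWeight hp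
  obtain ⟨D, M', hW⟩ := hυ.tailFn
  have hD := hW.one_le
  set L := D * 2 ^ M' with hL
  have hL0 : 0 < L := by positivity
  set c : ℝ≥0 := 3 ^ (2 * n - 1) with hc
  refine ⟨K₂ * (L.toNNReal * (c * K₁)), fun e R he hR hR1 => ?_⟩
  have hR0 : 0 < R := by linarith
  set u : ℝ → ℝ≥0∞ := fun r => ENNReal.ofReal ((Set.Ico (0 : ℝ) 1).indicator υ r) with hu
  have hum : Measurable u := (measurable_indicator_weight hυ.toIsRadialWeight).ennreal_ofReal
  set d : ℝ → ℝ≥0∞ := fun s => ENNReal.ofReal (meanDensity n U p s) with hd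
  have hdm : Measurable d := (measurable_meanDensity n hUm p).ennreal_ofReal
  -- With `r > 1 / 3` and `R > 6 / 7` one has `r R > 2 / 7 > 1 / 4`, so the lower bound for means
  -- applies; the Jacobian `r ^ (2 n - 1)` costs `3 ^ (2 n - 1)`.
  have hpt : ∀ r ∈ Set.Ioo (1 / 3 : ℝ) 1, u r * ∫⁻ s in Set.Ioc (1 - r * R) 1, d s ≤
      c * K₁ * (ENNReal.ofReal (υ r) *
        ENNReal.ofReal (r ^ (2 * n - 1)) * profileMean p F e (r * R)) := by
    intro r hr
    have hr0 : 0 < r := by linarith [hr.1]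
    have hur : ENNReal.ofReal (υ r) = u r := by
      rw [hu]
      simp only
      rw [Set.indicator_of_mem]
      exact ⟨hr0.le, hr.2⟩
    have h1 := hK₁ e (r * R) he (by nlinarith [hr.1])
      (mul_lt_one_of_nonneg_of_lt_one_left hr0.le hr.2 hR1.le)
    have h2 : (1 : ℝ≥0∞) ≤ c * ENNReal.ofReal (r ^ (2 * n - 1)) := by
      have h3 : (1 : ℝ) ≤ (3 * r) ^ (2 * n - 1) := one_le_pow₀ (by linarith [hr.1])
      have h4 : (c : ℝ≥0∞) = ENNReal.ofReal (3 ^ (2 * n - 1)) := by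
        rw [ENNReal.ofReal_pow (by norm_num), hc]
        push_cast
        congr 1
        simp
      rw [h4, ← ENNReal.ofReal_mul (by positivity), ← mul_pow]
      exact ENNReal.one_le_ofReal.2 h3
    calc u r * ∫⁻ s in Set.Ioc (1 - r * R) 1, d s
        ≤ u r * (1 * (K₁ * profileMean p F e (r * R))) := by
          rw [one_mul]
          exact mul_le_mul' le_rfl h1
      _ ≤ u r * (c * ENNReal.ofReal (r ^ (2 * n - 1)) * (K₁ * profileMean p F e (r * R))) := by
          gcongr
      _ = _ := by rw [hur]; ring
  have hT := lintegral_mul_lintegral_Ioc hum hdm (c := 1 / 3) hR0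
  have hmain : ∫⁻ s in Set.Ioc (2 * (1 - R)) 1,
      ENNReal.ofReal (tailFun υ s * meanDensity n U p s) ≤
      L.toNNReal * ∫⁻ r in Set.Ioo (1 / 3 : ℝ) 1, u r * ∫⁻ s in Set.Ioc (1 - r * R) 1, d s := by
    rw [hT, ← lintegral_const_mul' _ _ ENNReal.coe_ne_top]
    refine (setLIntegral_mono' measurableSet_Ioc fun s hs => ?_).trans
      (lintegral_mono_set (Set.Ioc_subset_Ioc_left (by linarith)))
    have hs0 : 0 < s := by linarith [hs.1]
    -- For `s > 2 (1 - R)` one has `R > 1 - s / 2`, hence `(1 - s / 2) R ≥ (1 - s / 2)² ≥ 1 - s`;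
    -- doubling of `υ` then replaces the tail at `s / 2` by the tail at `s`. The range `s ≤ 2 (1 -
    -- R)` is recovered by `lintegral_Ioc_le_of_doubling`.
    have h1 : max (1 / 3) ((1 - s) / R) ≤ 1 - s / 2 := by
      refine max_le (by linarith [hs.2]) ?_
      rw [div_le_iff₀ hR0]
      nlinarith [hs.1]
    have h2 : tailFun υ s ≤ L * tailFun υ (s / 2) :=
      hW.le_of_le_mul (by norm_num) (by positivity) (by linarith [hs.2]) hs0 hs.2 (by linarith)
    have h3 := hυ.tailFun_pos (s := s / 2) (by positivity) (by linarith [hs.2])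
    calc ENNReal.ofReal (tailFun υ s * meanDensity n U p s)
        ≤ ENNReal.ofReal (L * tailFun υ (s / 2)) * d s := by
          rw [ENNReal.ofReal_mul (hυ.tailFun_pos hs0 hs.2).le]
          gcongr
      _ = L.toNNReal * (d s * ∫⁻ r in Set.Ioo (1 - s / 2) 1, u r) := by
          rw [hυ.lintegral_Ioo_eq (by linarith [hs.2]), sub_sub_cancel, ENNReal.ofReal_mul hL0.le]
          change ENNReal.ofReal L * _ * _ = ENNReal.ofReal L * _
          ring
      _ ≤ _ := by
          refine mul_le_mul' le_rfl (mul_le_mul' le_rfl (lintegral_mono_set ?_))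
          exact Set.Ioo_subset_Ioo_left h1
  have hint : (∫⁻ r in Set.Ioo (1 / 3 : ℝ) 1, u r * ∫⁻ s in Set.Ioc (1 - r * R) 1, d s) ≤
      c * K₁ * (∫⁻ r in Set.Ioo (0 : ℝ) 1, ENNReal.ofReal (υ r) *
        ENNReal.ofReal (r ^ (2 * n - 1)) * profileMean p F e (r * R)) := by
    refine (setLIntegral_mono' measurableSet_Ioo hpt).trans ?_
    rw [lintegral_const_mul' _ _ (ENNReal.mul_ne_top ENNReal.coe_ne_top ENNReal.coe_ne_top)]
    exact mul_le_mul' le_rfl (lintegral_mono_set (Set.Ioo_subset_Ioo_left (by norm_num)))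
  have hone : (1 : ℝ≥0∞) ≤ 2 * n := by exact_mod_cast (by omega : 1 ≤ 2 * n)
  refine (hK₂ (1 - R) (by linarith) (by linarith)).trans ?_
  push_cast
  rw [mul_assoc]
  refine mul_le_mul' le_rfl (hmain.trans ?_)
  rw [mul_assoc]
  refine mul_le_mul' le_rfl (hint.trans ?_)
  exact mul_le_mul' le_rfl (le_mul_of_one_le_left' hone)

lemma comparable_bergmanNorm (hn : 1 ≤ n) (hω : IsDoubling ω) (hυ : IsDoubling υ) (hp : 0 < p)
    (hFm : Measurable F) (hF : SizeLike (kernelSize n ω q) F A) {f : Cn n → Cn n → ℂ}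
    (hf : ∀ z, ‖z‖ < 1 → Set.EqOn (f z) (fun w => F (inner ℂ z w)) (ball 0 1)) :
    ∃ C : ℝ≥0, 0 < C ∧ ∀ z : Cn n, 6 / 7 < ‖z‖ → ‖z‖ < 1 →
      Comparable C (bergmanNorm p υ (f z) ^ p) (ENNReal.ofReal (∫ t in (0 : ℝ)..‖z‖,
        hat υ t / (hat ω t ^ p * (1 - t) ^ (((n : ℝ) + q) * p - n + 1)))) := by
  obtain ⟨C, M, hU⟩ := hω.tailFn_kernelSize n q
  have hUm := hω.measurable_kernelSize n q
  obtain ⟨K₁, hK₁⟩ := hF.lintegral_profileMean_le hn hU hUm hp hυ.toIsRadialWeight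
  obtain ⟨K₂, hK₂⟩ := hF.le_lintegral_profileMean hn hU hUm hFm hp hυ
  have key : ∀ z : Cn n, ‖z‖ < 1 → ∃ e : Cn n, ‖e‖ = 1 ∧ bergmanNorm p υ (f z) ^ p =
      2 * n * ∫⁻ r in Set.Ioo (0 : ℝ) 1, ENNReal.ofReal (υ r) * ENNReal.ofReal (r ^ (2 * n - 1)) *
        profileMean p F e (r * ‖z‖) := fun z hz => by
    obtain ⟨e, he, hze⟩ := exists_eq_norm_smul hn z
    refine ⟨e, he, bergmanNorm_rpow_eq hn hυ.toIsRadialWeight hp hFm ?_⟩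
    rw [← hze]
    exact hf z hz
  have hup : ∃ K : ℝ≥0, ∀ z : Cn n, 6 / 7 < ‖z‖ ∧ ‖z‖ < 1 → bergmanNorm p υ (f z) ^ p ≤
      K * ENNReal.ofReal (∫ t in (0 : ℝ)..‖z‖,
        hat υ t / (hat ω t ^ p * (1 - t) ^ (((n : ℝ) + q) * p - n + 1))) := by
    refine ⟨K₁, fun z ⟨h0, h1⟩ => ?_⟩
    obtain ⟨e, he, hez⟩ := key z h1
    rw [hez, ofReal_integral_mul_kernelSize hn hω hυ.toIsRadialWeight hp q (norm_nonneg z) h1]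
    exact hK₁ e _ he h0 h1
  have hlo : ∃ K : ℝ≥0, ∀ z : Cn n, 6 / 7 < ‖z‖ ∧ ‖z‖ < 1 →
      ENNReal.ofReal (∫ t in (0 : ℝ)..‖z‖,
        hat υ t / (hat ω t ^ p * (1 - t) ^ (((n : ℝ) + q) * p - n + 1))) ≤
      K * bergmanNorm p υ (f z) ^ p := by
    refine ⟨K₂, fun z ⟨h0, h1⟩ => ?_⟩
    obtain ⟨e, he, hez⟩ := key z h1
    rw [hez, ofReal_integral_mul_kernelSize hn hω hυ.toIsRadialWeight hp q (norm_nonneg z) h1]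
    exact hK₂ e _ he h0 h1
  obtain ⟨C, hC0, hC⟩ := exists_comparable hup hlo
  exact ⟨C, hC0, fun z h0 h1 => hC z ⟨h0, h1⟩⟩

end BergmanNorm

end BergmanBall

end

theorem lemma3p2 (n : ℕ) (hn : 1 ≤ n) (p : ℝ) (hp : 0 < p) (ω : ℝ → ℝ)
    (hω : BergmanBall.IsDoubling ω) :
    (∃ C : ℝ≥0, 0 < C ∧ ∀ (r : ℝ) (z : BergmanBall.Cn n), 0 < r → r < 1 → ‖z‖ < 1 →
      1 / 4 < r * ‖z‖ →
      BergmanBall.Comparable C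
        (BergmanBall.integralMean p r (BergmanBall.bergmanKernel ω z) ^ p)
        (ENNReal.ofReal (∫ t in (0 : ℝ)..(r * ‖z‖),
          1 / (BergmanBall.hat ω t ^ p * (1 - t) ^ ((n : ℝ) * p - n + 1))))) ∧
    (∃ C : ℝ≥0, 0 < C ∧ ∀ (r : ℝ) (z : BergmanBall.Cn n), 0 < r → r < 1 → ‖z‖ < 1 →
      1 / 4 < r * ‖z‖ →
      BergmanBall.Comparable C
        (BergmanBall.integralMean p r
          (BergmanBall.radialDeriv (BergmanBall.bergmanKernel ω z)) ^ p)
        (ENNReal.ofReal (∫ t in (0 : ℝ)..(r * ‖z‖),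
          1 / (BergmanBall.hat ω t ^ p * (1 - t) ^ (((n : ℝ) + 1) * p - n + 1))))) ∧
    ∀ υ : ℝ → ℝ, BergmanBall.IsDoubling υ →
      (∃ C : ℝ≥0, 0 < C ∧ ∀ z : BergmanBall.Cn n, 6 / 7 < ‖z‖ → ‖z‖ < 1 →
        BergmanBall.Comparable C
          (BergmanBall.bergmanNorm p υ (BergmanBall.bergmanKernel ω z) ^ p)
          (ENNReal.ofReal (∫ t in (0 : ℝ)..‖z‖,
            BergmanBall.hat υ t /
              (BergmanBall.hat ω t ^ p * (1 - t) ^ ((n : ℝ) * p - n + 1))))) ∧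
      (∃ C : ℝ≥0, 0 < C ∧ ∀ z : BergmanBall.Cn n, 6 / 7 < ‖z‖ → ‖z‖ < 1 →
        BergmanBall.Comparable C
          (BergmanBall.bergmanNorm p υ
            (BergmanBall.radialDeriv (BergmanBall.bergmanKernel ω z)) ^ p)
          (ENNReal.ofReal (∫ t in (0 : ℝ)..‖z‖,
            BergmanBall.hat υ t /
              (BergmanBall.hat ω t ^ p * (1 - t) ^ (((n : ℝ) + 1) * p - n + 1))))) := by
  obtain ⟨F₀, F₁, hm₀, hm₁, ⟨A₀, hF₀⟩, ⟨A₁, hF₁⟩, hF⟩ := BergmanBall.exists_kernel_profile hn hω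
  have h₀ := fun z hz => (hF z hz).1
  have h₁ := fun z hz => (hF z hz).2
  refine ⟨?_, ?_, fun υ hυ => ⟨?_, ?_⟩⟩
  · simpa using BergmanBall.comparable_integralMean hn hω hp hm₀ hF₀ h₀
  · simpa using BergmanBall.comparable_integralMean hn hω hp hm₁ hF₁ h₁
  · simpa using BergmanBall.comparable_bergmanNorm hn hω hυ hp hm₀ hF₀ h₀
  · simpa using BergmanBall.comparable_bergmanNorm hn hω hυ hp hm₁ hF₁ h₁
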